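/- **Integral formulas for the magnetic Weyl product.** Let $d\in\mathbb N_0$, $\varepsilon>0$, $\lambda\in\mathbb R$, $\rho\in[0,1]$, $m_1,m_2\in\mathbb R$. *Notation.* For $X=(x,\xi)$, $Y=(y,\eta)$, $Z=(z,\zeta)$ in $\mathbb R^d\times\mathbb R^d$ put $\sigma(X,Y)=\xi\cdot y-x\cdot\eta$ and $(\mathcal F_\sigma u)(X)=(2\pi)^{-d}\int e^{i\sigma(X,X')}u(X')\,dX'$ (so $\mathcal F_\sigma^{-1}=\mathcal F_\sigma$). $S^m_\rho$ is the set of $f\in C^\infty(\mathbb R^d\times\mathbb R^d,\mathbb C)$ such that for all multi-indices $a,\alpha$ there is a $C$ with $|\partial_x^a\partial_\xi^\alpha f(x,\xi)|\le C\,(1+|\xi|^2)^{(m-|\alpha|\rho)/2}$. Let $B=(B_{lj})_{1\le l,j\le d}$ be a magnetic field on $\mathbb R^d$ whose real components are smooth and bounded together with all derivatives and which admits a vector potential, i.e. real functions $A_1,\dots,A_d\in C^\infty_{\mathrm{pol}}(\mathbb R^d)$ (smooth, all derivatives polynomially bounded) with $B_{lj}=\partial_{x_l}A_j-\partial_{x_j}A_l$.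 Let $\Gamma^B(\langle x,y,z\rangle)=\int_0^1\!\int_0^{1-s}\sum_{l,j}B_{lj}(x+s(y-x)+t(z-x))\,(y-x)_l(z-x)_j\,dt\,ds$ be the magnetic flux through the oriented triangle with corners $x,y,z$, and $\Omega^B_{\varepsilon,\lambda}(x,y,z)=e^{-i\frac{\lambda}{\varepsilon}\Gamma^B(\langle x,y,z\rangle)}$. For a vector potential $A$ as above the magnetic Weyl system is $$(W^A(Y)\varphi)(x)=e^{-i\varepsilon(x+\frac y2)\cdot\eta}\,e^{-i\frac{\lambda}{\varepsilon}\int_{[\varepsilon x,\varepsilon(x+y)]}A}\,\varphi(x+y),$$ and $\mathrm{Op}^A(f)=(2\pi)^{-d}\int (\mathcal F_\sigma^{-1}f)(Y)\,W^A(Y)\,dY$ on $\mathcal S(\mathbb R^d)$. An integral $\int u(v)\,dv$ is read as an oscillatory integral: for every Schwartz function $\chi$ with $\chi(0)=1$ it is the limit as $\delta\downarrow0$ of the absolutely convergent integrals $\int\chi(\delta v)u(v)\,dv$; integrals containing $\mathcal F_\sigma^{-1}f$ (and $\mathcal F_\sigma^{-1}g$) are read as limits of the absolutely convergent integrals with $f$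 (and $g$) replaced by $\chi_1(\delta\,\cdot)f$ (and $\chi_2(\delta\,\cdot)g$), for all Schwartz functions $\chi_1,\chi_2$ with value $1$ at $0$. (For $\mathrm{Op}^A(f)\varphi$ this is meant pointwise.) *Theorem.* Let $f\in S^{m_1}_\rho$ and $g\in S^{m_2}_\rho$. There is a function $f\sharp g\in S^{m_1+m_2}_\rho$ such that, for every vector potential $A$ of $B$ as above, the operators $\mathrm{Op}^A(f)$, $\mathrm{Op}^A(g)$, $\mathrm{Op}^A(f\sharp g)$ exist as continuous linear maps $\mathcal S(\mathbb R^d)\to\mathcal S(\mathbb R^d)$ and $$\mathrm{Op}^A(f)\,\mathrm{Op}^A(g)=\mathrm{Op}^A(f\sharp g),$$ and $f\sharp g$ is the only element of $\bigcup_{m'\in\mathbb R}S^{m'}_\rho$ with this property. Moreover, for every $X=(x,\xi)$, the following oscillatory integrals exist and $$\begin{aligned}(f\sharp g)(X)&=\frac1{(2\pi)^{2d}}\int dY\int dZ\; e^{i\sigma(X,Y+Z)}\,e^{i\frac\varepsilon2\sigma(Y,Z)}\,\Omega^B_{\varepsilon,\lambda}\bigl(x-\tfrac\varepsilon2(y+z),\,x+\tfrac\varepsilon2(y-z),\,x+\tfrac\varepsilon2(y+z)\bigr)\,(\mathcal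 F_\sigma^{-1}f)(Y)\,(\mathcal F_\sigma^{-1}g)(Z)\\&=\frac1{(\pi\varepsilon)^{2d}}\int d\tilde Y\int d\tilde Z\; e^{-i\frac2\varepsilon\sigma(\tilde Y-X,\tilde Z-X)}\,\Omega^B_{\varepsilon,\lambda}\bigl(x+\tilde y-\tilde z,\,-x+\tilde y+\tilde z,\,x-\tilde y+\tilde z\bigr)\,f(\tilde Y)\,g(\tilde Z).\end{aligned}$$ -/

import Mathlib

open MeasureTheory Filter Topology
open scoped SchwartzMap ContDiff

noncomputable section

namespace MagneticWeyl

/-- Configuration space `ℝ^d`. -/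
abbrev Conf (d : ℕ) : Type := EuclideanSpace ℝ (Fin d)

/-- Phase space `Ξ = ℝ^d × ℝ^d`; a point is `X = (x, ξ)`. -/
abbrev Phase (d : ℕ) : Type := Conf d × Conf d

/-- The standard basis vector `e_l` of `ℝ^d`. -/
def stdVec {d : ℕ} (l : Fin d) : Conf d := EuclideanSpace.single l 1

/-- The (non-magnetic) symplectic form `σ(X, Y) = ξ · y - x · η`. -/
def symp {d : ℕ} (X Y : Phase d) : ℝ := inner ℝ X.2 Y.1 - inner ℝ X.1 Y.2

/-- The phase factor `e^{i t}` for real `t`. -/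
def cis (t : ℝ) : ℂ := Complex.exp (Complex.I * (t : ℂ))

/-- The Japanese bracket `⟨ξ⟩ = (1 + |ξ|²)^{1/2}`. -/
def japanese {d : ℕ} (ξ : Conf d) : ℝ := Real.sqrt (1 + ‖ξ‖ ^ 2)

/-- `∂_{x_{a 0}} ⋯ ∂_{x_{a (p-1)}} ∂_{ξ_{b 0}} ⋯ ∂_{ξ_{b (q-1)}} f (X)`: as `a` and `b` vary, these
are all the mixed partial derivatives `∂_x^a ∂_ξ^α f` with `|a| = p` and `|α| = q`. -/
def mixedPartial {d p q : ℕ} (f : Phase d → ℂ) (a : Fin p → Fin d) (b : Fin q → Fin d)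
    (X : Phase d) : ℂ :=
  iteratedFDeriv ℝ (p + q) f X
    (Fin.append (fun i => ((stdVec (a i), 0) : Phase d)) (fun j => ((0, stdVec (b j)) : Phase d)))

/-- The Hörmander symbol class `S^m_ρ`. -/
def IsSymbol {d : ℕ} (m ρ : ℝ) (f : Phase d → ℂ) : Prop :=
  ContDiff ℝ ∞ f ∧
    ∀ (p q : ℕ) (a : Fin p → Fin d) (b : Fin q → Fin d), ∃ C : ℝ, ∀ X : Phase d,
      ‖mixedPartial f a b X‖ ≤ C * japanese X.2 ^ (m - (q : ℝ) * ρ)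

/-- `BC^∞(ℝ^d, ℝ)`: smooth, bounded, with bounded derivatives of all orders. -/
def IsBCInfty {d : ℕ} (u : Conf d → ℝ) : Prop :=
  ContDiff ℝ ∞ u ∧ ∀ n : ℕ, ∃ C : ℝ, ∀ x, ‖iteratedFDeriv ℝ n u x‖ ≤ C

/-- `A` is a vector potential of class `C^∞_pol` which represents `B`, i.e. `B = dA`,
`B_{lj} = ∂_l A_j - ∂_j A_l`. -/
def IsVectorPotential {d : ℕ} (A : Fin d → Conf d → ℝ) (B : Fin d → Fin d → Conf d → ℝ) : Prop :=
  (∀ l, (A l).HasTemperateGrowth) ∧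
    ∀ l j x, B l j x = fderiv ℝ (A j) x (stdVec l) - fderiv ℝ (A l) x (stdVec j)

/-- The standing assumption on the magnetic field: its components are of class `BC^∞` and
`B = dA` for some vector potential `A` with components in `C^∞_pol`. -/
def IsMagneticField {d : ℕ} (B : Fin d → Fin d → Conf d → ℝ) : Prop :=
  (∀ l j, IsBCInfty (B l j)) ∧ ∃ A, IsVectorPotential A B

/-- The circulation `∫_{[x, y]} A` of the one-form `A` along the segment from `x` to `y`. -/
def circulation {d : ℕ} (A : Fin d → Conf d → ℝ) (x y : Conf d) : ℝ :=
  ∫ s in (0 : ℝ)..1, ∑ l, (y l - x l) * A l (x + s • (y - x))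

/-- The scaled circulation `Γ^A_ε([x, y]) = ε⁻¹ ∫_{[ε x, ε y]} A`. -/
def scaledCirculation {d : ℕ} (ε : ℝ) (A : Fin d → Conf d → ℝ) (x y : Conf d) : ℝ :=
  ε⁻¹ * circulation A (ε • x) (ε • y)

/-- The magnetic flux `Γ^B(⟨x, y, z⟩) = ∫_{⟨x, y, z⟩} B` of the two-form
`B = ½ ∑_{l,j} B_{lj} dx_l ∧ dx_j` through the oriented triangle with corners `x`, `y`, `z`,
parametrized by `x + s (y - x) + t (z - x)`, `0 ≤ s`, `0 ≤ t`, `s + t ≤ 1`. -/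
def flux {d : ℕ} (B : Fin d → Fin d → Conf d → ℝ) (x y z : Conf d) : ℝ :=
  ∫ s in (0 : ℝ)..1, ∫ t in (0 : ℝ)..(1 - s),
    ∑ l, ∑ j, B l j (x + s • (y - x) + t • (z - x)) * (y l - x l) * (z j - x j)

/-- `Ω^B_{ε,λ}(x, y, z) = e^{- i (λ/ε) Γ^B(⟨x, y, z⟩)}`. -/
def fluxExp {d : ℕ} (ε lam : ℝ) (B : Fin d → Fin d → Conf d → ℝ) (x y z : Conf d) : ℂ :=
  cis (-(lam / ε * flux B x y z))

/-- The magnetic Weyl system `W(Y) = e^{- i σ(Y, (Q, Π^A))}`, `Q = ε x̂`, `Π^A = - i ∇ - λ A(Q)`: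
`(W(Y) φ)(x) = e^{- i ε (x + y/2) · η} e^{- i λ Γ^A_ε([x, x + y])} φ(x + y)`. -/
def weylSystem {d : ℕ} (ε lam : ℝ) (A : Fin d → Conf d → ℝ) (Y : Phase d) (φ : Conf d → ℂ)
    (x : Conf d) : ℂ :=
  cis (-(ε * inner ℝ (x + (2 : ℝ)⁻¹ • Y.1) Y.2)) *
    cis (-(lam * scaledCirculation ε A x (x + Y.1))) * φ (x + Y.1)

/-- The symplectic Fourier transform `(F_σ u)(X) = (2π)^{-d} ∫ e^{i σ(X, X')} u(X') dX'`.
It is its own inverse, `F_σ⁻¹ = F_σ`. -/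
def sympFourier {d : ℕ} (u : Phase d → ℂ) (X : Phase d) : ℂ :=
  ((((2 * Real.pi) ^ d : ℝ) : ℂ))⁻¹ * ∫ X' : Phase d, cis (symp X X') * u X'

/-- The regularization `v ↦ χ(δ v) u(v)` of a function `u` by a cut-off `χ`; for a Schwartz function
`χ` with `χ(0) = 1` and a symbol `u` it decays rapidly for `δ > 0`, and it tends to `u`
as `δ → 0`. -/
def regularize {V : Type*} [NormedAddCommGroup V] [NormedSpace ℝ V] (χ : 𝓢(V, ℂ)) (δ : ℝ)
    (u : V → ℂ) (v : V) : ℂ :=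
  χ (δ • v) * u v

/-- The oscillatory integral `∫ u(v) dv` exists and has the value `c`: for every Schwartz cut-off `χ`
with `χ(0) = 1` the integrals `∫ χ(δ v) u(v) dv`, `δ > 0`, converge absolutely, and they tend
to `c` as `δ → 0`. -/
def HasOscIntegral {V : Type*} [NormedAddCommGroup V] [NormedSpace ℝ V] [MeasureSpace V]
    (u : V → ℂ) (c : ℂ) : Prop :=
  ∀ χ : 𝓢(V, ℂ), χ 0 = 1 →
    (∀ δ : ℝ, 0 < δ → Integrable (regularize χ δ u)) ∧
      Tendsto (fun δ : ℝ => ∫ v, regularize χ δ u v) (𝓝[>] 0) (𝓝 c)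

/-- The oscillatory integral `∫ k(Y) (F_σ⁻¹ f)(Y) dY` exists and has the value `c`. As `f` need not be
integrable, `F_σ⁻¹ f` is a tempered distribution, the limit of the functions
`F_σ⁻¹ (χ(δ ·) f)`, and the integral is the limit of the corresponding absolutely
convergent integrals. -/
def HasFourierOscIntegral {d : ℕ} (k : Phase d → ℂ) (f : Phase d → ℂ) (c : ℂ) : Prop :=
  ∀ χ : 𝓢(Phase d, ℂ), χ 0 = 1 →
    (∀ δ : ℝ, 0 < δ → Integrable fun Y => k Y * sympFourier (regularize χ δ f) Y) ∧
      Tendsto (fun δ : ℝ => ∫ Y, k Y * sympFourier (regularize χ δ f) Y) (𝓝[>] 0) (𝓝 c)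

/-- The oscillatory integral `∫ ∫ k(Y, Z) (F_σ⁻¹ f)(Y) (F_σ⁻¹ g)(Z) dY dZ` exists and has the
value `c`, with the same reading of `F_σ⁻¹ f` and `F_σ⁻¹ g`. -/
def HasFourierOscIntegral₂ {d : ℕ} (k : Phase d → Phase d → ℂ) (f g : Phase d → ℂ) (c : ℂ) :
    Prop :=
  ∀ χ₁ χ₂ : 𝓢(Phase d, ℂ), χ₁ 0 = 1 → χ₂ 0 = 1 →
    (∀ δ : ℝ, 0 < δ → Integrable fun P : Phase d × Phase d =>
      k P.1 P.2 * sympFourier (regularize χ₁ δ f) P.1 * sympFourier (regularize χ₂ δ g) P.2) ∧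
      Tendsto (fun δ : ℝ => ∫ P : Phase d × Phase d,
        k P.1 P.2 * sympFourier (regularize χ₁ δ f) P.1 * sympFourier (regularize χ₂ δ g) P.2)
        (𝓝[>] 0) (𝓝 c)

/-- `T : 𝓢(ℝ^d) → 𝓢(ℝ^d)` is the magnetic Weyl quantization of `f`,
`T = Op^A_{ε,λ}(f) = (2π)^{-d} ∫ (F_σ⁻¹ f)(Y) W(Y) dY`. -/
def IsQuantization {d : ℕ} (ε lam : ℝ) (A : Fin d → Conf d → ℝ) (f : Phase d → ℂ)
    (T : 𝓢(Conf d, ℂ) →L[ℂ] 𝓢(Conf d, ℂ)) : Prop :=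
  ∀ (φ : 𝓢(Conf d, ℂ)) (x : Conf d),
    HasFourierOscIntegral (fun Y => weylSystem ε lam A Y φ x) f
      ((((2 * Real.pi) ^ d : ℝ) : ℂ) * T φ x)

/-- `h` is a magnetic Weyl product of `f` and `g`: the quantizations of `f`, `g` and `h` exist and
`Op^A_{ε,λ}(f) Op^A_{ε,λ}(g) = Op^A_{ε,λ}(h)`. -/
def IsWeylProduct {d : ℕ} (ε lam : ℝ) (A : Fin d → Conf d → ℝ) (f g h : Phase d → ℂ) : Prop :=
  ∃ F G : 𝓢(Conf d, ℂ) →L[ℂ] 𝓢(Conf d, ℂ),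
    IsQuantization ε lam A f F ∧ IsQuantization ε lam A g G ∧ IsQuantization ε lam A h (F.comp G)

/-- The kernel `e^{i σ(X, Y+Z)} e^{i (ε/2) σ(Y, Z)} Ω^B_{ε,λ}(x - ε/2 (y+z), x + ε/2 (y-z),
x + ε/2 (y+z))` of the magnetic Weyl product, acting on Fourier transforms of symbols. -/
def productKernel {d : ℕ} (ε lam : ℝ) (B : Fin d → Fin d → Conf d → ℝ) (X Y Z : Phase d) : ℂ :=
  cis (symp X (Y + Z)) * cis (ε / 2 * symp Y Z) *
    fluxExp ε lam B (X.1 - (ε / 2) • (Y.1 + Z.1)) (X.1 + (ε / 2) • (Y.1 - Z.1))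
      (X.1 + (ε / 2) • (Y.1 + Z.1))

/-- The integrand `e^{- i (2/ε) σ(Y - X, Z - X)} Ω^B_{ε,λ}(x + y - z, - x + y + z, x - y + z) f(Y) g(Z)`
of the product formula on phase space. -/
def productIntegrand {d : ℕ} (ε lam : ℝ) (B : Fin d → Fin d → Conf d → ℝ) (f g : Phase d → ℂ)
    (X : Phase d) (P : Phase d × Phase d) : ℂ :=
  cis (-(2 / ε * symp (P.1 - X) (P.2 - X))) *
    fluxExp ε lam B (X.1 + P.1.1 - P.2.1) (-X.1 + P.1.1 + P.2.1) (X.1 - P.1.1 + P.2.1) *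
    f P.1 * g P.2

end MagneticWeyl

end

open MeasureTheory Filter Topology
open scoped SchwartzMap ContDiff

noncomputable section

set_option linter.unusedSectionVars false
set_option linter.unusedVariables false

/-! The product is defined by the phase-space formula itself. After translation by $(X,X)$ the
second integral of the theorem has the fixed quadratic phase $-\frac2\varepsilon\sigma(Y,Z)$, and
`weylProd` is the resulting oscillatory integral. Only `B` enters, so one function serves all vector
potentials.

Convergence. The amplitude is a flux factor times $f(X+Y)g(X+Z)$. Each position derivative of the
flux factor may cost two powers of the relative positions, while momentum derivatives do not see it.
Integrating by parts along position directions gains decay in the momenta but worsens the growth in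
the positions, by an amount fixed once the number of steps is fixed. Integrating by parts afterwards
along momentum directions gains decay in the positions at no cost. In this order the procedure ends
with an absolutely convergent integral (`OscPhase.norm_stepOps_ops_le`). The calculus is run for
families of amplitudes with parameters; it therefore also yields smoothness and uniform bounds
(`OscPhase.isAmp_osc`) and the independence of the regularization (`OscPhase.tendsto_osc`).

Symbol class. Symbol weights are moderate under translation, so the product of the weights at $X$
comes out of the integral (`isAmp_weylProd`). As the flux does not depend on momenta, $\partial_\xi$
obeys the Leibniz rule for the product (`dirDeriv_weylProd`), and every momentum derivative lowers
the order by $\rho$.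

Composition. For Schwartz symbols the quantization is an integral operator whose kernel is the
parallel transport along $[\varepsilon x,\varepsilon(x+y)]$ times the partial Fourier transform of
the symbol at the midpoint (`quantFun_eq_integral`). When two such operators are composed, the two
transports differ from the transport along the third side by the flux through the triangle: this is
Stokes' theorem, `flux_eq_circulation`. Fourier inversion identifies the composed kernel with that
of the product (`partialFourier_weylProd`), and also converts the second integral formula into the
first (`integral_productKernel`). General symbols are limits of regularized ones; all errors are
$O(\delta)$ in suitable seminorms (`quantFun_comp`).

Uniqueness. A symbol $u$ with $\mathrm{Op}(u)=0$ has $\mathrm{Op}(u\sharp v)=0$ for every Schwartz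
function $v$. Here $u\sharp v$ is Schwartz, and quantization is injective on Schwartz functions
because the kernel determines the partial Fourier transform; hence $u\sharp v=0$. The trace identity
$\int u\sharp v=\int uv$ (`integral_weylProd`), extended by regularizing $u$, then gives $\int uv=0$
for all $v$, so $u=0$ (`eq_zero_of_quantFun`). -/

namespace MagneticWeyl

/-! ### Amplitudes: families of smooth functions with weighted derivative bounds. -/

section Amplitudes

variable {D D' H H' F : Type*} [NormedAddCommGroup D] [NormedSpace ℝ D]
  [NormedAddCommGroup D'] [NormedSpace ℝ D'] [NormedAddCommGroup H] [NormedSpace ℝ H]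
  [NormedAddCommGroup H'] [NormedSpace ℝ H'] {ι ι' κ : Type*}

/-- The derivative of `f` in the direction `e`. -/
def dirDeriv [NormedAddCommGroup F] [NormedSpace ℝ F] (e : D) (f : D → F) (p : D) : F :=
  fderiv ℝ f p e

lemma contDiff_dirDeriv [NormedAddCommGroup F] [NormedSpace ℝ F] {f : D → F}
    (hf : ContDiff ℝ ∞ f) (e : D) : ContDiff ℝ ∞ (dirDeriv e f) :=
  (hf.fderiv_right (m := ∞) (by simp)).clm_apply contDiff_const

lemma dirDeriv_zero_right [NormedAddCommGroup F] [NormedSpace ℝ F] (f : D → F) :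
    dirDeriv (0 : D) f = 0 := by
  ext p; simp [dirDeriv]

lemma dirDeriv_add {f g : D → ℂ} (hf : ContDiff ℝ ∞ f) (hg : ContDiff ℝ ∞ g) (e : D) :
    dirDeriv e (fun p => f p + g p) = fun p => dirDeriv e f p + dirDeriv e g p := by
  ext p
  simp only [dirDeriv]
  rw [fderiv_fun_add (hf.differentiable (by simp) p) (hg.differentiable (by simp) p)]
  rfl

lemma dirDeriv_sub {f g : D → ℂ} (hf : ContDiff ℝ ∞ f) (hg : ContDiff ℝ ∞ g) (e : D) :
    dirDeriv e (fun p => f p - g p) = fun p => dirDeriv e f p - dirDeriv e g p := by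
  ext p
  simp only [dirDeriv]
  rw [fderiv_fun_sub (hf.differentiable (by simp) p) (hg.differentiable (by simp) p)]
  rfl

lemma dirDeriv_mul {f g : D → ℂ} (hf : ContDiff ℝ ∞ f) (hg : ContDiff ℝ ∞ g) (e : D) :
    dirDeriv e (fun p => f p * g p) = fun p => dirDeriv e f p * g p + f p * dirDeriv e g p := by
  ext p
  simp only [dirDeriv]
  rw [fderiv_fun_mul (hf.differentiable (by simp) p) (hg.differentiable (by simp) p)]
  simp only [add_apply, smul_apply, smul_eq_mul]
  ring

lemma dirDeriv_const_mul {f : D → ℂ} (hf : ContDiff ℝ ∞ f) (c : ℂ) (e : D) :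
    dirDeriv e (fun p => c * f p) = fun p => c * dirDeriv e f p := by
  ext p
  simp only [dirDeriv]
  rw [fderiv_const_mul (hf.differentiable (by simp) p)]
  rfl

lemma dirDeriv_comp_clm {f : D → ℂ} (hf : ContDiff ℝ ∞ f) (A : D' →L[ℝ] D) (e : D') :
    dirDeriv e (fun p => f (A p)) = fun p => dirDeriv (A e) f (A p) := by
  ext p
  simp only [dirDeriv]
  rw [fderiv_fun_comp (f := fun p => A p) p (hf.differentiable (by simp) _) A.differentiableAt]
  simp

lemma dirDeriv_clm (L : D →L[ℝ] ℂ) (e : D) : dirDeriv e (fun p => L p) = fun _ => L e := by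
  ext p
  simp [dirDeriv]

lemma dirDeriv_comm {f : D → ℂ} (hf : ContDiff ℝ ∞ f) (e e' : D) :
    dirDeriv e (dirDeriv e' f) = dirDeriv e' (dirDeriv e f) := by
  ext p
  have h2 : DifferentiableAt ℝ (fderiv ℝ f) p :=
    (hf.fderiv_right (m := ∞) (by simp)).differentiable (by simp) p
  have key : ∀ a b : D, dirDeriv a (dirDeriv b f) p = fderiv ℝ (fderiv ℝ f) p a b := by
    intro a b
    change fderiv ℝ (fun p => (fderiv ℝ f p) b) p a = _
    rw [fderiv_clm_apply h2 (differentiableAt_const b)]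
    simp
  rw [key, key]
  exact (hf.contDiffAt.isSymmSndFDerivAt (by simpa using WithTop.coe_le_coe.mpr (le_top : (2 : ℕ∞) ≤ ⊤))).eq e e'

/-- `1` if `e` has a nonzero horizontal part, and `0` otherwise. -/
def step (hz : D →L[ℝ] H) (e : D) : ℕ := by
  classical exact if hz e = 0 then 0 else 1

lemma step_le_one (hz : D →L[ℝ] H) (e : D) : step hz e ≤ 1 := by
  unfold step; split_ifs <;> simp

lemma step_of_eq_zero {hz : D →L[ℝ] H} {e : D} (h : hz e = 0) : step hz e = 0 := by
  unfold step; simp [h]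

lemma step_of_ne_zero {hz : D →L[ℝ] H} {e : D} (h : hz e ≠ 0) : step hz e = 1 := by
  unfold step; simp [h]

/-- The functions `a i` are smooth, and their iterated directional derivatives of order at most `n`
are bounded, uniformly in `i`, by multiples of the weights `W k i`, where `k` counts the
derivatives in directions with nonzero horizontal part. -/
def IsAmpN (hz : D →L[ℝ] H) : ℕ → (ℕ → ι → D → ℝ) → (ι → D → ℂ) → Prop
  | 0, W, a => (∀ i, ContDiff ℝ ∞ (a i)) ∧ ∃ C, ∀ i p, ‖a i p‖ ≤ C * W 0 i p
  | n + 1, W, a => ((∀ i, ContDiff ℝ ∞ (a i)) ∧ ∃ C, ∀ i p, ‖a i p‖ ≤ C * W 0 i p) ∧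
      ∀ e : D, IsAmpN hz n (fun k => W (k + step hz e)) (fun i => dirDeriv e (a i))

/-- The bounds of `IsAmpN` for derivatives of all orders. -/
def IsAmp (hz : D →L[ℝ] H) (W : ℕ → ι → D → ℝ) (a : ι → D → ℂ) : Prop :=
  ∀ n, IsAmpN hz n W a

variable {hz : D →L[ℝ] H} {n : ℕ} {W W' W₁ W₂ W₃ : ℕ → ι → D → ℝ} {a b : ι → D → ℂ}

lemma IsAmpN.base (h : IsAmpN hz n W a) :
    (∀ i, ContDiff ℝ ∞ (a i)) ∧ ∃ C, ∀ i p, ‖a i p‖ ≤ C * W 0 i p := by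
  cases n with
  | zero => exact h
  | succ n => exact h.1

lemma IsAmpN.smooth (h : IsAmpN hz n W a) (i : ι) : ContDiff ℝ ∞ (a i) := h.base.1 i

lemma IsAmp.smooth (h : IsAmp hz W a) (i : ι) : ContDiff ℝ ∞ (a i) := (h 0).smooth i

lemma IsAmpN.bound (h : IsAmpN hz n W a) (hW : ∀ k i p, 0 ≤ W k i p) :
    ∃ C, 0 ≤ C ∧ ∀ i p, ‖a i p‖ ≤ C * W 0 i p := by
  obtain ⟨C, hC⟩ := h.base.2
  exact ⟨|C|, abs_nonneg C, fun i p =>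
    (hC i p).trans (mul_le_mul_of_nonneg_right (le_abs_self C) (hW 0 i p))⟩

lemma IsAmp.bound (h : IsAmp hz W a) (hW : ∀ k i p, 0 ≤ W k i p) :
    ∃ C, 0 ≤ C ∧ ∀ i p, ‖a i p‖ ≤ C * W 0 i p := (h 0).bound hW

lemma IsAmp.deriv (h : IsAmp hz W a) (e : D) :
    IsAmp hz (fun k => W (k + step hz e)) (fun i => dirDeriv e (a i)) :=
  fun n => (h (n + 1)).2 e

lemma IsAmpN.mono (h : IsAmpN hz n W a) (hW : ∀ k i p, 0 ≤ W k i p)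
    (hWW : ∀ k, ∃ C, ∀ i p, W k i p ≤ C * W' k i p) : IsAmpN hz n W' a := by
  induction n generalizing W W' a with
  | zero =>
    obtain ⟨C, hC0, hC⟩ := h.bound hW
    obtain ⟨C', hC'⟩ := hWW 0
    refine ⟨h.1, C * C', fun i p => (hC i p).trans ?_⟩
    rw [mul_assoc]
    exact mul_le_mul_of_nonneg_left (hC' i p) hC0
  | succ n ih =>
    obtain ⟨C, hC0, hC⟩ := h.bound hW
    obtain ⟨C', hC'⟩ := hWW 0
    refine ⟨⟨h.1.1, C * C', fun i p => (hC i p).trans ?_⟩, fun e => ?_⟩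
    · rw [mul_assoc]
      exact mul_le_mul_of_nonneg_left (hC' i p) hC0
    · exact ih (h.2 e) (fun k => hW _) (fun k => hWW _)

lemma IsAmp.mono (h : IsAmp hz W a) (hW : ∀ k i p, 0 ≤ W k i p)
    (hWW : ∀ k, ∃ C, ∀ i p, W k i p ≤ C * W' k i p) : IsAmp hz W' a :=
  fun n => (h n).mono hW hWW

lemma IsAmpN.reindex (h : IsAmpN hz n W a) (φ : ι' → ι) :
    IsAmpN hz n (fun k i => W k (φ i)) (fun i => a (φ i)) := by
  induction n generalizing W a with
  | zero => exact ⟨fun i => h.1 _, h.2.imp fun C hC i => hC _⟩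
  | succ n ih =>
    exact ⟨⟨fun i => h.1.1 _, h.1.2.imp fun C hC i => hC _⟩, fun e => ih (h.2 e)⟩

lemma IsAmp.reindex (h : IsAmp hz W a) (φ : ι' → ι) :
    IsAmp hz (fun k i => W k (φ i)) (fun i => a (φ i)) := fun n => (h n).reindex φ

lemma isAmpN_zero (hW : ∀ k i p, 0 ≤ W k i p) : IsAmpN hz n W (fun _ _ => 0) := by
  induction n generalizing W with
  | zero => exact ⟨fun i => contDiff_const, 0, fun i p => by simp⟩
  | succ n ih =>
    refine ⟨⟨fun i => contDiff_const, 0, fun i p => by simp⟩, fun e => ?_⟩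
    have : (fun _ : ι => dirDeriv e (fun _ : D => (0 : ℂ))) = fun _ _ => 0 := by
      ext i p; simp [dirDeriv]
    rw [this]
    exact ih fun k => hW _

lemma IsAmpN.add (ha : IsAmpN hz n W a) (hb : IsAmpN hz n W b) :
    IsAmpN hz n W (fun i p => a i p + b i p) := by
  induction n generalizing W a b with
  | zero =>
    obtain ⟨ha, C, hC⟩ := ha
    obtain ⟨hb, C', hC'⟩ := hb
    refine ⟨fun i => (ha i).add (hb i), C + C', fun i p => (norm_add_le _ _).trans ?_⟩
    rw [add_mul]
    exact add_le_add (hC i p) (hC' i p)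
  | succ n ih =>
    obtain ⟨⟨ha, C, hC⟩, ha'⟩ := ha
    obtain ⟨⟨hb, C', hC'⟩, hb'⟩ := hb
    refine ⟨⟨fun i => (ha i).add (hb i), C + C', fun i p => (norm_add_le _ _).trans ?_⟩,
      fun e => ?_⟩
    · rw [add_mul]
      exact add_le_add (hC i p) (hC' i p)
    · simp only [dirDeriv_add (ha _) (hb _)]
      exact ih (ha' e) (hb' e)

lemma IsAmp.add (ha : IsAmp hz W a) (hb : IsAmp hz W b) :
    IsAmp hz W (fun i p => a i p + b i p) := fun n => (ha n).add (hb n)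

/-- Multiplication by constants, which may depend on the index. -/
lemma IsAmpN.const_mul (ha : IsAmpN hz n W a) (c : ι → ℂ) :
    IsAmpN hz n (fun k i p => ‖c i‖ * W k i p) (fun i p => c i * a i p) := by
  have h0 : ∀ {W : ℕ → ι → D → ℝ} {a : ι → D → ℂ},
      ((∀ i, ContDiff ℝ ∞ (a i)) ∧ ∃ C, ∀ i p, ‖a i p‖ ≤ C * W 0 i p) →
      ((∀ i, ContDiff ℝ ∞ (fun p => c i * a i p)) ∧
        ∃ C, ∀ i p, ‖c i * a i p‖ ≤ C * (‖c i‖ * W 0 i p)) := by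
    rintro W a ⟨ha, C, hC⟩
    refine ⟨fun i => contDiff_const.mul (ha i), C, fun i p => ?_⟩
    rw [norm_mul, mul_left_comm]
    exact mul_le_mul_of_nonneg_left (hC i p) (norm_nonneg _)
  induction n generalizing W a with
  | zero => exact h0 ha
  | succ n ih =>
    refine ⟨h0 ha.1, fun e => ?_⟩
    simp only [dirDeriv_const_mul (ha.1.1 _)]
    exact ih (ha.2 e)

lemma IsAmpN.smul (ha : IsAmpN hz n W a) (c : ℂ) (hW : ∀ k i p, 0 ≤ W k i p) :
    IsAmpN hz n W (fun i p => c * a i p) :=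
  (ha.const_mul fun _ => c).mono (fun k i p => mul_nonneg (norm_nonneg _) (hW k i p))
    fun _ => ⟨‖c‖, fun _ _ => le_rfl⟩

lemma IsAmp.smul (ha : IsAmp hz W a) (c : ℂ) (hW : ∀ k i p, 0 ≤ W k i p) :
    IsAmp hz W (fun i p => c * a i p) := fun n => (ha n).smul c hW

lemma IsAmpN.sub (ha : IsAmpN hz n W a) (hb : IsAmpN hz n W b) (hW : ∀ k i p, 0 ≤ W k i p) :
    IsAmpN hz n W (fun i p => a i p - b i p) := by
  simpa [sub_eq_add_neg] using ha.add (hb.smul (-1) hW)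

lemma IsAmp.sub (ha : IsAmp hz W a) (hb : IsAmp hz W b) (hW : ∀ k i p, 0 ≤ W k i p) :
    IsAmp hz W (fun i p => a i p - b i p) := fun n => (ha n).sub (hb n) hW

lemma IsAmpN.sum {s : Finset κ} {a : κ → ι → D → ℂ} (ha : ∀ j ∈ s, IsAmpN hz n W (a j))
    (hW : ∀ k i p, 0 ≤ W k i p) : IsAmpN hz n W (fun i p => ∑ j ∈ s, a j i p) := by
  classical
  induction s using Finset.induction_on with
  | empty => simpa using isAmpN_zero hW
  | insert j s hj ih =>
    simp only [Finset.sum_insert hj]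
    exact (ha j (Finset.mem_insert_self j s)).add
      (ih fun j hj => ha j (Finset.mem_insert_of_mem hj))

lemma IsAmp.sum {s : Finset κ} {a : κ → ι → D → ℂ} (ha : ∀ j ∈ s, IsAmp hz W (a j))
    (hW : ∀ k i p, 0 ≤ W k i p) : IsAmp hz W (fun i p => ∑ j ∈ s, a j i p) :=
  fun n => IsAmpN.sum (fun j hj => ha j hj n) hW

/-- Leibniz' rule, where the second factor is controlled by a family of weights. -/
lemma IsAmpN.mul_family {V : κ → ℕ → ι → D → ℝ} (ha : IsAmpN hz n W₁ a)
    (hb : ∀ j, IsAmpN hz n (V j) b) (hW₁ : ∀ k i p, 0 ≤ W₁ k i p) (hV : ∀ j k i p, 0 ≤ V j k i p)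
    (h : ∀ j k, ∃ l C, ∀ i p, W₁ j i p * V l k i p ≤ C * W₃ (j + k) i p) :
    IsAmpN hz n W₃ (fun i p => a i p * b i p) := by
  have h0 : ∀ {W₁ W₃ : ℕ → ι → D → ℝ} {V : κ → ℕ → ι → D → ℝ} {a b : ι → D → ℂ} {n : ℕ},
      IsAmpN hz n W₁ a → (∀ j, IsAmpN hz n (V j) b) → (∀ k i p, 0 ≤ W₁ k i p) →
      (∀ j k i p, 0 ≤ V j k i p) →
      (∀ j k, ∃ l C, ∀ i p, W₁ j i p * V l k i p ≤ C * W₃ (j + k) i p) →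
      ((∀ i, ContDiff ℝ ∞ (fun p => a i p * b i p)) ∧
        ∃ C, ∀ i p, ‖a i p * b i p‖ ≤ C * W₃ 0 i p) := by
    intro W₁ W₃ V a b n ha hb hW₁ hV h
    obtain ⟨l, C₃, hC₃⟩ := h 0 0
    obtain ⟨C₁, hC₁, h₁⟩ := ha.bound hW₁
    obtain ⟨C₂, hC₂, h₂⟩ := (hb l).bound (hV l)
    refine ⟨fun i => (ha.smooth i).mul ((hb l).smooth i), C₁ * C₂ * C₃, fun i p => ?_⟩
    calc ‖a i p * b i p‖ = ‖a i p‖ * ‖b i p‖ := norm_mul _ _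
      _ ≤ (C₁ * W₁ 0 i p) * (C₂ * V l 0 i p) :=
          mul_le_mul (h₁ i p) (h₂ i p) (norm_nonneg _) (mul_nonneg hC₁ (hW₁ _ _ _))
      _ = C₁ * C₂ * (W₁ 0 i p * V l 0 i p) := by ring
      _ ≤ C₁ * C₂ * (C₃ * W₃ 0 i p) :=
          mul_le_mul_of_nonneg_left (hC₃ i p) (mul_nonneg hC₁ hC₂)
      _ = _ := by ring
  induction n generalizing W₁ W₃ V a b with
  | zero => exact h0 ha hb hW₁ hV h
  | succ n ih =>
    have hpred : ∀ {n : ℕ} {W : ℕ → ι → D → ℝ} {a : ι → D → ℂ}, IsAmpN hz (n + 1) W a →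
        IsAmpN hz n W a := by
      intro n
      induction n with
      | zero => exact fun h => h.1
      | succ n ih => exact fun h => ⟨h.1, fun e => ih (h.2 e)⟩
    refine ⟨h0 ha hb hW₁ hV h, fun e => ?_⟩
    -- The index type of the weights is not assumed nonempty. The hypothesis at order zero supplies
    -- an index, used only for the smoothness of `b`.
    obtain ⟨l, -⟩ := h 0 0
    simp only [dirDeriv_mul (ha.smooth _) ((hb l).smooth _)]
    refine (ih (ha.2 e) (fun j => hpred (hb j)) (fun k => hW₁ _) hV fun j k => ?_).add
      (ih (hpred ha) (fun j => (hb j).2 e) hW₁ (fun j k => hV _ _) fun j k => ?_)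
    · obtain ⟨l, C, hC⟩ := h (j + step hz e) k
      exact ⟨l, C, fun i p => (hC i p).trans_eq (by rw [add_right_comm])⟩
    · obtain ⟨l, C, hC⟩ := h j (k + step hz e)
      exact ⟨l, C, fun i p => (hC i p).trans_eq (by rw [add_assoc])⟩

lemma IsAmpN.mul (ha : IsAmpN hz n W₁ a) (hb : IsAmpN hz n W₂ b) (hW₁ : ∀ k i p, 0 ≤ W₁ k i p)
    (hW₂ : ∀ k i p, 0 ≤ W₂ k i p)
    (h : ∀ j k, ∃ C, ∀ i p, W₁ j i p * W₂ k i p ≤ C * W₃ (j + k) i p) :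
    IsAmpN hz n W₃ (fun i p => a i p * b i p) :=
  IsAmpN.mul_family (κ := Unit) (V := fun _ => W₂) ha (fun _ => hb) hW₁ (fun _ => hW₂)
    fun j k => ⟨(), h j k⟩

lemma IsAmp.mul (ha : IsAmp hz W₁ a) (hb : IsAmp hz W₂ b) (hW₁ : ∀ k i p, 0 ≤ W₁ k i p)
    (hW₂ : ∀ k i p, 0 ≤ W₂ k i p)
    (h : ∀ j k, ∃ C, ∀ i p, W₁ j i p * W₂ k i p ≤ C * W₃ (j + k) i p) :
    IsAmp hz W₃ (fun i p => a i p * b i p) := fun n => (ha n).mul (hb n) hW₁ hW₂ h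

lemma IsAmp.mul_family {V : κ → ℕ → ι → D → ℝ} (ha : IsAmp hz W₁ a)
    (hb : ∀ j, IsAmp hz (V j) b) (hW₁ : ∀ k i p, 0 ≤ W₁ k i p) (hV : ∀ j k i p, 0 ≤ V j k i p)
    (h : ∀ j k, ∃ l C, ∀ i p, W₁ j i p * V l k i p ≤ C * W₃ (j + k) i p) :
    IsAmp hz W₃ (fun i p => a i p * b i p) :=
  fun n => (ha n).mul_family (fun j => hb j n) hW₁ hV h

/-- Pull-back under a continuous linear map which does not map vertical to horizontal vectors. -/
lemma IsAmpN.comp_clm {hz' : D' →L[ℝ] H'} (ha : IsAmpN hz n W a) (A : D' →L[ℝ] D)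
    (hA : ∀ e, hz' e = 0 → hz (A e) = 0) (hW : ∀ k i p, 0 ≤ W k i p)
    (hmono : ∀ i p, Monotone fun k => W k i p) :
    IsAmpN hz' n (fun k i p => W k i (A p)) (fun i p => a i (A p)) := by
  have hstep : ∀ e, step hz (A e) ≤ step hz' e := by
    intro e
    by_cases h : hz' e = 0
    · rw [step_of_eq_zero (hA e h)]; exact Nat.zero_le _
    · rw [step_of_ne_zero h]; exact step_le_one _ _
  have h0 : ∀ {W : ℕ → ι → D → ℝ} {a : ι → D → ℂ},
      ((∀ i, ContDiff ℝ ∞ (a i)) ∧ ∃ C, ∀ i p, ‖a i p‖ ≤ C * W 0 i p) →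
      ((∀ i, ContDiff ℝ ∞ (fun p => a i (A p))) ∧
        ∃ C, ∀ i p, ‖a i (A p)‖ ≤ C * W 0 i (A p)) :=
    fun h => ⟨fun i => (h.1 i).comp A.contDiff, h.2.imp fun C hC i p => hC _ _⟩
  induction n generalizing W a with
  | zero => exact h0 ha
  | succ n ih =>
    refine ⟨h0 ha.1, fun e => ?_⟩
    simp only [dirDeriv_comp_clm (ha.smooth _)]
    refine (ih (ha.2 (A e)) (fun k => hW _) fun i p k l hkl => hmono i p (by omega)).mono
      (fun k i p => hW _ _ _) fun k => ⟨1, fun i p => ?_⟩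
    rw [one_mul]
    exact hmono i (A p) (by have := hstep e; omega)

lemma IsAmp.comp_clm {hz' : D' →L[ℝ] H'} (ha : IsAmp hz W a) (A : D' →L[ℝ] D)
    (hA : ∀ e, hz' e = 0 → hz (A e) = 0) (hW : ∀ k i p, 0 ≤ W k i p)
    (hmono : ∀ i p, Monotone fun k => W k i p) :
    IsAmp hz' (fun k i p => W k i (A p)) (fun i p => a i (A p)) :=
  fun n => (ha n).comp_clm A hA hW hmono

/-- If the weights do not depend on the order, the horizontal part plays no role. -/
lemma IsAmp.comp_clm_const {hz' : D' →L[ℝ] H'} {w : ι → D → ℝ} (ha : IsAmp hz (fun _ => w) a)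
    (A : D' →L[ℝ] D) : IsAmp hz' (fun _ i p => w i (A p)) (fun i p => a i (A p)) := by
  intro n
  replace ha := ha n
  induction n generalizing a with
  | zero => exact ⟨fun i => (ha.1 i).comp A.contDiff, ha.2.imp fun C hC i p => hC _ _⟩
  | succ n ih =>
    refine ⟨⟨fun i => (ha.1.1 i).comp A.contDiff, ha.1.2.imp fun C hC i p => hC _ _⟩, fun e => ?_⟩
    simp only [dirDeriv_comp_clm (ha.smooth _)]
    exact ih (ha.2 (A e))

lemma IsAmp.change_hz {hz' : D →L[ℝ] H'} {w : ι → D → ℝ} (ha : IsAmp hz (fun _ => w) a) :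
    IsAmp hz' (fun _ => w) a :=
  ha.comp_clm_const (ContinuousLinearMap.id ℝ D)

lemma isAmp_const (c : ι → ℂ) : IsAmp hz (fun _ i _ => ‖c i‖) (fun i (_ : D) => c i) := by
  intro n
  induction n generalizing c with
  | zero => exact ⟨fun i => contDiff_const, 1, fun i p => by simp⟩
  | succ n ih =>
    refine ⟨⟨fun i => contDiff_const, 1, fun i p => by simp⟩, fun e => ?_⟩
    have : (fun i : ι => dirDeriv e (fun _ : D => c i)) = fun i _ => 0 := by
      ext i p; simp [dirDeriv]
    rw [this]
    exact isAmpN_zero fun _ _ _ => norm_nonneg _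

/-- Continuous linear functionals, with respect to weights which are bounded from below. -/
lemma isAmp_clm (L : D →L[ℝ] ℂ) {w : D → ℝ} (h1 : ∀ p, 1 ≤ w p)
    (hL : ∃ C, ∀ p, ‖L p‖ ≤ C * w p) : IsAmp hz (fun _ (_ : ι) => w) (fun _ p => L p) := by
  have h0 : ∀ i p, (0 : ℝ) ≤ (fun _ : ι => w) i p := fun i p => zero_le_one.trans (h1 p)
  intro n
  cases n with
  | zero => exact ⟨fun _ => L.contDiff, hL.imp fun C hC _ => hC⟩
  | succ n =>
    refine ⟨⟨fun _ => L.contDiff, hL.imp fun C hC _ => hC⟩, fun e => ?_⟩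
    simp only [dirDeriv_clm]
    refine (isAmp_const (fun _ : ι => L e) n).mono (fun _ _ _ => norm_nonneg _)
      fun _ => ⟨‖L e‖, fun i p => ?_⟩
    exact le_mul_of_one_le_right (norm_nonneg _) (h1 p)

lemma norm_iteratedFDeriv_dirDeriv_le {f : D → ℂ} (hf : ContDiff ℝ ∞ f) (e : D) (n : ℕ) (p : D) :
    ‖iteratedFDeriv ℝ n (dirDeriv e f) p‖ ≤ ‖e‖ * ‖iteratedFDeriv ℝ (n + 1) f p‖ := by
  have hf' : ContDiff ℝ ∞ (fderiv ℝ f) := hf.fderiv_right (by simp)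
  have := norm_iteratedFDeriv_clm_apply_const (c := e) (n := n) (x := p) (f := fderiv ℝ f)
    (N := ∞) hf'.contDiffAt (by exact_mod_cast le_top)
  rwa [norm_iteratedFDeriv_fderiv] at this

lemma isAmpN_of_iteratedFDeriv (ha : ∀ i, ContDiff ℝ ∞ (a i)) (hW : ∀ k i p, 0 ≤ W k i p)
    (h : ∀ k, ∃ C, ∀ i p, ‖iteratedFDeriv ℝ k (a i) p‖ ≤ C * W k i p) :
    IsAmp (ContinuousLinearMap.id ℝ D) W a := by
  intro n
  have h0 : ∀ {W : ℕ → ι → D → ℝ} {a : ι → D → ℂ}, (∀ k, ∃ C, ∀ i p,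
      ‖iteratedFDeriv ℝ k (a i) p‖ ≤ C * W k i p) → ∃ C, ∀ i p, ‖a i p‖ ≤ C * W 0 i p :=
    fun h => (h 0).imp fun C hC i p => by simpa using hC i p
  induction n generalizing W a with
  | zero => exact ⟨ha, h0 h⟩
  | succ n ih =>
    refine ⟨⟨ha, h0 h⟩, fun e => ?_⟩
    -- The zero direction does not raise the weight index, but then the derivative vanishes.
    by_cases he : e = 0
    · subst he
      simp only [dirDeriv_zero_right]
      exact isAmpN_zero fun k => hW _
    · refine ih (fun i => contDiff_dirDeriv (ha i) e) (fun k => hW _) fun k => ?_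
      rw [step_of_ne_zero (by simpa using he)]
      obtain ⟨C, hC⟩ := h (k + 1)
      refine ⟨‖e‖ * C, fun i p => (norm_iteratedFDeriv_dirDeriv_le (ha i) e k p).trans ?_⟩
      rw [mul_assoc]
      exact mul_le_mul_of_nonneg_left (hC i p) (norm_nonneg e)

/-- In a basis the differential is the sum of the directional derivatives times the coordinate
functionals. The constant depends on the basis alone, which keeps the bounds below uniform over
families. -/
lemma norm_iteratedFDeriv_succ_le [FiniteDimensional ℝ D] : ∃ (m : ℕ) (v : Fin m → D) (C : ℝ),
    0 ≤ C ∧ ∀ (f : D → ℂ), ContDiff ℝ ∞ f → ∀ n p, ‖iteratedFDeriv ℝ (n + 1) f p‖ ≤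
      C * ∑ j, ‖iteratedFDeriv ℝ n (dirDeriv (v j) f) p‖ := by
  let v := Module.finBasis ℝ D
  let L : Fin (Module.finrank ℝ D) → ℂ →L[ℝ] D →L[ℝ] ℂ := fun j =>
    ContinuousLinearMap.smulRightL ℝ D ℂ (LinearMap.toContinuousLinearMap (v.coord j))
  refine ⟨_, v, ∑ j, ‖L j‖, by positivity, fun f hf n p => ?_⟩
  rw [← norm_iteratedFDeriv_fderiv]
  have hfd : fderiv ℝ f = fun p => ∑ j, L j (dirDeriv (v j) f p) := by
    ext p e
    simp only [L, sum_apply]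
    conv_lhs => rw [← v.sum_repr e, map_sum]
    refine Finset.sum_congr rfl fun j _ => ?_
    simp [dirDeriv]
  have hsm : ∀ j, ContDiff ℝ ∞ fun p => L j (dirDeriv (v j) f p) := fun j =>
    (L j).contDiff.comp (contDiff_dirDeriv hf _)
  rw [hfd, iteratedFDeriv_sum fun j _ => (hsm j).of_le (by exact_mod_cast le_top)]
  rw [Finset.sum_apply, Finset.sum_mul]
  refine (norm_sum_le _ _).trans (Finset.sum_le_sum fun j _ => ?_)
  refine ((L j).norm_iteratedFDeriv_comp_left (f := dirDeriv (v j) f) (N := ∞)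
    (contDiff_dirDeriv hf _).contDiffAt (by exact_mod_cast le_top)).trans ?_
  exact mul_le_mul_of_nonneg_left (Finset.single_le_sum
    (f := fun j => ‖iteratedFDeriv ℝ n (dirDeriv (v j) f) p‖) (fun _ _ => norm_nonneg _)
    (Finset.mem_univ j)) (norm_nonneg _)

/-- The way back from directional derivatives to operator norms, needed to reach Schwartz seminorms.
-/
lemma IsAmp.norm_iteratedFDeriv_le [FiniteDimensional ℝ D] (ha : IsAmp hz W a)
    (hW : ∀ k i p, 0 ≤ W k i p) (hmono : ∀ i p, Monotone fun k => W k i p) (n : ℕ) :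
    ∃ C, 0 ≤ C ∧ ∀ i p, ‖iteratedFDeriv ℝ n (a i) p‖ ≤ C * W n i p := by
  obtain ⟨m, v, C, hC, hv⟩ := norm_iteratedFDeriv_succ_le (D := D)
  induction n generalizing W a with
  | zero => simpa using ha.bound hW
  | succ n ih =>
    have : ∀ j, ∃ C, 0 ≤ C ∧ ∀ i p, ‖iteratedFDeriv ℝ n (dirDeriv (v j) (a i)) p‖ ≤
        C * W (n + step hz (v j)) i p := fun j =>
      ih (ha.deriv (v j)) (fun k => hW _) fun i p k l hkl => hmono i p (by omega)
    choose K hK0 hK using this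
    refine ⟨C * ∑ j, K j, mul_nonneg hC (Finset.sum_nonneg fun j _ => hK0 j), fun i p => ?_⟩
    refine (hv (a i) (ha.smooth i) n p).trans ?_
    rw [mul_assoc, Finset.sum_mul]
    refine mul_le_mul_of_nonneg_left (Finset.sum_le_sum fun j _ => (hK j i p).trans ?_) hC
    exact mul_le_mul_of_nonneg_left
      (hmono i p (by have := step_le_one hz (v j); omega)) (hK0 j)

end Amplitudes

/-! ### Unimodular exponentials. -/

section Phases

lemma norm_cis (t : ℝ) : ‖cis t‖ = 1 := by
  rw [cis, mul_comm]; exact Complex.norm_exp_ofReal_mul_I t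

lemma cis_add (s t : ℝ) : cis (s + t) = cis s * cis t := by
  simp only [cis, ← Complex.exp_add]; congr 1; push_cast; ring

lemma cis_zero : cis 0 = 1 := by simp [cis]

lemma contDiff_cis : ContDiff ℝ ∞ cis := by
  unfold cis
  exact (contDiff_const.mul Complex.ofRealCLM.contDiff).cexp

lemma continuous_cis : Continuous cis := contDiff_cis.continuous

lemma hasDerivAt_cis (t : ℝ) : HasDerivAt cis (Complex.I * cis t) t := by
  have := ((Complex.ofRealCLM.hasDerivAt (x := t)).const_mul Complex.I).cexp
  simp only [Complex.ofRealCLM_apply, Complex.ofReal_one, mul_one] at this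
  rw [mul_comm]
  exact this

end Phases

/-! ### Quadratic phases and the algebra of integration by parts. -/

section OscillatoryIntegrals

variable {P Q U V : Type*} [NormedAddCommGroup P] [NormedSpace ℝ P]
  [NormedAddCommGroup Q] [NormedSpace ℝ Q] [NormedAddCommGroup U] [NormedSpace ℝ U]
  [NormedAddCommGroup V] [NormedSpace ℝ V] {ι : Type*}

/-- A quadratic phase function on a space with coordinates `πu q` and `πv q`, together with finitely
many directions along which integration by parts yields decay in `πv q` and in `πu q`. -/
structure OscPhase (Q U V : Type*) [NormedAddCommGroup Q] [NormedSpace ℝ Q]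
    [NormedAddCommGroup U] [NormedSpace ℝ U] [NormedAddCommGroup V] [NormedSpace ℝ V] where
  /-- the phase function -/
  Φ : Q → ℝ
  /-- the derivative of the phase function -/
  L : Q →L[ℝ] Q →L[ℝ] ℝ
  hasFDerivAt : ∀ q, HasFDerivAt Φ (L q) q
  /-- the first group of coordinates -/
  πu : Q →L[ℝ] U
  /-- the second group of coordinates -/
  πv : Q →L[ℝ] V
  /-- directions for the gain of decay in `πv q` -/
  dA : List Q
  /-- directions for the gain of decay in `πu q` -/
  dB : List Q
  -- Isotropy makes the derivative of the phase along `d` constant on lines parallel to `d`, so no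
  -- derivative falls on the factor `gain`.
  isotropic : ∀ d ∈ dA ++ dB, L d d = 0
  -- Steps in the directions `dB` use no horizontal derivative and so do not worsen the growth of
  -- the amplitude.
  vertical : ∀ d ∈ dB, πu d = 0
  boundA : ∃ C, ∀ q, 1 + ‖πv q‖ ≤ C * (dA.map fun d => 1 + |L q d|).prod
  boundB : ∃ C, ∀ q, 1 + ‖πu q‖ ≤ C * (dB.map fun d => 1 + |L q d|).prod
  boundQ : ∃ C, ∀ q, 1 + ‖q‖ ≤ C * ((1 + ‖πu q‖) * (1 + ‖πv q‖))

namespace OscPhase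

variable (S : OscPhase Q U V)

/-- The horizontal part of a vector in `P × Q`. -/
def hz (P : Type*) [NormedAddCommGroup P] [NormedSpace ℝ P] : P × Q →L[ℝ] P × U :=
  (ContinuousLinearMap.fst ℝ P Q).prod (S.πu.comp (ContinuousLinearMap.snd ℝ P Q))

@[simp] lemma hz_apply (p : P × Q) : S.hz P p = (p.1, S.πu p.2) := rfl

/-- The factor `(1 + i ∂_d Φ)⁻¹`. -/
def gain (d : Q) (p : P × Q) : ℂ := (1 + Complex.I * (S.L p.2 d : ℝ))⁻¹

lemma one_add_ne_zero (t : ℝ) : (1 + Complex.I * (t : ℂ)) ≠ 0 := by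
  intro h
  have := congrArg Complex.re h
  simp at this

lemma gain_le (d : Q) (p : P × Q) : ‖S.gain d p‖ ≤ 2 * (1 + |S.L p.2 d|)⁻¹ := by
  have h : ∀ t : ℝ, ‖(1 + Complex.I * (t : ℂ))⁻¹‖ ≤ 2 * (1 + |t|)⁻¹ := by
    intro t
    rw [norm_inv]
    have h1 : 1 ≤ ‖1 + Complex.I * (t : ℂ)‖ := by
      simpa using Complex.abs_re_le_norm (1 + Complex.I * (t : ℂ))
    have h2 : |t| ≤ ‖1 + Complex.I * (t : ℂ)‖ := by
      simpa using Complex.abs_im_le_norm (1 + Complex.I * (t : ℂ))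
    have h3 : (0 : ℝ) < 1 + |t| := by positivity
    rw [inv_eq_one_div, ← div_eq_mul_inv, div_le_div_iff₀ (by linarith) h3]
    linarith
  exact h _

lemma gain_le_one (d : Q) (p : P × Q) : ‖S.gain d p‖ ≤ 1 := by
  unfold gain
  rw [norm_inv]
  refine inv_le_one_of_one_le₀ ?_
  simpa using Complex.abs_re_le_norm (1 + Complex.I * ((S.L p.2 d : ℝ) : ℂ))

lemma contDiff_gain (d : Q) : ContDiff ℝ ∞ (S.gain d : P × Q → ℂ) := by
  unfold gain
  refine ContDiff.inv ?_ fun p => one_add_ne_zero _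
  refine contDiff_const.add (contDiff_const.mul (Complex.ofRealCLM.contDiff.comp ?_))
  exact ((S.L.flip d).contDiff).comp contDiff_snd

lemma dirDeriv_gain (d : Q) (e : P × Q) :
    dirDeriv e (S.gain d : P × Q → ℂ) =
      fun p => (-(Complex.I * (S.L e.2 d : ℝ))) * S.gain d p ^ 2 := by
  ext p
  have h1 : HasFDerivAt (fun p : P × Q => (1 : ℂ) + Complex.I * ((S.L p.2 d : ℝ) : ℂ))
      (Complex.I • (Complex.ofRealCLM.comp ((S.L.flip d).comp (ContinuousLinearMap.snd ℝ P Q))))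
      p := by
    have := ((Complex.ofRealCLM.comp
      ((S.L.flip d).comp (ContinuousLinearMap.snd ℝ P Q))).hasFDerivAt (x := p)).const_mul
        Complex.I
    exact this.const_add 1
  have h2 := (hasDerivAt_inv (one_add_ne_zero (S.L p.2 d))).hasFDerivAt.restrictScalars ℝ
    |>.comp p h1
  have h3 : fderiv ℝ (S.gain d : P × Q → ℂ) p = _ := h2.fderiv
  rw [dirDeriv, h3]
  simp [gain, mul_comm]

lemma isAmp_gain (d : Q) (hz' : P × Q →L[ℝ] P × U) :
    IsAmp hz' (fun _ (_ : ι) p => ‖S.gain d p‖) (fun _ => S.gain d) := by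
  -- The phase derivative is linear, so differentiating a power of the gain raises the exponent by
  -- one, up to a constant. Monomials of positive degree form a class closed under derivatives, and
  -- each is bounded by the gain because the gain is at most one.
  have key : ∀ (n k : ℕ) (c : ℂ), IsAmpN hz' n (fun _ (_ : ι) p => ‖S.gain d p‖)
      (fun _ p => c * S.gain d p ^ (k + 1)) := by
    intro n
    have h0 : ∀ (k : ℕ) (c : ℂ), (∀ _ : ι, ContDiff ℝ ∞ fun p : P × Q =>
        c * S.gain d p ^ (k + 1)) ∧
        ∃ C : ℝ, ∀ (_ : ι) (p : P × Q), ‖c * S.gain d p ^ (k + 1)‖ ≤ C * ‖S.gain d p‖ := by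
      intro k c
      refine ⟨fun _ => contDiff_const.mul ((S.contDiff_gain d).pow _), ‖c‖, fun _ p => ?_⟩
      rw [norm_mul, norm_pow, pow_succ]
      refine mul_le_mul_of_nonneg_left ?_ (norm_nonneg c)
      exact mul_le_of_le_one_left (norm_nonneg _)
        (pow_le_one₀ (norm_nonneg _) (S.gain_le_one d p))
    induction n with
    | zero => exact h0
    | succ n ih =>
      intro k c
      refine ⟨h0 k c, fun e => ?_⟩
      have : dirDeriv e (fun p : P × Q => c * S.gain d p ^ (k + 1)) =
          fun p => (c * ((k + 1 : ℕ) * (-(Complex.I * (S.L e.2 d : ℝ))))) *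
            S.gain d p ^ (k + 1 + 1) := by
        rw [dirDeriv_const_mul ((S.contDiff_gain d).pow _)]
        ext p
        have h1 : dirDeriv e (fun p : P × Q => S.gain d p ^ (k + 1)) p =
            (k + 1 : ℕ) * S.gain d p ^ k * dirDeriv e (S.gain d) p := by
          have hd := (S.contDiff_gain (P := P) d).differentiable (by simp) p
          simp only [dirDeriv]
          rw [fderiv_fun_pow _ hd]
          simp
        rw [h1, dirDeriv_gain]
        ring
      simp only [this]
      exact ih _ _
  intro n
  simpa using key n 0 1

/-- One step of integration by parts in the direction `d`. -/
def stepOp (d : Q) (a : P × Q → ℂ) (p : P × Q) : ℂ :=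
  S.gain d p * (a p - dirDeriv (0, d) a p)

lemma contDiff_stepOp (d : Q) {a : P × Q → ℂ} (ha : ContDiff ℝ ∞ a) :
    ContDiff ℝ ∞ (S.stepOp d a) :=
  (S.contDiff_gain d).mul (ha.sub (contDiff_dirDeriv ha _))

lemma stepOp_sub (d : Q) {a b : P × Q → ℂ} (ha : ContDiff ℝ ∞ a) (hb : ContDiff ℝ ∞ b) :
    S.stepOp d (fun p => a p - b p) = fun p => S.stepOp d a p - S.stepOp d b p := by
  ext p
  simp only [stepOp, dirDeriv_sub ha hb]
  ring

/-- The phase does not involve the parameter, so parameter derivatives pass through integration by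
parts. This is what permits differentiation of the regularized integral. -/
lemma stepOp_dirDeriv (d : Q) {a : P × Q → ℂ} (ha : ContDiff ℝ ∞ a) (w : P) :
    dirDeriv (w, 0) (S.stepOp d a) = S.stepOp d (dirDeriv (w, 0) a) := by
  have hd := contDiff_dirDeriv ha ((0, d) : P × Q)
  unfold stepOp
  rw [dirDeriv_mul (S.contDiff_gain d) (ha.sub hd), dirDeriv_sub ha hd, dirDeriv_gain,
    dirDeriv_comm ha]
  ext p
  simp

variable {W : ℕ → ι → P × Q → ℝ} {a : ι → P × Q → ℂ}

lemma isAmp_stepOp (d : Q) {c : ℕ} (hc : step (S.hz P) (0, d) ≤ c) (ha : IsAmp (S.hz P) W a)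
    (hW : ∀ k i p, 0 ≤ W k i p) (hmono : ∀ i p, Monotone fun k => W k i p) :
    IsAmp (S.hz P) (fun k i p => ‖S.gain d p‖ * W (k + c) i p) (fun i => S.stepOp d (a i)) := by
  have h1 : IsAmp (S.hz P) (fun k i p => W (k + c) i p)
      (fun i p => a i p - dirDeriv (0, d) (a i) p) := by
    refine (ha.mono hW fun k => ⟨1, fun i p => ?_⟩).sub
      ((ha.deriv (0, d)).mono (fun k => hW _) fun k => ⟨1, fun i p => ?_⟩) fun k => hW _
    · rw [one_mul]; exact hmono i p (by omega)
    · rw [one_mul]; exact hmono i p (by omega)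
  refine (S.isAmp_gain d (S.hz P)).mul h1 (fun _ _ _ => norm_nonneg _) (fun k => hW _)
    fun j k => ⟨1, fun i p => ?_⟩
  rw [one_mul]
  exact mul_le_mul_of_nonneg_left (hmono i p (by omega)) (norm_nonneg _)

/-- Integration by parts in several directions. -/
def stepOps : List Q → (P × Q → ℂ) → P × Q → ℂ
  | [], a => a
  | d :: ds, a => stepOps ds (S.stepOp d a)

lemma stepOps_append (l l' : List Q) (a : P × Q → ℂ) :
    S.stepOps (l ++ l') a = S.stepOps l' (S.stepOps l a) := by
  induction l generalizing a with
  | nil => rfl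
  | cons d l ih => exact ih _

lemma contDiff_stepOps (l : List Q) {a : P × Q → ℂ} (ha : ContDiff ℝ ∞ a) :
    ContDiff ℝ ∞ (S.stepOps l a) := by
  induction l generalizing a with
  | nil => exact ha
  | cons d l ih => exact ih (S.contDiff_stepOp d ha)

lemma stepOps_sub (l : List Q) {a b : P × Q → ℂ} (ha : ContDiff ℝ ∞ a) (hb : ContDiff ℝ ∞ b) :
    S.stepOps l (fun p => a p - b p) = fun p => S.stepOps l a p - S.stepOps l b p := by
  induction l generalizing a b with
  | nil => rfl
  | cons d l ih =>
    simp only [stepOps]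
    rw [stepOp_sub S d ha hb, ih (S.contDiff_stepOp d ha) (S.contDiff_stepOp d hb)]

lemma stepOps_dirDeriv (l : List Q) {a : P × Q → ℂ} (ha : ContDiff ℝ ∞ a) (w : P) :
    dirDeriv (w, 0) (S.stepOps l a) = S.stepOps l (dirDeriv (w, 0) a) := by
  induction l generalizing a with
  | nil => rfl
  | cons d l ih =>
    simp only [stepOps]
    rw [ih (S.contDiff_stepOp d ha), stepOp_dirDeriv S d ha]

/-- The product of the gains of several integrations by parts. -/
def gains (l : List Q) (p : P × Q) : ℝ := (l.map fun d => ‖S.gain d p‖).prod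

lemma gains_nonneg (l : List Q) (p : P × Q) : 0 ≤ S.gains l p :=
  List.prod_nonneg (by simp only [List.mem_map]; rintro _ ⟨d, -, rfl⟩; exact norm_nonneg _)

lemma gains_cons (d : Q) (l : List Q) (p : P × Q) :
    S.gains (d :: l) p = ‖S.gain d p‖ * S.gains l p := by simp [gains]

/-- Each step multiplies by one gain and shifts the weight index by at most `c`; the value `c = 0`
is admissible for vertical directions. -/
lemma isAmp_stepOps (l : List Q) {c : ℕ} (hc : ∀ d ∈ l, step (S.hz P) (0, d) ≤ c)
    (ha : IsAmp (S.hz P) W a) (hW : ∀ k i p, 0 ≤ W k i p)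
    (hmono : ∀ i p, Monotone fun k => W k i p) :
    IsAmp (S.hz P) (fun k i p => S.gains l p * W (k + l.length * c) i p)
      (fun i => S.stepOps l (a i)) := by
  induction l generalizing W a with
  | nil => simpa [gains, stepOps] using ha
  | cons d l ih =>
    have h1 := S.isAmp_stepOp d (hc d (by simp)) ha hW hmono
    have h2 := ih (fun d hd => hc d (by simp [hd])) h1
      (fun k i p => mul_nonneg (norm_nonneg _) (hW _ _ _))
      (fun i p j k hjk => mul_le_mul_of_nonneg_left (hmono i p (by omega)) (norm_nonneg _))
    refine h2.mono (fun k i p => mul_nonneg (S.gains_nonneg _ _)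
      (mul_nonneg (norm_nonneg _) (hW _ _ _))) fun k => ⟨1, fun i p => ?_⟩
    rw [gains_cons, one_mul, List.length_cons]
    rw [show k + l.length * c + c = k + (l.length + 1) * c by ring]
    exact le_of_eq (by ring)

/-- `K`-fold repetition of a list of directions. -/
def rep (K : ℕ) (l : List Q) : List Q := (List.replicate K l).flatten

lemma mem_rep {K : ℕ} {l : List Q} {d : Q} (h : d ∈ rep K l) : d ∈ l := by
  simp only [rep, List.mem_flatten, List.mem_replicate] at h
  obtain ⟨_, ⟨-, rfl⟩, h⟩ := h
  exact h

lemma length_rep (K : ℕ) (l : List Q) : (rep K l).length = K * l.length := by simp [rep]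

lemma gains_rep (K : ℕ) (l : List Q) (p : P × Q) : S.gains (rep K l) p = S.gains l p ^ K := by
  induction K with
  | zero => simp [rep, gains]
  | succ K ih =>
    have : S.gains (rep (K + 1) l) p = S.gains l p * S.gains (rep K l) p := by
      simp [rep, gains, List.replicate_succ]
    rw [this, ih, pow_succ']

/-- Each gain is at most $2/(1+|\partial_d\Phi|)$, so a lower bound for the product of these
denominators turns into decay. -/
lemma gains_le {l : List Q} {N : Q → ℝ} (hN : ∀ q, 0 < N q)
    (h : ∃ C, ∀ q, N q ≤ C * (l.map fun d => 1 + |S.L q d|).prod) :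
    ∃ C, 0 ≤ C ∧ ∀ p : P × Q, S.gains l p ≤ C * (N p.2)⁻¹ := by
  obtain ⟨C, hC⟩ := h
  have key : ∀ (l : List Q) (p : P × Q),
      0 < (l.map fun d => 1 + |S.L p.2 d|).prod ∧
      S.gains l p ≤ 2 ^ l.length * ((l.map fun d => 1 + |S.L p.2 d|).prod)⁻¹ := by
    intro l p
    induction l with
    | nil => simp [gains]
    | cons d l ih =>
      rw [gains_cons, List.map_cons, List.prod_cons, List.length_cons]
      refine ⟨mul_pos (by positivity) ih.1, ?_⟩
      calc _ ≤ (2 * (1 + |S.L p.2 d|)⁻¹) *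
            (2 ^ l.length * ((l.map fun d => 1 + |S.L p.2 d|).prod)⁻¹) :=
            mul_le_mul (S.gain_le d p) ih.2 (S.gains_nonneg l p) (by positivity)
        _ = _ := by rw [mul_inv, pow_succ]; ring
  -- The sign of the constant is forced by the inequality at the origin, where the left side is
  -- positive.
  have hC0 : 0 ≤ C := by
    by_contra hneg
    have h1 := hC 0
    have h2 := (key l (0 : P × Q)).1
    have h3 := hN 0
    have : C * (l.map fun d => 1 + |S.L 0 d|).prod ≤ 0 :=
      mul_nonpos_of_nonpos_of_nonneg (by linarith) h2.le
    linarith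
  refine ⟨2 ^ l.length * C, by positivity, fun p => (key l p).2.trans ?_⟩
  rw [mul_assoc]
  refine mul_le_mul_of_nonneg_left ?_ (by positivity)
  rw [← div_eq_mul_inv, le_div_iff₀ (hN _), inv_mul_le_iff₀ (key l p).1, mul_comm]
  exact hC p.2

end OscPhase

end OscillatoryIntegrals

/-! ### Schwartz cut-offs and their dilations. -/

section Cutoffs

variable {D H : Type*} [NormedAddCommGroup D] [NormedSpace ℝ D]
  [NormedAddCommGroup H] [NormedSpace ℝ H] {ι : Type*}

lemma one_le_one_add_norm (p : D) : 1 ≤ 1 + ‖p‖ := by linarith [norm_nonneg p]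

lemma schwartz_decay (ψ : 𝓢(D, ℂ)) (K n : ℕ) : ∃ C, ∀ p,
    ‖iteratedFDeriv ℝ n ψ p‖ ≤ C * ((1 + ‖p‖) ^ K)⁻¹ := by
  refine ⟨2 ^ K * (Finset.Iic (K, n)).sup
    (fun m => SchwartzMap.seminorm ℝ m.1 m.2) ψ, fun p => ?_⟩
  have hp : 0 < (1 + ‖p‖) ^ K := by positivity
  rw [← div_eq_mul_inv, le_div_iff₀ hp, mul_comm]
  exact SchwartzMap.one_add_le_sup_seminorm_apply (𝕜 := ℝ) (m := (K, n)) le_rfl le_rfl ψ p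

lemma isAmp_schwartz (hz : D →L[ℝ] H) (ψ : 𝓢(D, ℂ)) (K : ℕ) :
    IsAmp hz (fun _ (_ : ι) p => ((1 + ‖p‖) ^ K)⁻¹) (fun _ => ψ) :=
  (isAmpN_of_iteratedFDeriv (fun _ => ψ.smooth ⊤) (fun _ _ _ => by positivity) fun n =>
    (schwartz_decay ψ K n).imp fun _ h _ p => h p).change_hz

/-- Rapid decay for one fixed `δ`, with constants that blow up as `δ` tends to zero. It only serves
to make the regularized integrals absolutely convergent. -/
lemma isAmp_dilation (hz : D →L[ℝ] H) (ψ : 𝓢(D, ℂ)) {δ : ℝ} (hδ : 0 < δ) (K : ℕ) :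
    IsAmp hz (fun _ (_ : ι) p => ((1 + ‖p‖) ^ K)⁻¹) (fun _ p => ψ (δ • p)) := by
  refine ((isAmp_schwartz hz ψ K).comp_clm_const (hz' := hz)
    (δ • ContinuousLinearMap.id ℝ D)).mono (fun _ _ _ => by positivity)
    fun k => ⟨((1 + δ⁻¹) ^ K), fun i p => ?_⟩
  have h1 : 1 + ‖p‖ ≤ (1 + δ⁻¹) * (1 + ‖δ • p‖) := by
    rw [norm_smul, Real.norm_of_nonneg hδ.le]
    have : (1 + δ⁻¹) * (1 + δ * ‖p‖) = 1 + ‖p‖ + δ⁻¹ + δ * ‖p‖ := by field_simp; ring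
    rw [this]
    have h2 : 0 ≤ δ⁻¹ := by positivity
    have h3 : 0 ≤ δ * ‖p‖ := by positivity
    linarith
  simp only [smul_apply, ContinuousLinearMap.id_apply]
  rw [← div_eq_mul_inv, le_div_iff₀ (by positivity), inv_mul_le_iff₀ (by positivity), ← mul_pow,
    mul_comm (1 + ‖δ • p‖)]
  exact pow_le_pow_left₀ (by positivity) h1 K

lemma dirDeriv_dilation (ψ : 𝓢(D, ℂ)) (δ : ℝ) (e : D) :
    dirDeriv e (fun p => ψ (δ • p)) = fun p => (δ : ℂ) * LineDeriv.lineDerivOp e ψ (δ • p) := by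
  have := dirDeriv_comp_clm (ψ.smooth ⊤) (δ • ContinuousLinearMap.id ℝ D) e
  simp only [smul_apply, ContinuousLinearMap.id_apply] at this
  rw [this]
  ext p
  simp [dirDeriv, SchwartzMap.lineDerivOp_apply_eq_fderiv]

/-- Dilated cut-offs converge to a constant, in the sense of amplitudes. -/
lemma isAmp_cutoff (hz : D →L[ℝ] H) (χ : 𝓢(D, ℂ)) :
    IsAmp hz (fun _ (δ : Set.Ioc (0 : ℝ) 1) p => δ * (1 + ‖p‖))
      (fun δ p => χ ((δ : ℝ) • p) - χ 0) := by
  have hbd : ∀ ψ : 𝓢(D, ℂ), ∃ C, ∀ p, ‖ψ p‖ ≤ C := fun ψ =>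
    ⟨_, fun p => SchwartzMap.norm_le_seminorm ℝ ψ p⟩
  have hsm : ∀ (ψ : 𝓢(D, ℂ)) (δ : ℝ), ContDiff ℝ ∞ fun p => ψ (δ • p) := fun ψ δ =>
    (ψ.smooth ⊤).comp (contDiff_const_smul δ)
  have key : ∀ (n : ℕ) (ψ : 𝓢(D, ℂ)), IsAmpN hz n (fun _ (δ : Set.Ioc (0 : ℝ) 1) _ => (δ : ℝ))
      (fun δ p => ((δ : ℝ) : ℂ) * ψ ((δ : ℝ) • p)) := by
    intro n
    have h0 : ∀ ψ : 𝓢(D, ℂ), (∀ δ : Set.Ioc (0 : ℝ) 1, ContDiff ℝ ∞ fun p =>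
        ((δ : ℝ) : ℂ) * ψ ((δ : ℝ) • p)) ∧
        ∃ C : ℝ, ∀ (δ : Set.Ioc (0 : ℝ) 1) p, ‖((δ : ℝ) : ℂ) * ψ ((δ : ℝ) • p)‖ ≤ C * δ := by
      intro ψ
      obtain ⟨C, hC⟩ := hbd ψ
      refine ⟨fun δ => contDiff_const.mul (hsm ψ δ), C, fun δ p => ?_⟩
      rw [norm_mul, Complex.norm_real, Real.norm_of_nonneg δ.2.1.le, mul_comm]
      exact mul_le_mul_of_nonneg_right (hC _) δ.2.1.le
    induction n with
    | zero => exact h0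
    | succ n ih =>
      refine fun ψ => ⟨h0 ψ, fun e => ?_⟩
      simp only [dirDeriv_const_mul (hsm ψ _), dirDeriv_dilation]
      refine ((ih (LineDeriv.lineDerivOp e ψ)).const_mul fun δ => ((δ : ℝ) : ℂ)).mono
        (fun k δ p => mul_nonneg (norm_nonneg _) δ.2.1.le) fun k => ⟨1, fun δ p => ?_⟩
      rw [Complex.norm_real, Real.norm_of_nonneg δ.2.1.le]
      exact mul_le_mul_of_nonneg_right δ.2.2 δ.2.1.le
  have h0 : (∀ δ : Set.Ioc (0 : ℝ) 1, ContDiff ℝ ∞ fun p => χ ((δ : ℝ) • p) - χ 0) ∧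
      ∃ C : ℝ, ∀ (δ : Set.Ioc (0 : ℝ) 1) p,
        ‖χ ((δ : ℝ) • p) - χ 0‖ ≤ C * ((δ : ℝ) * (1 + ‖p‖)) := by
    refine ⟨fun δ => (hsm χ δ).sub contDiff_const, SchwartzMap.seminorm ℝ 0 1 χ, fun δ p => ?_⟩
    have h1 : ‖χ ((δ : ℝ) • p) - χ 0‖ ≤ SchwartzMap.seminorm ℝ 0 1 χ * ‖(δ : ℝ) • p - 0‖ := by
      refine Convex.norm_image_sub_le_of_norm_fderiv_le (𝕜 := ℝ) (s := Set.univ)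
        (fun x _ => χ.differentiable x) (fun x _ => ?_) convex_univ trivial trivial
      have := SchwartzMap.norm_iteratedFDeriv_le_seminorm ℝ χ 1 x
      rwa [norm_iteratedFDeriv_one] at this
    refine h1.trans (mul_le_mul_of_nonneg_left ?_ (apply_nonneg _ _))
    rw [sub_zero, norm_smul, Real.norm_of_nonneg δ.2.1.le]
    exact mul_le_mul_of_nonneg_left (by linarith) δ.2.1.le
  intro n
  cases n with
  | zero => exact h0
  | succ n =>
    refine ⟨h0, fun e => ?_⟩
    have : ∀ δ : Set.Ioc (0 : ℝ) 1, dirDeriv e (fun p => χ ((δ : ℝ) • p) - χ 0) =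
        fun p => ((δ : ℝ) : ℂ) * LineDeriv.lineDerivOp e χ ((δ : ℝ) • p) := by
      intro δ
      rw [← dirDeriv_dilation, dirDeriv_sub (hsm χ δ) contDiff_const]
      ext p
      simp [dirDeriv]
    simp only [this]
    refine (key n _).mono (fun k δ p => δ.2.1.le) fun k => ⟨1, fun δ p => ?_⟩
    rw [one_mul]
    exact le_mul_of_one_le_right δ.2.1.le (one_le_one_add_norm p)

lemma exists_schwartz_eq_one (D : Type*) [NormedAddCommGroup D] [NormedSpace ℝ D]
    [FiniteDimensional ℝ D] : ∃ χ : 𝓢(D, ℂ), χ 0 = 1 := by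
  have φ : ContDiffBump (0 : D) := default
  have h1 : HasCompactSupport (fun x => ((φ x : ℝ) : ℂ)) :=
    φ.hasCompactSupport.comp_left (g := fun t : ℝ => (t : ℂ)) (by simp)
  have h2 : ContDiff ℝ ∞ (fun x => ((φ x : ℝ) : ℂ)) :=
    Complex.ofRealCLM.contDiff.comp φ.contDiff
  refine ⟨h1.toSchwartzMap h2, ?_⟩
  change ((φ 0 : ℝ) : ℂ) = 1
  rw [φ.one_of_mem_closedBall (by simp [φ.rIn_pos.le])]
  simp

/-- A fixed Schwartz function with value one at the origin. -/
def stdCutoff (D : Type*) [NormedAddCommGroup D] [NormedSpace ℝ D] [FiniteDimensional ℝ D] :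
    𝓢(D, ℂ) := (exists_schwartz_eq_one D).choose

lemma stdCutoff_zero (D : Type*) [NormedAddCommGroup D] [NormedSpace ℝ D]
    [FiniteDimensional ℝ D] : stdCutoff D 0 = 1 := (exists_schwartz_eq_one D).choose_spec

end Cutoffs

/-! ### Integration by parts under the integral and absolute convergence. -/

namespace OscPhase

variable {P Q U V : Type*} [NormedAddCommGroup P] [NormedSpace ℝ P]
  [NormedAddCommGroup Q] [NormedSpace ℝ Q] [NormedAddCommGroup U] [NormedSpace ℝ U]
  [NormedAddCommGroup V] [NormedSpace ℝ V] {ι : Type*} (S : OscPhase Q U V)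
  [FiniteDimensional ℝ Q] [MeasureSpace Q] [BorelSpace Q]
  [(volume : Measure Q).IsAddHaarMeasure]

/-- An exponent for which the weight `decay` below is integrable. -/
def decayExp (Q : Type*) [NormedAddCommGroup Q] [MeasureSpace Q] : ℕ :=
  (volume : Measure Q).integrablePower

/-- An integrable weight. -/
def decay (q : Q) : ℝ := ((1 + ‖q‖) ^ decayExp Q)⁻¹

lemma decay_pos (q : Q) : 0 < decay q := by unfold decay; positivity

lemma integrable_decay : Integrable (decay : Q → ℝ) := by
  refine (Measure.integrable_pow_neg_integrablePower (volume : Measure Q)).congr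
    (Eventually.of_forall fun q => ?_)
  simp only [decay, decayExp]
  rw [Real.rpow_neg (by positivity), Real.rpow_natCast]

lemma phase_continuous : Continuous S.Φ :=
  continuous_iff_continuousAt.mpr fun q => (S.hasFDerivAt q).continuousAt

lemma integrable_of_decay {g : Q → ℂ} (hg : Continuous g) {C : ℝ}
    (h : ∀ q, ‖g q‖ ≤ C * decay q) : Integrable g :=
  (integrable_decay.const_mul C).mono' hg.aestronglyMeasurable (Eventually.of_forall h)

lemma integrable_phase_mul {g : Q → ℂ} (hg : Integrable g) :
    Integrable fun q => cis (S.Φ q) * g q :=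
  hg.bdd_mul (c := 1) (continuous_cis.comp S.phase_continuous).aestronglyMeasurable
    (Eventually.of_forall fun _ => (norm_cis _).le)

/-- With $\gamma=(1+i\partial_d\Phi)^{-1}$ the two integrands differ by $\partial_d(e^{i\Phi}\gamma
a)$, because $\gamma$ is constant along `d`; the integral of this derivative is zero. -/
lemma integral_stepOp {d : Q} (hd : S.L d d = 0) {a : P × Q → ℂ} (ha : ContDiff ℝ ∞ a) (x : P)
    (h1 : Integrable fun q => a (x, q)) (h2 : Integrable fun q => dirDeriv (0, d) a (x, q)) :
    ∫ q, cis (S.Φ q) * a (x, q) = ∫ q, cis (S.Φ q) * S.stepOp d a (x, q) := by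
  set G : Q → ℂ := fun q => cis (S.Φ q) * (S.gain d (x, q) * a (x, q)) with hG
  set G' : Q → ℂ := fun q => cis (S.Φ q) * (S.gain d (x, q) *
    (Complex.I * (S.L q d : ℝ) * a (x, q) + dirDeriv (0, d) a (x, q))) with hG'
  have hgc : Continuous fun q => S.gain d (x, q) :=
    (S.contDiff_gain d).continuous.comp (Continuous.prodMk_right x)
  have hgain : ∀ q, S.gain d (x, q) * (1 + Complex.I * (S.L q d : ℝ)) = 1 := fun q =>
    inv_mul_cancel₀ (one_add_ne_zero _)
  have hdiff : ∀ q, cis (S.Φ q) * a (x, q) - cis (S.Φ q) * S.stepOp d a (x, q) = G' q := by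
    intro q
    simp only [hG', stepOp]
    linear_combination (-(cis (S.Φ q) * a (x, q))) * hgain q
  have hGi : Integrable G := by
    refine S.integrable_phase_mul (h1.bdd_mul (c := 1) hgc.aestronglyMeasurable
      (Eventually.of_forall fun q => S.gain_le_one d _))
  have hi1 : Integrable fun q => cis (S.Φ q) * a (x, q) := S.integrable_phase_mul h1
  have hi2 : Integrable fun q => cis (S.Φ q) * S.stepOp d a (x, q) :=
    S.integrable_phase_mul ((h1.sub h2).bdd_mul (c := 1) hgc.aestronglyMeasurable
      (Eventually.of_forall fun q => S.gain_le_one d _))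
  have hGi' : Integrable G' := (hi1.sub hi2).congr (Eventually.of_forall hdiff)
  have hder : ∀ q, HasLineDerivAt ℝ G (G' q) q d := by
    intro q
    have hgain0 : ∀ t : ℝ, S.gain d (x, q + t • d) = S.gain d (x, q) := by
      intro t
      simp [gain, hd]
    have hline : HasDerivAt (fun t : ℝ => q + t • d) d 0 := by
      simpa using ((hasDerivAt_id (0 : ℝ)).smul_const d).const_add q
    have hΦ : HasDerivAt (fun t : ℝ => S.Φ (q + t • d)) (S.L q d) 0 := by
      have h : HasFDerivAt S.Φ (S.L q) (q + (0 : ℝ) • d) := by simpa using S.hasFDerivAt q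
      exact h.comp_hasDerivAt 0 hline
    have he : HasDerivAt (fun t : ℝ => cis (S.Φ (q + t • d)))
        (S.L q d • (Complex.I * cis (S.Φ q))) 0 := by
      have h := hasDerivAt_cis (S.Φ (q + (0 : ℝ) • d))
      have := h.scomp 0 hΦ
      simp only [zero_smul, add_zero] at this
      exact this
    have hal : HasDerivAt (fun t : ℝ => a (x, q + t • d)) (dirDeriv (0, d) a (x, q)) 0 := by
      have h : HasFDerivAt a (fderiv ℝ a (x, q)) (x, q + (0 : ℝ) • d) := by
        simpa using (ha.differentiable (by simp) (x, q)).hasFDerivAt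
      exact h.comp_hasDerivAt 0 ((hasDerivAt_const (0 : ℝ) x).prodMk hline)
    have := he.mul (hal.const_mul (S.gain d (x, q)))
    rw [HasLineDerivAt]
    simp only [hG, hgain0]
    refine this.congr_deriv ?_
    simp only [hG', zero_smul, add_zero, Complex.real_smul]
    ring
  -- Integration by parts against the constant function one; integrability of `G` and `G'` replaces
  -- any boundary condition.
  have hzero : ∫ q, G' q = 0 := by
    have := integral_bilinear_hasLineDerivAt_right_eq_neg_left_of_integrable (μ := volume)
      (f := fun _ : Q => (1 : ℂ)) (f' := fun _ => 0) (g := G) (g' := G') (v := d)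
      (B := ContinuousLinearMap.mul ℝ ℂ) (by simp) (by simpa using hGi') (by simpa using hGi)
      (fun q _ => by simpa [HasLineDerivAt] using hasDerivAt_const (0 : ℝ) (1 : ℂ)) (fun q _ => hder q)
    simpa using this
  rw [← sub_eq_zero, ← integral_sub hi1 hi2, ← hzero]
  exact integral_congr_ae (Eventually.of_forall hdiff)

/-- All derivatives of `a` are integrable in the second variable, because of decay. -/
def IsDecaying (a : P × Q → ℂ) : Prop :=
  ∃ w : ℕ → P → ℝ, (∀ k x, 0 ≤ w k x) ∧ (∀ x, Monotone fun k => w k x) ∧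
    IsAmp (S.hz P) (fun k (_ : Unit) p => w k p.1 * decay p.2) (fun _ => a)

variable {S} in
lemma IsDecaying.smooth {a : P × Q → ℂ} (h : S.IsDecaying a) : ContDiff ℝ ∞ a := by
  obtain ⟨w, -, -, h⟩ := h
  exact h.smooth ()

variable {S} in
lemma IsDecaying.integrable {a : P × Q → ℂ} (h : S.IsDecaying a) (x : P) :
    Integrable fun q => a (x, q) := by
  have hs := h.smooth
  obtain ⟨w, hw, -, h⟩ := h
  obtain ⟨C, hC0, hC⟩ := h.bound fun _ _ p => mul_nonneg (hw _ _) (decay_pos _).le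
  refine integrable_of_decay (C := C * w 0 x) (hs.continuous.comp (Continuous.prodMk_right x))
    fun q => ?_
  rw [mul_assoc]
  exact hC () (x, q)

variable {S} in
lemma IsDecaying.dirDeriv {a : P × Q → ℂ} (h : S.IsDecaying a) (e : P × Q) :
    S.IsDecaying (dirDeriv e a) := by
  obtain ⟨w, hw, hm, h⟩ := h
  exact ⟨fun k => w (k + step (S.hz P) e), fun k => hw _, fun x k l hkl => hm x (by omega),
    h.deriv e⟩

variable {S} in
lemma IsDecaying.stepOp {a : P × Q → ℂ} (h : S.IsDecaying a) (d : Q) :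
    S.IsDecaying (S.stepOp d a) := by
  obtain ⟨w, hw, hm, h⟩ := h
  refine ⟨fun k => w (k + 1), fun k => hw _, fun x k l hkl => hm x (by omega),
    (S.isAmp_stepOp d (step_le_one _ _) h
    (fun _ _ p => mul_nonneg (hw _ _) (decay_pos _).le) (fun _ p _ _ hkl =>
      mul_le_mul_of_nonneg_right (hm p.1 hkl) (decay_pos _).le)).mono
    (fun _ _ p => mul_nonneg (norm_nonneg _) (mul_nonneg (hw _ _) (decay_pos _).le))
    fun k => ⟨1, fun i p => ?_⟩⟩
  exact mul_le_mul_of_nonneg_right (S.gain_le_one d p) (mul_nonneg (hw _ _) (decay_pos _).le)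

variable {S} in
lemma IsDecaying.stepOps {a : P × Q → ℂ} (h : S.IsDecaying a) (l : List Q) :
    S.IsDecaying (S.stepOps l a) := by
  induction l generalizing a with
  | nil => exact h
  | cons d l ih => exact ih (h.stepOp d)

lemma integral_stepOps {l : List Q} (hl : ∀ d ∈ l, S.L d d = 0) {a : P × Q → ℂ}
    (ha : S.IsDecaying a) (x : P) :
    ∫ q, cis (S.Φ q) * a (x, q) = ∫ q, cis (S.Φ q) * S.stepOps l a (x, q) := by
  induction l generalizing a with
  | nil => rfl
  | cons d l ih =>
    rw [S.integral_stepOp (hl d (by simp)) ha.smooth x (ha.integrable x)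
      ((ha.dirDeriv _).integrable x), ih (fun d hd => hl d (by simp [hd])) (ha.stepOp d)]
    rfl

/-- The weights `w k i x (1 + |u|)^(N k) (1 + |v|)^M`. -/
def wt (w : ℕ → ι → P → ℝ) (N : ℕ → ℕ) (M : ℕ) (k : ℕ) (i : ι) (p : P × Q) : ℝ :=
  w k i p.1 * (1 + ‖S.πu p.2‖) ^ N k * (1 + ‖S.πv p.2‖) ^ M

variable {w w' : ℕ → ι → P → ℝ} {N N' : ℕ → ℕ} {M M' : ℕ}

lemma wt_nonneg (hw : ∀ k i x, 0 ≤ w k i x) (k : ℕ) (i : ι) (p : P × Q) :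
    0 ≤ S.wt w N M k i p := by
  have := hw k i p.1
  unfold wt; positivity

lemma wt_monotone (hw : ∀ k i x, 0 ≤ w k i x) (hwm : ∀ i x, Monotone fun k => w k i x)
    (hN : Monotone N) (i : ι) (p : P × Q) : Monotone fun k => S.wt w N M k i p := by
  intro k l hkl
  have h1 := hw k i p.1
  have h2 := hw l i p.1
  have h3 : w k i p.1 ≤ w l i p.1 := hwm i p.1 hkl
  have h4 : (1 + ‖S.πu p.2‖) ^ N k ≤ (1 + ‖S.πu p.2‖) ^ N l :=
    pow_le_pow_right₀ (one_le_one_add_norm _) (hN hkl)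
  simp only [wt]
  gcongr

/-- Integrations by parts which make an amplitude integrable. -/
def ops (M N : ℕ) : List Q := rep (M + decayExp Q) S.dA ++ rep (N + decayExp Q) S.dB

/-- The number of horizontal derivatives used by `ops`. -/
def loss (M : ℕ) : ℕ := (M + decayExp Q) * S.dA.length

/-- The order matters. The steps along `dA` come first and raise the weight index by `loss`; the
steps along `dB` are vertical, so they leave the index where it is. -/
lemma isAmp_ops {a : ι → P × Q → ℂ} {N₀ : ℕ} (ha : IsAmp (S.hz P) (S.wt w N M) a)
    (hw : ∀ k i x, 0 ≤ w k i x) (hwm : ∀ i x, Monotone fun k => w k i x) (hN : Monotone N) :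
    IsAmp (S.hz P) (fun k i p => S.gains (rep (N₀ + decayExp Q) S.dB) p *
      (S.gains (rep (M' + decayExp Q) S.dA) p * S.wt w N M (k + S.loss M') i p))
      (fun i => S.stepOps (S.ops M' N₀) (a i)) := by
  have h1 := S.isAmp_stepOps (rep (M' + decayExp Q) S.dA) (fun d _ => step_le_one _ _) ha
    (S.wt_nonneg hw) (S.wt_monotone hw hwm hN)
  have h2 := S.isAmp_stepOps (rep (N₀ + decayExp Q) S.dB) (c := 0) (fun d hd => ?_) h1
    (fun k i p => mul_nonneg (S.gains_nonneg _ _) (S.wt_nonneg hw _ _ _))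
    (fun i p j k hjk => mul_le_mul_of_nonneg_left
      (S.wt_monotone hw hwm hN i p (by omega)) (S.gains_nonneg _ _))
  · simp only [mul_zero, add_zero, mul_one, length_rep, ← stepOps_append] at h2
    exact h2
  · rw [step_of_eq_zero]
    simp [S.vertical d (mem_rep hd)]

/-- The gains along `dA` cancel the power `M` of $1+|v|$. The gains along `dB` cancel the power of
$1+|u|$, whose exponent is already evaluated after the loss and bounded by `N₀`. What remains are
`decayExp` powers of both inverses, integrable by `boundQ`. The constant does not depend on `w` or
`N`. -/
lemma exists_ops_le (N₀ : ℕ) (hM : M ≤ M') : ∃ C, 0 ≤ C ∧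
    ∀ (w : ℕ → ι → P → ℝ) (N : ℕ → ℕ), (∀ k i x, 0 ≤ w k i x) →
    ∀ k, N (k + S.loss M') ≤ N₀ → ∀ i p,
    S.gains (rep (N₀ + decayExp Q) S.dB) p *
      (S.gains (rep (M' + decayExp Q) S.dA) p * S.wt w N M (k + S.loss M') i p) ≤
      C * (w (k + S.loss M') i p.1 * decay p.2) := by
  obtain ⟨CA, hCA, hA⟩ := S.gains_le (P := P) (l := S.dA) (N := fun q => 1 + ‖S.πv q‖)
    (fun q => by positivity) S.boundA
  obtain ⟨CB, hCB, hB⟩ := S.gains_le (P := P) (l := S.dB) (N := fun q => 1 + ‖S.πu q‖)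
    (fun q => by positivity) S.boundB
  obtain ⟨CQ, hQ⟩ := S.boundQ
  refine ⟨CB ^ (N₀ + decayExp Q) * CA ^ (M' + decayExp Q) * |CQ| ^ decayExp Q, by positivity,
    fun w N hw k hN i p => ?_⟩
  set s := decayExp Q with hs
  set u := 1 + ‖S.πu p.2‖ with hu
  set v := 1 + ‖S.πv p.2‖ with hv
  have hu1 : 1 ≤ u := one_le_one_add_norm _
  have hv1 : 1 ≤ v := one_le_one_add_norm _
  have hu0 : 0 < u := by linarith
  have hv0 : 0 < v := by linarith
  have hw0 := hw (k + S.loss M') i p.1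
  have hgA : S.gains (rep (M' + s) S.dA) p ≤ CA ^ (M' + s) * (v⁻¹) ^ (M' + s) := by
    rw [gains_rep, ← mul_pow]
    exact pow_le_pow_left₀ (S.gains_nonneg _ _) (hA p) _
  have hgB : S.gains (rep (N₀ + s) S.dB) p ≤ CB ^ (N₀ + s) * (u⁻¹) ^ (N₀ + s) := by
    rw [gains_rep, ← mul_pow]
    exact pow_le_pow_left₀ (S.gains_nonneg _ _) (hB p) _
  have hdec : (u⁻¹) ^ s * (v⁻¹) ^ s ≤ |CQ| ^ s * decay p.2 := by
    have h1 : 1 + ‖p.2‖ ≤ |CQ| * (u * v) :=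
      (hQ p.2).trans (mul_le_mul_of_nonneg_right (le_abs_self _) (by positivity))
    rw [decay, ← hs, ← mul_pow, ← mul_inv, inv_pow, ← div_eq_mul_inv, le_div_iff₀ (by positivity),
      inv_mul_le_iff₀ (by positivity), ← mul_pow, mul_comm (u * v)]
    exact pow_le_pow_left₀ (by positivity) h1 s
  have hun : u ^ N (k + S.loss M') ≤ u ^ N₀ := pow_le_pow_right₀ hu1 hN
  have hvn : v ^ M ≤ v ^ M' := pow_le_pow_right₀ hv1 hM
  have e1 : (u⁻¹) ^ (N₀ + s) * u ^ N₀ = (u⁻¹) ^ s := by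
    rw [pow_add, mul_right_comm, ← mul_pow, inv_mul_cancel₀ hu0.ne', one_pow, one_mul]
  have e2 : (v⁻¹) ^ (M' + s) * v ^ M' = (v⁻¹) ^ s := by
    rw [pow_add, mul_right_comm, ← mul_pow, inv_mul_cancel₀ hv0.ne', one_pow, one_mul]
  calc _ ≤ (CB ^ (N₀ + s) * (u⁻¹) ^ (N₀ + s)) * ((CA ^ (M' + s) * (v⁻¹) ^ (M' + s)) *
        (w (k + S.loss M') i p.1 * u ^ N₀ * v ^ M')) := by
        refine mul_le_mul hgB (mul_le_mul hgA ?_ (S.wt_nonneg hw _ _ _) (by positivity))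
          (mul_nonneg (S.gains_nonneg _ _) (S.wt_nonneg hw _ _ _)) (by positivity)
        unfold wt
        gcongr
    _ = CB ^ (N₀ + s) * CA ^ (M' + s) * w (k + S.loss M') i p.1 *
        (((u⁻¹) ^ (N₀ + s) * u ^ N₀) * ((v⁻¹) ^ (M' + s) * v ^ M')) := by ring
    _ = CB ^ (N₀ + s) * CA ^ (M' + s) * w (k + S.loss M') i p.1 * ((u⁻¹) ^ s * (v⁻¹) ^ s) := by
        rw [e1, e2]
    _ ≤ CB ^ (N₀ + s) * CA ^ (M' + s) * w (k + S.loss M') i p.1 * (|CQ| ^ s * decay p.2) := by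
        gcongr
    _ = _ := by ring

lemma norm_stepOps_ops_le {a : ι → P × Q → ℂ} {N₀ : ℕ} (ha : IsAmp (S.hz P) (S.wt w N M) a)
    (hw : ∀ k i x, 0 ≤ w k i x) (hwm : ∀ i x, Monotone fun k => w k i x) (hN : Monotone N)
    (hM : M ≤ M') (hN₀ : N (S.loss M') ≤ N₀) :
    ∃ C, 0 ≤ C ∧ ∀ i p,
      ‖S.stepOps (S.ops M' N₀) (a i) p‖ ≤ C * (w (S.loss M') i p.1 * decay p.2) := by
  obtain ⟨C, hC, h⟩ := (S.isAmp_ops (N₀ := N₀) (M' := M') ha hw hwm hN).bound fun k i p =>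
    mul_nonneg (S.gains_nonneg _ _) (mul_nonneg (S.gains_nonneg _ _) (S.wt_nonneg hw _ _ _))
  obtain ⟨C', hC', h'⟩ := S.exists_ops_le (P := P) (ι := ι) N₀ hM
  refine ⟨C * C', by positivity, fun i p => (h i p).trans ?_⟩
  have := h' w N hw 0 (by simpa using hN₀) i p
  rw [zero_add] at this ⊢
  rw [mul_assoc]
  exact mul_le_mul_of_nonneg_left this hC

end OscPhase

/-! ### Oscillatory integrals with parameters: existence, linearity, derivatives, bounds. -/

namespace OscPhase

variable {P Q U V : Type*} [NormedAddCommGroup P] [NormedSpace ℝ P]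
  [NormedAddCommGroup Q] [NormedSpace ℝ Q] [NormedAddCommGroup U] [NormedSpace ℝ U]
  [NormedAddCommGroup V] [NormedSpace ℝ V] {ι : Type*} (S : OscPhase Q U V)
  [FiniteDimensional ℝ Q] [MeasureSpace Q] [BorelSpace Q]
  [(volume : Measure Q).IsAddHaarMeasure]

/-- The properties of weights which are used for amplitudes with parameters. -/
structure IsWeight (w : ℕ → ι → P → ℝ) : Prop where
  nonneg : ∀ k i x, 0 ≤ w k i x
  mono : ∀ i x, Monotone fun k => w k i x
  locBdd : ∀ k i x, ∃ C, ∀ᶠ y in 𝓝 x, w k i y ≤ C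

lemma IsWeight.shift {w : ℕ → ι → P → ℝ} (hw : IsWeight w) (c : ℕ) :
    IsWeight fun k => w (k + c) :=
  ⟨fun k => hw.nonneg _, fun i x k l hkl => hw.mono i x (by omega), fun k => hw.locBdd _⟩

lemma IsWeight.reindex {ι' : Type*} {w : ℕ → ι → P → ℝ} (hw : IsWeight w) (φ : ι' → ι) :
    IsWeight fun k i => w k (φ i) :=
  ⟨fun k i => hw.nonneg _ _, fun i => hw.mono _, fun k i => hw.locBdd _ _⟩

/-- The oscillatory integral of `a` with parameter `x`. -/
def osc (a : P × Q → ℂ) (x : P) : ℂ :=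
  limUnder (𝓝[>] (0 : ℝ)) fun δ => ∫ q, cis (S.Φ q) * (stdCutoff Q (δ • q) * a (x, q))

variable {w : ℕ → ι → P → ℝ} {w₁ : ℕ → Unit → P → ℝ} {N N' : ℕ → ℕ} {M M' M₁ N₀ : ℕ}

lemma integrable_stepOps_ops {a : ι → P × Q → ℂ} (ha : IsAmp (S.hz P) (S.wt w N M) a)
    (hw : IsWeight w) (hN : Monotone N) (hM : M ≤ M₁) (hN₀ : N (S.loss M₁) ≤ N₀) (i : ι) (x : P) :
    Integrable fun q => S.stepOps (S.ops M₁ N₀) (a i) (x, q) := by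
  obtain ⟨C, -, hC⟩ := S.norm_stepOps_ops_le ha hw.nonneg hw.mono hN hM hN₀
  refine integrable_of_decay (C := C * w (S.loss M₁) i x)
    ((S.contDiff_stepOps _ (ha.smooth i)).continuous.comp (Continuous.prodMk_right x)) fun q => ?_
  rw [mul_assoc]
  exact hC i (x, q)

lemma norm_integral_le_decay {C : ℝ} {g : Q → ℂ} (hg : ∀ q, ‖g q‖ ≤ C * decay q) :
    ‖∫ q, cis (S.Φ q) * g q‖ ≤ C * ∫ q : Q, decay q := by
  rw [← integral_const_mul]
  refine norm_integral_le_of_norm_le (integrable_decay.const_mul C)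
    (Eventually.of_forall fun q => ?_)
  rw [norm_mul, norm_cis, one_mul]
  exact hg q

/-- For the decaying approximants integration by parts is an identity. The steps are linear and the
amplitude of the error carries a factor `δ`, so the absolutely convergent integrals differ by at
most a multiple of `δ`. -/
lemma tendsto_integral_stepOps {a : P × Q → ℂ} {b : ℝ → P × Q → ℂ} {w' : ℕ → P → ℝ}
    (ha : IsAmp (S.hz P) (S.wt w₁ N M) fun _ => a) (hw : IsWeight w₁) (hN : Monotone N)
    (hb : ∀ δ, 0 < δ → S.IsDecaying (b δ))
    (hab : IsAmp (S.hz P) (S.wt (fun k (δ : Set.Ioc (0 : ℝ) 1) x => δ * w' k x) N' M')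
      fun δ p => b δ p - a p)
    (hw' : ∀ k x, 0 ≤ w' k x) (hwm' : ∀ x, Monotone fun k => w' k x) (hN' : Monotone N')
    (hM : M ≤ M₁) (hM' : M' ≤ M₁) (hN₀ : N (S.loss M₁) ≤ N₀) (hN₀' : N' (S.loss M₁) ≤ N₀) (x : P) :
    Tendsto (fun δ : ℝ => ∫ q, cis (S.Φ q) * b δ (x, q)) (𝓝[>] 0)
      (𝓝 (∫ q, cis (S.Φ q) * S.stepOps (S.ops M₁ N₀) a (x, q))) := by
  have hint := S.integrable_phase_mul (S.integrable_stepOps_ops ha hw hN hM hN₀ () x)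
  obtain ⟨C, hC0, hC⟩ := S.norm_stepOps_ops_le hab
    (fun k δ x => mul_nonneg δ.2.1.le (hw' k x))
    (fun δ x k l hkl => mul_le_mul_of_nonneg_left (hwm' x hkl) δ.2.1.le) hN' hM' hN₀'
  rw [tendsto_iff_norm_sub_tendsto_zero]
  have hbound : ∀ᶠ δ in 𝓝[>] (0 : ℝ), ‖(∫ q, cis (S.Φ q) * b δ (x, q)) -
      ∫ q, cis (S.Φ q) * S.stepOps (S.ops M₁ N₀) a (x, q)‖ ≤
      δ * (C * w' (S.loss M₁) x * ∫ q : Q, decay q) := by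
    filter_upwards [Ioc_mem_nhdsGT (zero_lt_one : (0 : ℝ) < 1)] with δ hδ
    have hiso : ∀ d ∈ S.ops M₁ N₀, S.L d d = 0 := by
      intro d hd
      refine S.isotropic d ?_
      rw [ops, List.mem_append] at hd
      rw [List.mem_append]
      exact hd.imp mem_rep mem_rep
    have hbd := hb δ hδ.1
    rw [S.integral_stepOps hiso hbd x, ← integral_sub
      (S.integrable_phase_mul ((hbd.stepOps _).integrable x)) hint]
    simp only [← mul_sub]
    have := S.norm_integral_le_decay (C := δ * (C * w' (S.loss M₁) x))
      (g := fun q => S.stepOps (S.ops M₁ N₀) (b δ) (x, q) - S.stepOps (S.ops M₁ N₀) a (x, q))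
      fun q => ?_
    · rw [← mul_assoc]; exact this
    · have h := hC ⟨δ, hδ⟩ (x, q)
      rw [S.stepOps_sub _ hbd.smooth (ha.smooth ())] at h
      refine h.trans (le_of_eq ?_)
      simp only
      ring
  refine squeeze_zero' (Eventually.of_forall fun _ => norm_nonneg _) hbound ?_
  have : Tendsto (fun δ : ℝ => δ * (C * w' (S.loss M₁) x * ∫ q : Q, decay q)) (𝓝 0)
      (𝓝 (0 * (C * w' (S.loss M₁) x * ∫ q : Q, decay q))) := tendsto_id.mul_const _
  rw [zero_mul] at this
  exact this.mono_left nhdsWithin_le_nhds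

lemma one_add_norm_clm_le {E F : Type*} [NormedAddCommGroup E] [NormedSpace ℝ E]
    [NormedAddCommGroup F] [NormedSpace ℝ F] (A : E →L[ℝ] F) (x : E) :
    1 + ‖A x‖ ≤ (1 + ‖A‖) * (1 + ‖x‖) := by
  have h1 := A.le_opNorm x
  have h2 := norm_nonneg A
  have h3 := norm_nonneg x
  nlinarith

/-- An amplitude multiplied by a function which decays faster than any power. -/
lemma isDecaying_mul {a c : P × Q → ℂ} {g : ℕ → P → ℝ}
    (ha : IsAmp (S.hz P) (S.wt w₁ N M) fun _ => a) (hw : IsWeight w₁)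
    (hg : ∀ K x, 0 ≤ g K x)
    (hc : ∀ K, IsAmp (S.hz P) (fun _ (_ : Unit) p => g K p.1 * ((1 + ‖p.2‖) ^ K)⁻¹) fun _ => c) :
    S.IsDecaying fun p => a p * c p := by
  -- Enough decay to absorb the growth of the amplitude at order `k` and to leave the integrable
  -- weight.
  set K : ℕ → ℕ := fun k => N k + M + decayExp Q with hK
  -- The bounds for different powers are unrelated, so they are summed over all lower orders to
  -- obtain a monotone weight.
  refine ⟨fun k x => w₁ k () x * ∑ j ∈ Finset.range (k + 1), g (K j) x,
    fun k x => mul_nonneg (hw.nonneg _ _ _) (Finset.sum_nonneg fun j _ => hg _ _),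
    fun x k l hkl => ?_, ?_⟩
  · refine mul_le_mul (hw.mono () x hkl) ?_ (Finset.sum_nonneg fun j _ => hg _ _)
      (hw.nonneg _ _ _)
    exact Finset.sum_le_sum_of_subset_of_nonneg (Finset.range_mono (by omega))
      fun j _ _ => hg _ _
  · refine ha.mul_family hc (S.wt_nonneg hw.nonneg) (fun K k i p =>
      mul_nonneg (hg _ _) (by positivity)) fun j k => ⟨K j,
        (1 + ‖S.πu‖) ^ N j * (1 + ‖S.πv‖) ^ M, fun i p => ?_⟩
    have h1 : (1 + ‖S.πu p.2‖) ^ N j ≤ (1 + ‖S.πu‖) ^ N j * (1 + ‖p.2‖) ^ N j := by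
      rw [← mul_pow]; exact pow_le_pow_left₀ (by positivity) (one_add_norm_clm_le _ _) _
    have h2 : (1 + ‖S.πv p.2‖) ^ M ≤ (1 + ‖S.πv‖) ^ M * (1 + ‖p.2‖) ^ M := by
      rw [← mul_pow]; exact pow_le_pow_left₀ (by positivity) (one_add_norm_clm_le _ _) _
    have h3 : w₁ j i p.1 ≤ w₁ (j + k) () p.1 := hw.mono i p.1 (by omega)
    have h4 : g (K j) p.1 ≤ ∑ j ∈ Finset.range (j + k + 1), g (K j) p.1 :=
      Finset.single_le_sum (f := fun j => g (K j) p.1) (fun j _ => hg _ _) (by simp)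
    have h5 : (1 + ‖p.2‖) ^ N j * (1 + ‖p.2‖) ^ M * ((1 + ‖p.2‖) ^ K j)⁻¹ = decay p.2 := by
      have : (0 : ℝ) < 1 + ‖p.2‖ := by positivity
      rw [decay, hK, pow_add, pow_add, mul_inv, ← mul_assoc,
        mul_inv_cancel₀ (by positivity), one_mul]
    have hw0 := hw.nonneg j i p.1
    have hw1 := hw.nonneg (j + k) () p.1
    have hg0 := hg (K j) p.1
    calc S.wt w₁ N M j i p * (g (K j) p.1 * ((1 + ‖p.2‖) ^ K j)⁻¹)
        ≤ (w₁ j i p.1 * ((1 + ‖S.πu‖) ^ N j * (1 + ‖p.2‖) ^ N j) *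
          ((1 + ‖S.πv‖) ^ M * (1 + ‖p.2‖) ^ M)) * (g (K j) p.1 * ((1 + ‖p.2‖) ^ K j)⁻¹) := by
          unfold wt; gcongr
      _ = (1 + ‖S.πu‖) ^ N j * (1 + ‖S.πv‖) ^ M * ((w₁ j i p.1 * g (K j) p.1) *
          ((1 + ‖p.2‖) ^ N j * (1 + ‖p.2‖) ^ M * ((1 + ‖p.2‖) ^ K j)⁻¹)) := by ring
      _ = (1 + ‖S.πu‖) ^ N j * (1 + ‖S.πv‖) ^ M * ((w₁ j i p.1 * g (K j) p.1) * decay p.2) := by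
          rw [h5]
      _ ≤ _ := by
          exact mul_le_mul_of_nonneg_left (mul_le_mul_of_nonneg_right
            (mul_le_mul h3 h4 hg0 hw1) (decay_pos p.2).le) (by positivity)

lemma isDecaying_stdCutoff_mul {a : P × Q → ℂ} (ha : IsAmp (S.hz P) (S.wt w₁ N M) fun _ => a)
    (hw : IsWeight w₁) {δ : ℝ} (hδ : 0 < δ) :
    S.IsDecaying fun p => stdCutoff Q (δ • p.2) * a p := by
  have h := S.isDecaying_mul (c := fun p => stdCutoff Q (δ • p.2)) (g := fun _ _ => 1) ha hw
    (fun _ _ => zero_le_one) fun K => by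
      simpa using (isAmp_dilation (ι := Unit) (0 : Q →L[ℝ] Q) (stdCutoff Q) hδ K).comp_clm_const
        (hz' := S.hz P) (ContinuousLinearMap.snd ℝ P Q)
  simpa only [mul_comm] using h

/-- The cut-off differs from one by $O(\delta(1+|q|))$, hence by $O(\delta(1+|u|)(1+|v|))$: the rate
costs one power in each group of coordinates. -/
lemma isAmp_stdCutoff_sub {a : P × Q → ℂ} (ha : IsAmp (S.hz P) (S.wt w₁ N M) fun _ => a)
    (hw : IsWeight w₁) (hN : Monotone N) :
    IsAmp (S.hz P) (S.wt (fun k (δ : Set.Ioc (0 : ℝ) 1) x => δ * w₁ k () x)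
      (fun k => N k + 1) (M + 1)) fun δ p => stdCutoff Q ((δ : ℝ) • p.2) * a p - a p := by
  obtain ⟨C, hC⟩ := S.boundQ
  have h1 := (isAmp_cutoff (0 : Q →L[ℝ] Q) (stdCutoff Q)).comp_clm_const
    (hz' := S.hz P) (ContinuousLinearMap.snd ℝ P Q)
  have h2 := h1.mul (W₃ := S.wt (fun k (δ : Set.Ioc (0 : ℝ) 1) x => δ * w₁ k () x)
      (fun k => N k + 1) (M + 1)) (ha.reindex (fun _ : Set.Ioc (0 : ℝ) 1 => ()))
    (fun _ δ p => mul_nonneg δ.2.1.le (by positivity)) (fun k _ p => S.wt_nonneg hw.nonneg _ _ _)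
    fun j k => ⟨C, fun δ p => ?_⟩
  · simp only [stdCutoff_zero, ContinuousLinearMap.coe_snd', sub_mul, one_mul] at h2
    exact h2
  · have h3 := hC p.2
    have h4 := S.wt_monotone (M := M) hw.nonneg hw.mono hN () p (Nat.le_add_left k j)
    have h5 := S.wt_nonneg (N := N) (M := M) hw.nonneg k () p
    have h6 := δ.2.1.le
    calc (δ : ℝ) * (1 + ‖p.2‖) * S.wt w₁ N M k () p
        ≤ δ * (C * ((1 + ‖S.πu p.2‖) * (1 + ‖S.πv p.2‖))) * S.wt w₁ N M (j + k) () p := by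
          have h7 : 0 ≤ (δ : ℝ) * (1 + ‖p.2‖) := by positivity
          have h8 : (δ : ℝ) * (1 + ‖p.2‖) ≤ δ * (C * ((1 + ‖S.πu p.2‖) * (1 + ‖S.πv p.2‖))) :=
            mul_le_mul_of_nonneg_left h3 h6
          exact mul_le_mul h8 h4 h5 (h7.trans h8)
      _ = _ := by simp only [wt]; ring

/-- Any sufficiently large number of steps gives the same value. The two summands `1` leave room for
the error amplitude of the cut-off. -/
lemma osc_eq {a : ι → P × Q → ℂ} (ha : IsAmp (S.hz P) (S.wt w N M) a) (hw : IsWeight w)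
    (hN : Monotone N) (hM : M + 1 ≤ M₁) (hN₀ : N (S.loss M₁) + 1 ≤ N₀) (i : ι) (x : P) :
    S.osc (a i) x = ∫ q, cis (S.Φ q) * S.stepOps (S.ops M₁ N₀) (a i) (x, q) := by
  have ha' := ha.reindex fun _ : Unit => i
  have hw' := hw.reindex fun _ : Unit => i
  exact (S.tendsto_integral_stepOps (b := fun δ p => stdCutoff Q (δ • p.2) * a i p) ha' hw' hN
    (fun δ hδ => S.isDecaying_stdCutoff_mul ha' hw' hδ) (S.isAmp_stdCutoff_sub ha' hw' hN)
    (fun k x => hw.nonneg k i x) (fun x => hw.mono i x) (fun k l hkl => Nat.add_le_add_right (hN hkl) 1)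
    (by omega) hM (by omega) hN₀ x).limUnder_eq

/-- The numbers of steps are taken so large that they suit the amplitude, the given error and the
standard cut-off together; by `osc_eq` the limit is then the standard one. -/
lemma tendsto_osc {a : P × Q → ℂ} {b : ℝ → P × Q → ℂ} {w' : ℕ → P → ℝ}
    (ha : IsAmp (S.hz P) (S.wt w₁ N M) fun _ => a) (hw : IsWeight w₁) (hN : Monotone N)
    (hb : ∀ δ, 0 < δ → S.IsDecaying (b δ))
    (hab : IsAmp (S.hz P) (S.wt (fun k (δ : Set.Ioc (0 : ℝ) 1) x => δ * w' k x) N' M')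
      fun δ p => b δ p - a p)
    (hw' : ∀ k x, 0 ≤ w' k x) (hwm' : ∀ x, Monotone fun k => w' k x) (hN' : Monotone N')
    (x : P) :
    Tendsto (fun δ : ℝ => ∫ q, cis (S.Φ q) * b δ (x, q)) (𝓝[>] 0) (𝓝 (S.osc a x)) := by
  have h1 := S.osc_eq ha hw hN (M₁ := M + M' + 1) (N₀ := N (S.loss (M + M' + 1)) +
    N' (S.loss (M + M' + 1)) + 1) (by omega) (by omega) () x
  rw [h1]
  exact S.tendsto_integral_stepOps ha hw hN hb hab hw' hwm' hN' (by omega) (by omega) (by omega)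
    (by omega) x

lemma tendsto_osc_stdCutoff {a : ι → P × Q → ℂ} (ha : IsAmp (S.hz P) (S.wt w N M) a)
    (hw : IsWeight w) (hN : Monotone N) (i : ι) (x : P) :
    Tendsto (fun δ : ℝ => ∫ q, cis (S.Φ q) * (stdCutoff Q (δ • q) * a i (x, q))) (𝓝[>] 0)
      (𝓝 (S.osc (a i) x)) := by
  have ha' := ha.reindex fun _ : Unit => i
  have hw' := hw.reindex fun _ : Unit => i
  exact S.tendsto_osc (b := fun δ p => stdCutoff Q (δ • p.2) * a i p) ha' hw' hN
    (fun δ hδ => S.isDecaying_stdCutoff_mul ha' hw' hδ) (S.isAmp_stdCutoff_sub ha' hw' hN)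
    (fun k x => hw.nonneg k i x) (fun x => hw.mono i x)
    (fun k l hkl => Nat.add_le_add_right (hN hkl) 1) x

lemma osc_add {a b : ι → P × Q → ℂ} (ha : IsAmp (S.hz P) (S.wt w N M) a)
    (hb : IsAmp (S.hz P) (S.wt w N M) b) (hw : IsWeight w) (hN : Monotone N) (i : ι) (x : P) :
    S.osc (fun p => a i p + b i p) x = S.osc (a i) x + S.osc (b i) x := by
  refine tendsto_nhds_unique (S.tendsto_osc_stdCutoff (ha.add hb) hw hN i x)
    (((S.tendsto_osc_stdCutoff ha hw hN i x).add (S.tendsto_osc_stdCutoff hb hw hN i x)).congr' ?_)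
  filter_upwards [self_mem_nhdsWithin] with δ hδ
  have hw' := hw.reindex fun _ : Unit => i
  have h1 := (S.isDecaying_stdCutoff_mul (ha.reindex fun _ : Unit => i) hw' hδ).integrable x
  have h2 := (S.isDecaying_stdCutoff_mul (hb.reindex fun _ : Unit => i) hw' hδ).integrable x
  rw [← integral_add (S.integrable_phase_mul h1) (S.integrable_phase_mul h2)]
  congr 1
  ext q
  ring

/-- Additivity for three members of one family, whose weights may differ. It yields linearity of
quantization in the Schwartz function, which is itself part of the index. -/
lemma osc_add_of_eq {a : ι → P × Q → ℂ} (ha : IsAmp (S.hz P) (S.wt w N M) a)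
    (hw : IsWeight w) (hN : Monotone N) {i j k : ι} (h : ∀ p, a k p = a i p + a j p) (x : P) :
    S.osc (a k) x = S.osc (a i) x + S.osc (a j) x := by
  refine tendsto_nhds_unique (S.tendsto_osc_stdCutoff ha hw hN k x)
    (((S.tendsto_osc_stdCutoff ha hw hN i x).add (S.tendsto_osc_stdCutoff ha hw hN j x)).congr' ?_)
  filter_upwards [self_mem_nhdsWithin] with δ hδ
  have h1 := fun i => (S.isDecaying_stdCutoff_mul (ha.reindex fun _ : Unit => i)
    (hw.reindex fun _ : Unit => i) hδ).integrable x
  rw [← integral_add (S.integrable_phase_mul (h1 i)) (S.integrable_phase_mul (h1 j))]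
  congr 1
  ext q
  rw [h]
  ring

lemma osc_const_mul {a : ι → P × Q → ℂ} (ha : IsAmp (S.hz P) (S.wt w N M) a)
    (hw : IsWeight w) (hN : Monotone N) (c : ℂ) (i : ι) (x : P) :
    S.osc (fun p => c * a i p) x = c * S.osc (a i) x := by
  refine tendsto_nhds_unique
    (S.tendsto_osc_stdCutoff (ha.smul c (S.wt_nonneg hw.nonneg)) hw hN i x)
    (((S.tendsto_osc_stdCutoff ha hw hN i x).const_mul c).congr fun δ => ?_)
  rw [← integral_const_mul]
  congr 1
  ext q
  ring

lemma osc_sub {a b : ι → P × Q → ℂ} (ha : IsAmp (S.hz P) (S.wt w N M) a)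
    (hb : IsAmp (S.hz P) (S.wt w N M) b) (hw : IsWeight w) (hN : Monotone N) (i : ι) (x : P) :
    S.osc (fun p => a i p - b i p) x = S.osc (a i) x - S.osc (b i) x := by
  have h := S.osc_add ha (hb.smul (-1) (S.wt_nonneg hw.nonneg)) hw hN i x
  rw [S.osc_const_mul hb hw hN] at h
  simpa [sub_eq_add_neg] using h

lemma osc_eq_integral {a : ι → P × Q → ℂ} (ha : IsAmp (S.hz P) (S.wt w N M) a)
    (hw : IsWeight w) (hN : Monotone N) (i : ι) (hd : S.IsDecaying (a i)) (x : P) :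
    S.osc (a i) x = ∫ q, cis (S.Φ q) * a i (x, q) := by
  have h := S.tendsto_osc (b := fun _ => a i) (w' := fun _ _ => 0) (N' := fun _ => 0) (M' := 0)
    (ha.reindex fun _ : Unit => i) (hw.reindex fun _ : Unit => i) hN (fun _ _ => hd)
    (by
      simp only [sub_self]
      exact fun n => isAmpN_zero fun k δ p => S.wt_nonneg (by simp) _ _ _)
    (fun _ _ => le_rfl) (fun _ => monotone_const) monotone_const x
  exact tendsto_nhds_unique h tendsto_const_nhds

variable [FiniteDimensional ℝ P]

lemma isAmp_deriv_wt {a : ι → P × Q → ℂ} (ha : IsAmp (S.hz P) (S.wt w N M) a)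
    (hw : IsWeight w) (hN : Monotone N) (e : P × Q) :
    IsAmp (S.hz P) (S.wt (fun k => w (k + 1)) (fun k => N (k + 1)) M)
      (fun i => dirDeriv e (a i)) := by
  refine (ha.deriv e).mono (fun k => S.wt_nonneg hw.nonneg _) fun k => ⟨1, fun i p => ?_⟩
  rw [one_mul]
  exact S.wt_monotone (M := M) hw.nonneg hw.mono hN i p
    (by have := step_le_one (S.hz P) e; omega : k + step (S.hz P) e ≤ k + 1)

/-- Differentiation under the integral, after the integrations by parts have made it absolutely
convergent. Parameter derivatives commute with these steps, so the derivative is again an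
oscillatory integral. -/
lemma hasFDerivAt_osc {a : ι → P × Q → ℂ} (ha : IsAmp (S.hz P) (S.wt w N M) a)
    (hw : IsWeight w) (hN : Monotone N) (i : ι) (x : P) :
    ∃ T : P →L[ℝ] ℂ, HasFDerivAt (S.osc (a i)) T x ∧
      ∀ v, T v = S.osc (dirDeriv (v, 0) (a i)) x := by
  set M₁ := M + 1 with hM₁
  -- One horizontal derivative beyond the loss is provided for, so the same steps serve the
  -- amplitude and its parameter derivatives.
  set N₀ := N (S.loss M₁ + 1) + 1 with hN₀
  have hNN : N (S.loss M₁) + 1 ≤ N₀ := by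
    have : N (S.loss M₁) ≤ N (S.loss M₁ + 1) := hN (Nat.le_succ _)
    omega
  set G : P × Q → ℂ := S.stepOps (S.ops M₁ N₀) (a i) with hG
  have hGs : ContDiff ℝ ∞ G := S.contDiff_stepOps _ (ha.smooth i)
  have hfd : ∀ p : P × Q, HasFDerivAt G (fderiv ℝ G p) p := fun p =>
    (hGs.differentiable (by simp) p).hasFDerivAt
  have hder : ∀ v : P, dirDeriv (v, 0) G = S.stepOps (S.ops M₁ N₀) (dirDeriv (v, 0) (a i)) :=
    S.stepOps_dirDeriv _ (ha.smooth i)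
  have hda := fun e => S.isAmp_deriv_wt ha hw hN e
  have hN' : Monotone fun k => N (k + 1) := fun k l hkl => hN (by omega)
  have hbd : ∀ v : P, ∃ C, 0 ≤ C ∧ ∀ p,
      ‖dirDeriv (v, 0) G p‖ ≤ C * (w (S.loss M₁ + 1) i p.1 * decay p.2) := by
    intro v
    obtain ⟨C, hC0, hC⟩ := S.norm_stepOps_ops_le (N₀ := N₀) (M' := M₁) (hda (v, 0))
      (hw.shift 1).nonneg (hw.shift 1).mono hN' (by omega) (Nat.le_succ _)
    refine ⟨C, hC0, fun p => ?_⟩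
    rw [hder]
    exact hC i p
  set B := Module.finBasis ℝ P with hB
  obtain ⟨K, hK0, hK⟩ := B.exists_opNorm_le (F := ℂ)
  choose C hC0 hC using hbd
  set C₁ := ∑ j, C (B j) with hC₁
  have hC₁0 : 0 ≤ C₁ := Finset.sum_nonneg fun j _ => hC0 _
  set F' : P → Q → P →L[ℝ] ℂ := fun y q =>
    cis (S.Φ q) • (fderiv ℝ G (y, q)).comp (ContinuousLinearMap.inl ℝ P Q) with hF'
  have hF'v : ∀ y q v, F' y q v = cis (S.Φ q) * dirDeriv (v, 0) G (y, q) := fun y q v => by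
    simp [hF', dirDeriv]
  have hF'bd : ∀ y q, ‖F' y q‖ ≤ K * (C₁ * (w (S.loss M₁ + 1) i y * decay q)) := by
    intro y q
    have h0 : 0 ≤ w (S.loss M₁ + 1) i y * decay q :=
      mul_nonneg (hw.nonneg _ _ _) (decay_pos _).le
    refine hK (mul_nonneg hC₁0 h0) fun j => ?_
    rw [hF'v, norm_mul, norm_cis, one_mul]
    refine (hC (B j) (y, q)).trans (mul_le_mul_of_nonneg_right ?_ h0)
    exact Finset.single_le_sum (f := fun j => C (B j)) (fun j _ => hC0 _) (Finset.mem_univ j)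
  obtain ⟨Cw, hCw⟩ := hw.locBdd (S.loss M₁ + 1) i x
  have hphase := continuous_cis.comp S.phase_continuous
  have hF'c : Continuous (F' x) := by
    refine hphase.smul ?_
    have : Continuous fun q : Q => fderiv ℝ G (x, q) :=
      (hGs.continuous_fderiv (by simp)).comp (Continuous.prodMk_right x)
    fun_prop
  have hF'i : Integrable (F' x) := by
    refine (integrable_decay.const_mul (K * (C₁ * w (S.loss M₁ + 1) i x))).mono'
      hF'c.aestronglyMeasurable (Eventually.of_forall fun q => (hF'bd x q).trans (le_of_eq ?_))
    ring
  have hmain : HasFDerivAt (fun y => ∫ q, cis (S.Φ q) * G (y, q)) (∫ q, F' x q) x := by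
    -- Local boundedness of the weight makes this set a neighbourhood of `x`, on which one multiple
    -- of `decay` dominates.
    refine hasFDerivAt_integral_of_dominated_of_fderiv_le (s := {y | w (S.loss M₁ + 1) i y ≤ Cw})
      (bound := fun q => K * (C₁ * (Cw * decay q))) hCw
      (Eventually.of_forall fun y => ?_) ?_ hF'c.aestronglyMeasurable
      (Eventually.of_forall fun q y hy => (hF'bd y q).trans ?_)
      (((integrable_decay.const_mul Cw).const_mul C₁).const_mul K)
      (Eventually.of_forall fun q y hy => ?_)
    · exact (hphase.mul (hGs.continuous.comp (Continuous.prodMk_right y))).aestronglyMeasurable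
    · exact S.integrable_phase_mul (S.integrable_stepOps_ops ha hw hN (by omega) (by omega) i x)
    · have h1 := (decay_pos q).le
      have h2 : w (S.loss M₁ + 1) i y ≤ Cw := hy
      gcongr
    · have h1 : HasFDerivAt (fun y : P => G (y, q)) _ y :=
        (hfd (y, q)).comp y (hasFDerivAt_prodMk_left y q)
      exact h1.const_mul (cis (S.Φ q))
  refine ⟨∫ q, F' x q, ?_, fun v => ?_⟩
  · have : S.osc (a i) = fun y => ∫ q, cis (S.Φ q) * G (y, q) := by
      ext y
      exact S.osc_eq ha hw hN (by omega) hNN i y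
    rw [this]
    exact hmain
  · rw [ContinuousLinearMap.integral_apply hF'i]
    simp only [hF'v, hder]
    exact (S.osc_eq (hda (v, 0)) (hw.shift 1) hN' (by omega) (by omega) i x).symm

lemma dirDeriv_osc {a : ι → P × Q → ℂ} (ha : IsAmp (S.hz P) (S.wt w N M) a)
    (hw : IsWeight w) (hN : Monotone N) (i : ι) (v : P) :
    dirDeriv v (S.osc (a i)) = S.osc (dirDeriv (v, 0) (a i)) := by
  ext x
  obtain ⟨T, hT, hTv⟩ := S.hasFDerivAt_osc ha hw hN i x
  rw [dirDeriv, hT.fderiv, hTv]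

lemma contDiff_osc {a : ι → P × Q → ℂ} (ha : IsAmp (S.hz P) (S.wt w N M) a)
    (hw : IsWeight w) (hN : Monotone N) (i : ι) : ContDiff ℝ ∞ (S.osc (a i)) := by
  refine contDiff_infty.mpr fun n => ?_
  induction n generalizing w N a with
  | zero =>
    refine contDiff_zero.mpr (continuous_iff_continuousAt.mpr fun x => ?_)
    obtain ⟨T, hT, -⟩ := S.hasFDerivAt_osc ha hw hN i x
    exact hT.continuousAt
  | succ n ih =>
    rw [Nat.cast_succ, contDiff_succ_iff_fderiv_apply]
    refine ⟨fun x => ?_, by simp, fun v => ?_⟩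
    · obtain ⟨T, hT, -⟩ := S.hasFDerivAt_osc ha hw hN i x
      exact hT.differentiableAt
    · have := S.dirDeriv_osc ha hw hN i v
      rw [show (fun x => fderiv ℝ (S.osc (a i)) x v) = dirDeriv v (S.osc (a i)) from rfl, this]
      exact ih (a := fun i => dirDeriv (v, 0) (a i)) (S.isAmp_deriv_wt ha hw hN (v, 0))
        (hw.shift 1) fun k l hkl => hN (Nat.add_le_add_right hkl 1)

/-- Oscillatory integrals of families of amplitudes are controlled by the weights. -/
lemma isAmp_osc {a : ι → P × Q → ℂ} (ha : IsAmp (S.hz P) (S.wt w N M) a)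
    (hw : IsWeight w) (hN : Monotone N) :
    IsAmp (ContinuousLinearMap.id ℝ P) (fun k i x => w (k + S.loss (M + 1)) i x)
      (fun i => S.osc (a i)) := by
  intro n
  have h0 : ∀ {a : ι → P × Q → ℂ} {w : ℕ → ι → P → ℝ} {N : ℕ → ℕ},
      IsAmp (S.hz P) (S.wt w N M) a → IsWeight w → Monotone N →
      (∀ i, ContDiff ℝ ∞ (S.osc (a i))) ∧
        ∃ C, ∀ i x, ‖S.osc (a i) x‖ ≤ C * w (0 + S.loss (M + 1)) i x := by
    intro a w N ha hw hN
    refine ⟨S.contDiff_osc ha hw hN, ?_⟩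
    obtain ⟨C, hC0, hC⟩ := S.norm_stepOps_ops_le (M' := M + 1) (N₀ := N (S.loss (M + 1)) + 1) ha
      hw.nonneg hw.mono hN (by omega) (by omega)
    refine ⟨C * ∫ q : Q, decay q, fun i x => ?_⟩
    rw [S.osc_eq ha hw hN le_rfl le_rfl i x, zero_add]
    refine (S.norm_integral_le_decay (C := C * w (S.loss (M + 1)) i x) fun q => ?_).trans
      (le_of_eq (by ring))
    rw [mul_assoc]
    exact hC i (x, q)
  induction n generalizing w N a with
  | zero => exact h0 ha hw hN
  | succ n ih =>
    refine ⟨h0 ha hw hN, fun v => ?_⟩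
    by_cases hv : v = 0
    · subst hv
      simp only [dirDeriv_zero_right]
      exact isAmpN_zero fun k i x => hw.nonneg _ _ _
    · rw [step_of_ne_zero (by simpa using hv)]
      simp only [S.dirDeriv_osc ha hw hN]
      have := ih (S.isAmp_deriv_wt ha hw hN (v, 0)) (hw.shift 1) fun k l hkl => hN (by omega)
      simpa only [add_right_comm] using this

end OscPhase

/-! ### Exponentials of real amplitudes. -/

section Exponentials

variable {D : Type*} [NormedAddCommGroup D] [NormedSpace ℝ D] {ι : Type*}

lemma dirDeriv_cis {θ : D → ℝ} (hθ : ContDiff ℝ ∞ fun p => ((θ p : ℝ) : ℂ)) (e : D) :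
    dirDeriv e (fun p => cis (θ p)) =
      fun p => Complex.I * dirDeriv e (fun p => ((θ p : ℝ) : ℂ)) p * cis (θ p) := by
  ext p
  have h := ((hθ.differentiable (by simp) p).hasFDerivAt.const_mul Complex.I).cexp
  have : fderiv ℝ (fun p => cis (θ p)) p = _ := h.fderiv
  rw [dirDeriv, this]
  simp [dirDeriv, cis]
  ring

/-- From $\partial e^{i\theta}=i\,\partial\theta\,e^{i\theta}$ by induction on the order. Only
derivatives of $\theta$ enter, hence the index `j + 1`; the size of $\theta$ itself is irrelevant.
-/
lemma isAmp_cis {θ : ι → D → ℝ} {Wθ W : ℕ → ι → D → ℝ}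
    (hθ : IsAmp (ContinuousLinearMap.id ℝ D) Wθ fun i p => ((θ i p : ℝ) : ℂ))
    (hWθ : ∀ k i p, 0 ≤ Wθ k i p) (hW : ∀ k i p, 0 ≤ W k i p) (hW1 : ∀ i p, 1 ≤ W 0 i p)
    (h : ∀ j k, ∃ C, ∀ i p, Wθ (j + 1) i p * W k i p ≤ C * W (j + k + 1) i p) :
    IsAmp (ContinuousLinearMap.id ℝ D) W fun i p => cis (θ i p) := by
  have hs : ∀ i, ContDiff ℝ ∞ fun p => cis (θ i p) := fun i =>
    (contDiff_const.mul (hθ.smooth i)).cexp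
  have h0 : (∀ i, ContDiff ℝ ∞ fun p => cis (θ i p)) ∧
      ∃ C, ∀ i p, ‖cis (θ i p)‖ ≤ C * W 0 i p :=
    ⟨hs, 1, fun i p => by rw [norm_cis, one_mul]; exact hW1 i p⟩
  intro n
  induction n with
  | zero => exact h0
  | succ n ih =>
    refine ⟨h0, fun e => ?_⟩
    by_cases he : e = 0
    · subst he
      simp only [dirDeriv_zero_right]
      exact isAmpN_zero fun k => hW _
    · have hst := step_of_ne_zero (hz := ContinuousLinearMap.id ℝ D) (e := e) (by simpa using he)
      have h1 := (hθ (n + 1)).2 e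
      rw [hst] at h1 ⊢
      simp only [dirDeriv_cis (hθ.smooth _)]
      exact (h1.smul Complex.I fun k => hWθ _).mul ih (fun k => hWθ _) hW h

end Exponentials

/-! ### Averages over a compact space of pull-backs under linear maps. -/

section ParametricIntegrals

variable {D E T : Type*} [NormedAddCommGroup D] [NormedSpace ℝ D] [FiniteDimensional ℝ D]
  [NormedAddCommGroup E] [NormedSpace ℝ E] [FiniteDimensional ℝ E]
  [TopologicalSpace T] [CompactSpace T] [SecondCountableTopology T] [MeasurableSpace T]
  [OpensMeasurableSpace T] {ν : Measure T} [IsFiniteMeasure ν]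

lemma integrable_of_continuous_compact {F : Type*} [NormedAddCommGroup F] {f : T → F}
    (hf : Continuous f) : Integrable f ν := by
  obtain ⟨C, hC⟩ := isCompact_univ.exists_bound_of_continuousOn hf.continuousOn
  exact Integrable.of_bound hf.aestronglyMeasurable C
    (Eventually.of_forall fun t => hC t trivial)

lemma dirDeriv_parametric {A : T → D →L[ℝ] E} (hA : Continuous A) {c : T → ℂ}
    (hc : Continuous c) {G : E → ℂ} (hG : ContDiff ℝ ∞ G) (q : D) :
    HasFDerivAt (fun q => ∫ t, c t * G (A t q) ∂ν)
      (∫ t, c t • (fderiv ℝ G (A t q)).comp (A t) ∂ν) q := by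
  have hGd := hG.continuous_fderiv (by simp)
  have hcont : Continuous fun p : D × T => c p.2 • (fderiv ℝ G (A p.2 p.1)).comp (A p.2) := by
    have h1 : Continuous fun p : D × T => A p.2 := hA.comp continuous_snd
    exact (hc.comp continuous_snd).smul
      ((hGd.comp (h1.clm_apply continuous_fst)).clm_comp h1)
  have hK : IsCompact (Metric.closedBall q 1 ×ˢ (Set.univ : Set T)) :=
    (isCompact_closedBall q 1).prod isCompact_univ
  obtain ⟨C, hC⟩ := hK.exists_bound_of_continuousOn hcont.continuousOn
  refine hasFDerivAt_integral_of_dominated_of_fderiv_le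
    (F' := fun q t => c t • (fderiv ℝ G (A t q)).comp (A t)) (bound := fun _ => C)
    (Metric.closedBall_mem_nhds q zero_lt_one)
    (Eventually.of_forall fun q => ?_) ?_ ?_ ?_ (integrable_const C) ?_
  · exact (hc.mul (hG.continuous.comp (hA.clm_apply continuous_const))).aestronglyMeasurable
  · exact integrable_of_continuous_compact
      (hc.mul (hG.continuous.comp (hA.clm_apply continuous_const)))
  · exact (hcont.comp (Continuous.prodMk_right q)).aestronglyMeasurable
  · exact Eventually.of_forall fun t y hy => hC (y, t) ⟨hy, trivial⟩
  · refine Eventually.of_forall fun t y hy => ?_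
    exact (((hG.differentiable (by simp) _).hasFDerivAt.comp y (A t).hasFDerivAt).const_mul (c t))

/-- Expanding the moving direction `A t e` in a fixed basis puts its coordinates into the
coefficient. The derivative is then a sum of integrals of the same form, so inductions on the order
close. -/
lemma dirDeriv_parametric_eq {A : T → D →L[ℝ] E} (hA : Continuous A) {c : T → ℂ}
    (hc : Continuous c) {G : E → ℂ} (hG : ContDiff ℝ ∞ G) (e : D) :
    dirDeriv e (fun q => ∫ t, c t * G (A t q) ∂ν) = fun q =>
      ∑ j, ∫ t, (c t * ((Module.finBasis ℝ E).repr (A t e) j : ℝ)) *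
        dirDeriv (Module.finBasis ℝ E j) G (A t q) ∂ν := by
  set v := Module.finBasis ℝ E with hv
  ext q
  have hcoord : ∀ j, Continuous fun t => ((v.repr (A t e) j : ℝ) : ℂ) := fun j =>
    Complex.continuous_ofReal.comp ((LinearMap.continuous_of_finiteDimensional (v.coord j)).comp
      (hA.clm_apply continuous_const))
  have hGc := hG.continuous_fderiv (by simp)
  have hAq : Continuous fun t => A t q := hA.clm_apply continuous_const
  rw [dirDeriv, (dirDeriv_parametric hA hc hG q).fderiv, ContinuousLinearMap.integral_apply]
  · rw [← integral_finsetSum]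
    · refine integral_congr_ae (Eventually.of_forall fun t => ?_)
      simp only [smul_apply, ContinuousLinearMap.comp_apply, smul_eq_mul, dirDeriv]
      conv_lhs => rw [← v.sum_repr (A t e), map_sum, Finset.mul_sum]
      refine Finset.sum_congr rfl fun j _ => ?_
      rw [map_smul, Complex.real_smul, mul_assoc]
    · intro j _
      refine integrable_of_continuous_compact ((hc.mul (hcoord j)).mul ?_)
      exact (hGc.comp hAq).clm_apply continuous_const
  · exact integrable_of_continuous_compact (hc.smul ((hGc.comp hAq).clm_comp hA))

lemma contDiff_parametric {A : T → D →L[ℝ] E} (hA : Continuous A) {c : T → ℂ}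
    (hc : Continuous c) {G : E → ℂ} (hG : ContDiff ℝ ∞ G) :
    ContDiff ℝ ∞ fun q => ∫ t, c t * G (A t q) ∂ν := by
  refine contDiff_infty.mpr fun n => ?_
  induction n generalizing c G with
  | zero =>
    exact contDiff_zero.mpr (continuous_iff_continuousAt.mpr fun x =>
      (dirDeriv_parametric hA hc hG x).continuousAt)
  | succ n ih =>
    rw [Nat.cast_succ, contDiff_succ_iff_fderiv_apply]
    refine ⟨fun x => (dirDeriv_parametric hA hc hG x).differentiableAt, by simp, fun e => ?_⟩
    have := dirDeriv_parametric_eq (ν := ν) hA hc hG e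
    unfold dirDeriv at this
    rw [this]
    refine ContDiff.sum fun j _ => ih ?_ (contDiff_dirDeriv hG _)
    exact hc.mul (Complex.continuous_ofReal.comp ((LinearMap.continuous_of_finiteDimensional
      ((Module.finBasis ℝ E).coord j)).comp (hA.clm_apply continuous_const)))

lemma isAmp_parametric {A : T → D →L[ℝ] E} (hA : Continuous A) {c : T → ℂ}
    (hc : Continuous c) {G : E → ℂ} {N : ℕ → ℕ}
    (hG : IsAmp (ContinuousLinearMap.id ℝ E) (fun k (_ : Unit) p => (1 + ‖p‖) ^ N k) fun _ => G)
    (hN : Monotone N) :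
    IsAmp (ContinuousLinearMap.id ℝ D) (fun k (_ : Unit) p => (1 + ‖p‖) ^ N k)
      fun _ q => ∫ t, c t * G (A t q) ∂ν := by
  obtain ⟨CA, hCA⟩ := isCompact_univ.exists_bound_of_continuousOn hA.continuousOn
  have hA' : ∀ t q, 1 + ‖A t q‖ ≤ (1 + |CA|) * (1 + ‖q‖) := by
    intro t q
    have h1 := (A t).le_of_opNorm_le (hCA t trivial) q
    have h2 : CA * ‖q‖ ≤ |CA| * ‖q‖ := mul_le_mul_of_nonneg_right (le_abs_self _) (norm_nonneg _)
    nlinarith [norm_nonneg q, abs_nonneg CA]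
  have h0 : ∀ {c : T → ℂ} {G : E → ℂ} {N : ℕ → ℕ}, Continuous c →
      IsAmp (ContinuousLinearMap.id ℝ E) (fun k (_ : Unit) p => (1 + ‖p‖) ^ N k) (fun _ => G) →
      (∀ _ : Unit, ContDiff ℝ ∞ fun q => ∫ t, c t * G (A t q) ∂ν) ∧
        ∃ C : ℝ, ∀ (_ : Unit) q, ‖∫ t, c t * G (A t q) ∂ν‖ ≤ C * (1 + ‖q‖) ^ N 0 := by
    intro c G N hc hG
    refine ⟨fun _ => contDiff_parametric hA hc (hG.smooth ()), ?_⟩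
    obtain ⟨C, hC0, hC⟩ := hG.bound fun _ _ _ => by positivity
    obtain ⟨Cc, hCc⟩ := isCompact_univ.exists_bound_of_continuousOn hc.continuousOn
    refine ⟨|Cc| * (C * (1 + |CA|) ^ N 0) * ν.real Set.univ, fun _ q => ?_⟩
    have := norm_integral_le_of_norm_le_const (μ := ν) (f := fun t => c t * G (A t q))
      (C := |Cc| * (C * ((1 + |CA|) * (1 + ‖q‖)) ^ N 0)) (Eventually.of_forall fun t => ?_)
    · refine this.trans (le_of_eq ?_)
      rw [mul_pow]; ring
    · rw [norm_mul]
      refine mul_le_mul ((hCc t trivial).trans (le_abs_self _)) ((hC () _).trans ?_)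
        (norm_nonneg _) (abs_nonneg _)
      exact mul_le_mul_of_nonneg_left (pow_le_pow_left₀ (by positivity) (hA' t q) _) hC0
  intro n
  induction n generalizing c G N with
  | zero => exact h0 hc hG
  | succ n ih =>
    refine ⟨h0 hc hG, fun e => ?_⟩
    by_cases he : e = 0
    · subst he
      simp only [dirDeriv_zero_right]
      exact isAmpN_zero fun k _ _ => by positivity
    · rw [step_of_ne_zero (by simpa using he)]
      simp only [dirDeriv_parametric_eq hA hc (hG.smooth ())]
      refine IsAmpN.sum (fun j _ => ?_) fun _ _ _ => by positivity
      refine ih (N := fun k => N (k + 1)) ?_ ?_ fun k l hkl => hN (by omega)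
      · exact hc.mul (Complex.continuous_ofReal.comp ((LinearMap.continuous_of_finiteDimensional
          ((Module.finBasis ℝ E).coord j)).comp (hA.clm_apply continuous_const)))
      · refine (hG.deriv _).mono (fun _ _ _ => by positivity) fun k => ⟨1, fun _ p => ?_⟩
        rw [one_mul]
        exact pow_le_pow_right₀ (one_le_one_add_norm p)
          (hN (by have := step_le_one (ContinuousLinearMap.id ℝ E) (Module.finBasis ℝ E j); omega))

end ParametricIntegrals

/-! ### Growth of magnetic fluxes and circulations. -/

section Fluxes

variable {d : ℕ}

lemma integral_unitInterval (f : ℝ → ℝ) :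
    ∫ t : unitInterval, f t = ∫ t in (0 : ℝ)..1, f t := by
  rw [intervalIntegral.integral_of_le zero_le_one, ← integral_Icc_eq_integral_Ioc]
  exact integral_subtype measurableSet_Icc f

/-- The substitution $t\mapsto(1-s)t$ turns the triangle into a square, a fixed compact parameter
space over which the corners enter linearly. -/
lemma flux_eq {B : Fin d → Fin d → Conf d → ℝ} (hB : ∀ l j, Continuous (B l j))
    (x y z : Conf d) :
    ((flux B x y z : ℝ) : ℂ) = ∑ l, ∑ j, (((y - x) l : ℝ) : ℂ) * (((z - x) j : ℝ) : ℂ) *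
      ∫ t : unitInterval × unitInterval, ((1 - (t.1 : ℝ) : ℝ) : ℂ) *
        ((B l j (x + (t.1 : ℝ) • (y - x) + ((1 - (t.1 : ℝ)) * t.2) • (z - x)) : ℝ) : ℂ) := by
  have hc : ∀ l j, Continuous fun t : ℝ × ℝ =>
      (1 - t.1) * B l j (x + t.1 • (y - x) + ((1 - t.1) * t.2) • (z - x)) := fun l j => by
    have := hB l j
    fun_prop
  have h1 : flux B x y z = ∫ s in (0 : ℝ)..1, ∫ t in (0 : ℝ)..1, ∑ l, ∑ j,
      ((y - x) l * (z - x) j) * ((1 - s) *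
        B l j (x + s • (y - x) + ((1 - s) * t) • (z - x))) := by
    unfold flux
    refine intervalIntegral.integral_congr fun s _ => ?_
    simp only
    have := intervalIntegral.smul_integral_comp_mul_left (a := 0) (b := 1)
      (fun t => ∑ l, ∑ j, B l j (x + s • (y - x) + t • (z - x)) * (y l - x l) * (z j - x j))
      (1 - s)
    rw [mul_zero, mul_one] at this
    rw [← this, smul_eq_mul, ← intervalIntegral.integral_const_mul]
    refine intervalIntegral.integral_congr fun t _ => ?_
    simp only [Finset.mul_sum]
    refine Finset.sum_congr rfl fun l _ => Finset.sum_congr rfl fun j _ => ?_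
    simp only [PiLp.sub_apply]
    ring
  have h2 : ∀ f : ℝ × ℝ → ℝ, Continuous f → ∫ s in (0 : ℝ)..1, ∫ t in (0 : ℝ)..1, f (s, t) =
      ∫ t : unitInterval × unitInterval, f (t.1, t.2) := by
    intro f hf
    have hint : Integrable (fun t : unitInterval × unitInterval => f (t.1, t.2))
        (volume.prod volume) := integrable_of_continuous_compact (by fun_prop)
    rw [Measure.volume_eq_prod, integral_prod _ hint, ← integral_unitInterval]
    refine integral_congr_ae (Eventually.of_forall fun s => ?_)
    simp only
    rw [← integral_unitInterval]
  have h3 := h2 (fun t => ∑ l, ∑ j, ((y - x) l * (z - x) j) * ((1 - t.1) *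
        B l j (x + t.1 • (y - x) + ((1 - t.1) * t.2) • (z - x)))) (by
    exact continuous_finsetSum _ fun l _ => continuous_finsetSum _ fun j _ =>
      continuous_const.mul (hc l j))
  have hint : ∀ l j, Integrable (fun t : unitInterval × unitInterval => (1 - (t.1 : ℝ)) *
        B l j (x + (t.1 : ℝ) • (y - x) + ((1 - (t.1 : ℝ)) * t.2) • (z - x))) := fun l j =>
    integrable_of_continuous_compact ((hc l j).comp (f := fun t : unitInterval × unitInterval =>
      ((t.1 : ℝ), (t.2 : ℝ))) (by fun_prop))
  rw [h1, h3]
  rw [integral_finsetSum _ fun l _ => integrable_finsetSum _ fun j _ => (hint l j).const_mul _]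
  rw [Complex.ofReal_sum]
  refine Finset.sum_congr rfl fun l _ => ?_
  rw [integral_finsetSum _ fun j _ => (hint l j).const_mul _, Complex.ofReal_sum]
  refine Finset.sum_congr rfl fun j _ => ?_
  rw [integral_const_mul, Complex.ofReal_mul, Complex.ofReal_mul, ← integral_complex_ofReal]
  simp only [Complex.ofReal_mul]

/-- The flux through triangles whose corners depend linearly on `p`. -/
lemma isAmp_flux {B : Fin d → Fin d → Conf d → ℝ} (hB : ∀ l j, IsBCInfty (B l j))
    {D : Type*} [NormedAddCommGroup D] [NormedSpace ℝ D] [FiniteDimensional ℝ D]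
    (L₀ L₁ L₂ : D →L[ℝ] Conf d) {g : D → ℝ} (hg : ∀ p, 1 ≤ g p)
    (h₁ : ∃ C, ∀ p, ‖L₁ p‖ ≤ C * g p) (h₂ : ∃ C, ∀ p, ‖L₂ p‖ ≤ C * g p) :
    IsAmp (ContinuousLinearMap.id ℝ D) (fun _ (_ : Unit) p => g p ^ 2)
      fun _ p => ((flux B (L₀ p) (L₀ p + L₁ p) (L₀ p + L₂ p) : ℝ) : ℂ) := by
  have hg0 : ∀ p, 0 ≤ g p := fun p => zero_le_one.trans (hg p)
  have hcoord : ∀ (L : D →L[ℝ] Conf d), (∃ C, ∀ p, ‖L p‖ ≤ C * g p) → ∀ l,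
      IsAmp (ContinuousLinearMap.id ℝ D) (fun _ (_ : Unit) => g)
        fun _ p => ((L p l : ℝ) : ℂ) := by
    intro L hL l
    obtain ⟨C, hC⟩ := hL
    refine isAmp_clm (hz := ContinuousLinearMap.id ℝ D)
      (Complex.ofRealCLM.comp ((EuclideanSpace.proj l : Conf d →L[ℝ] ℝ).comp L)) hg
      ⟨C, fun p => le_trans ?_ (hC p)⟩
    simpa using PiLp.norm_apply_le (L p) l
  set A : unitInterval × unitInterval → D →L[ℝ] Conf d := fun t =>
    L₀ + (t.1 : ℝ) • L₁ + ((1 - (t.1 : ℝ)) * t.2) • L₂ with hA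
  have hAc : Continuous A := by rw [hA]; fun_prop
  have hF : ∀ l j, IsAmp (ContinuousLinearMap.id ℝ D) (fun _ (_ : Unit) p => 1)
      fun _ p => ∫ t : unitInterval × unitInterval, ((1 - (t.1 : ℝ) : ℝ) : ℂ) *
        ((B l j (A t p) : ℝ) : ℂ) := by
    intro l j
    have hb : IsAmp (ContinuousLinearMap.id ℝ (Conf d)) (fun k (_ : Unit) p => (1 + ‖p‖) ^ 0)
        fun _ p => ((B l j p : ℝ) : ℂ) := by
      refine isAmpN_of_iteratedFDeriv (fun _ => Complex.ofRealCLM.contDiff.comp (hB l j).1)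
        (fun _ _ _ => by positivity) fun k => ?_
      obtain ⟨C, hC⟩ := (hB l j).2 k
      refine ⟨‖Complex.ofRealCLM‖ * C, fun _ p => ?_⟩
      refine (Complex.ofRealCLM.norm_iteratedFDeriv_comp_left (f := B l j) (N := ∞)
        (hB l j).1.contDiffAt (by exact_mod_cast le_top)).trans ?_
      rw [pow_zero, mul_one]
      exact mul_le_mul_of_nonneg_left (hC p) (norm_nonneg _)
    have := isAmp_parametric (ν := volume) hAc (c := fun t => ((1 - (t.1 : ℝ) : ℝ) : ℂ))
      (by fun_prop) (N := fun _ => 0) hb monotone_const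
    simpa using this
  have hmain : IsAmp (ContinuousLinearMap.id ℝ D) (fun _ (_ : Unit) p => g p ^ 2)
      fun _ p => ∑ l, ∑ j, ((L₁ p l : ℝ) : ℂ) * ((L₂ p j : ℝ) : ℂ) *
        ∫ t : unitInterval × unitInterval, ((1 - (t.1 : ℝ) : ℝ) : ℂ) *
        ((B l j (A t p) : ℝ) : ℂ) := by
    refine IsAmp.sum (fun l _ => IsAmp.sum (fun j _ => ?_) fun _ _ p => by positivity)
      fun _ _ p => by positivity
    have h12 := (hcoord L₁ h₁ l).mul (W₃ := fun _ _ p => g p ^ 2) (hcoord L₂ h₂ j)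
      (fun _ _ p => hg0 p) (fun _ _ p => hg0 p) fun _ _ => ⟨1, fun _ p => by rw [one_mul, sq]⟩
    exact h12.mul (hF l j) (fun _ _ p => by positivity) (fun _ _ p => zero_le_one)
      fun _ _ => ⟨1, fun _ p => by simp⟩
  convert hmain using 3 with i p
  rw [flux_eq fun l j => (hB l j).1.continuous]
  simp [hA]

lemma circulation_eq {A : Fin d → Conf d → ℝ} (hA : ∀ l, Continuous (A l)) (x y : Conf d) :
    ((circulation A x y : ℝ) : ℂ) = ∑ l, (((y - x) l : ℝ) : ℂ) *
      ∫ t : unitInterval, (1 : ℂ) * ((A l (x + (t : ℝ) • (y - x)) : ℝ) : ℂ) := by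
  have hc : ∀ l, Continuous fun t : unitInterval => A l (x + (t : ℝ) • (y - x)) := fun l => by
    have := hA l
    fun_prop
  unfold circulation
  rw [← integral_unitInterval (fun s => ∑ l, (y l - x l) * A l (x + s • (y - x)))]
  rw [integral_finsetSum _ fun l _ => (integrable_of_continuous_compact (hc l)).const_mul _,
    Complex.ofReal_sum]
  refine Finset.sum_congr rfl fun l _ => ?_
  rw [integral_const_mul, Complex.ofReal_mul, ← integral_complex_ofReal]
  simp

/-- Circulations along segments whose end points depend linearly on `p`. -/
lemma isAmp_circulation {A : Fin d → Conf d → ℝ} (hA : ∀ l, (A l).HasTemperateGrowth)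
    {D : Type*} [NormedAddCommGroup D] [NormedSpace ℝ D] [FiniteDimensional ℝ D]
    (L₀ L₁ : D →L[ℝ] Conf d) : ∃ N : ℕ → ℕ, Monotone N ∧
    IsAmp (ContinuousLinearMap.id ℝ D) (fun k (_ : Unit) p => (1 + ‖p‖) ^ N k)
      fun _ p => ((circulation A (L₀ p) (L₀ p + L₁ p) : ℝ) : ℂ) := by
  have hgrow : ∀ l k, ∃ (N : ℕ) (C : ℝ), ∀ p, ‖iteratedFDeriv ℝ k (A l) p‖ ≤ C * (1 + ‖p‖) ^ N :=
    fun l k => (hA l).2 k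
  choose N C hN using hgrow
  -- A single exponent for all components, made monotone in the order by summation.
  set N' : ℕ → ℕ := fun k => ∑ i ∈ Finset.range (k + 1), ∑ l, N l i with hN'
  have hN'm : Monotone N' := fun k m hkm =>
    Finset.sum_le_sum_of_subset (Finset.range_mono (by omega))
  have hb : ∀ l, IsAmp (ContinuousLinearMap.id ℝ (Conf d))
      (fun k (_ : Unit) p => (1 + ‖p‖) ^ N' k) fun _ p => ((A l p : ℝ) : ℂ) := by
    intro l
    refine isAmpN_of_iteratedFDeriv (fun _ => Complex.ofRealCLM.contDiff.comp (hA l).1)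
      (fun _ _ _ => by positivity) fun k => ⟨‖Complex.ofRealCLM‖ * |C l k|, fun _ p => ?_⟩
    refine (Complex.ofRealCLM.norm_iteratedFDeriv_comp_left (f := A l) (N := ∞)
      (hA l).1.contDiffAt (by exact_mod_cast le_top)).trans ?_
    rw [mul_assoc]
    refine mul_le_mul_of_nonneg_left ((hN l k p).trans ?_) (norm_nonneg _)
    refine mul_le_mul (le_abs_self _) (pow_le_pow_right₀ (one_le_one_add_norm p) ?_)
      (by positivity) (abs_nonneg _)
    calc N l k ≤ ∑ l, N l k := Finset.single_le_sum (f := fun l => N l k) (fun _ _ => Nat.zero_le _)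
          (Finset.mem_univ l)
      _ ≤ N' k := Finset.single_le_sum (f := fun i => ∑ l, N l i) (fun _ _ => Nat.zero_le _)
          (by simp)
  set At : unitInterval → D →L[ℝ] Conf d := fun t => L₀ + (t : ℝ) • L₁ with hAt
  have hAc : Continuous At := by rw [hAt]; fun_prop
  refine ⟨fun k => N' k + 1, fun k l hkl => Nat.add_le_add_right (hN'm hkl) 1, ?_⟩
  have hmain : IsAmp (ContinuousLinearMap.id ℝ D) (fun k (_ : Unit) p => (1 + ‖p‖) ^ (N' k + 1))
      fun _ p => ∑ l, ((L₁ p l : ℝ) : ℂ) *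
        ∫ t : unitInterval, (1 : ℂ) * ((A l (At t p) : ℝ) : ℂ) := by
    refine IsAmp.sum (fun l _ => ?_) fun _ _ p => by positivity
    have h1 : IsAmp (ContinuousLinearMap.id ℝ D) (fun _ (_ : Unit) p => 1 + ‖p‖)
        fun _ p => ((L₁ p l : ℝ) : ℂ) :=
      isAmp_clm (hz := ContinuousLinearMap.id ℝ D)
        (Complex.ofRealCLM.comp ((EuclideanSpace.proj l : Conf d →L[ℝ] ℝ).comp L₁))
        one_le_one_add_norm ⟨‖L₁‖, fun p => by
          have h2 := PiLp.norm_apply_le (L₁ p) l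
          have h3 := L₁.le_opNorm p
          have h4 := norm_nonneg L₁
          simp only [ContinuousLinearMap.comp_apply, Complex.ofRealCLM_apply, Complex.norm_real]
          refine (h2.trans h3).trans ?_
          nlinarith⟩
    refine h1.mul (isAmp_parametric (ν := volume) hAc (c := fun _ => 1) continuous_const (hb l)
      hN'm) (fun _ _ p => by positivity) (fun _ _ p => by positivity) fun j k => ⟨1, fun _ p => ?_⟩
    rw [one_mul, pow_succ']
    refine mul_le_mul_of_nonneg_left (pow_le_pow_right₀ (one_le_one_add_norm p)
      (hN'm (by omega))) (by positivity)
  convert hmain using 3 with i p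
  rw [circulation_eq fun l => (hA l).1.continuous]
  simp [hAt]

end Fluxes

/-! ### Stokes' theorem on a triangle. -/

section Stokes

variable {d : ℕ}

lemma integral_triangle_swap {F : ℝ × ℝ → ℝ} (hF : Continuous F) :
    ∫ s in (0 : ℝ)..1, ∫ t in (0 : ℝ)..(1 - s), F (s, t) =
      ∫ t in (0 : ℝ)..1, ∫ s in (0 : ℝ)..(1 - t), F (s, t) := by
  have key : ∀ G : ℝ × ℝ → ℝ, ∫ s in (0 : ℝ)..1, ∫ t in (0 : ℝ)..(1 - s), G (s, t) =
      ∫ s in Set.Ioc (0 : ℝ) 1, ∫ t in Set.Ioc (0 : ℝ) 1,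
        Set.indicator {p : ℝ × ℝ | p.1 + p.2 ≤ 1} G (s, t) := by
    intro G
    rw [intervalIntegral.integral_of_le zero_le_one]
    refine setIntegral_congr_fun measurableSet_Ioc fun s hs => ?_
    rw [intervalIntegral.integral_of_le (by linarith [hs.2]),
      ← integral_indicator measurableSet_Ioc, ← integral_indicator measurableSet_Ioc]
    congr 1
    ext t
    by_cases h : t ∈ Set.Ioc 0 (1 - s)
    · have h2 : t ∈ Set.Ioc (0 : ℝ) 1 := ⟨h.1, by linarith [h.2, hs.1]⟩
      have h3 : (s, t) ∈ {p : ℝ × ℝ | p.1 + p.2 ≤ 1} := by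
        have := h.2
        simp only [Set.mem_ofPred_eq]; linarith
      rw [Set.indicator_of_mem h, Set.indicator_of_mem h2, Set.indicator_of_mem h3]
    · rw [Set.indicator_of_notMem h]
      by_cases h2 : t ∈ Set.Ioc (0 : ℝ) 1
      · have h3 : (s, t) ∉ {p : ℝ × ℝ | p.1 + p.2 ≤ 1} := fun h3 =>
          h ⟨h2.1, by simp only [Set.mem_ofPred_eq] at h3; linarith⟩
        rw [Set.indicator_of_mem h2, Set.indicator_of_notMem h3]
      · rw [Set.indicator_of_notMem h2]
  have h2 := key fun p => F (p.2, p.1)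
  simp only at h2
  rw [h2, key F]
  have hint : Integrable (Set.indicator {p : ℝ × ℝ | p.1 + p.2 ≤ 1} F)
      ((volume.restrict (Set.Ioc (0 : ℝ) 1)).prod (volume.restrict (Set.Ioc (0 : ℝ) 1))) := by
    refine Integrable.indicator ?_ (isClosed_le (by fun_prop) continuous_const).measurableSet
    rw [Measure.prod_restrict]
    have : IntegrableOn F (Set.Icc (0 : ℝ) 1 ×ˢ Set.Icc (0 : ℝ) 1) (volume.prod volume) :=
      hF.continuousOn.integrableOn_compact (isCompact_Icc.prod isCompact_Icc)
    exact this.mono_set (Set.prod_mono Set.Ioc_subset_Icc_self Set.Ioc_subset_Icc_self)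
  have hsw := integral_integral_swap
    (f := fun s t => Set.indicator {p : ℝ × ℝ | p.1 + p.2 ≤ 1} F (s, t)) hint
  refine hsw.trans ?_
  refine integral_congr_ae (Eventually.of_forall fun t => integral_congr_ae
    (Eventually.of_forall fun s => ?_))
  simp only [Set.indicator, Set.mem_ofPred_eq, add_comm]

/-- Stokes' theorem for a triangle. -/
lemma flux_eq_circulation {A : Fin d → Conf d → ℝ} {B : Fin d → Fin d → Conf d → ℝ}
    (hA : IsVectorPotential A B) (x y z : Conf d) :
    flux B x y z = circulation A x y + circulation A y z - circulation A x z := by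
  have hAs : ∀ l, ContDiff ℝ ∞ (A l) := fun l => (hA.1 l).1
  have hAc : ∀ l, Continuous (A l) := fun l => (hAs l).continuous
  set Y := y - x with hY
  set Z := z - x with hZ
  set pt : ℝ × ℝ → Conf d := fun p => x + p.1 • Y + p.2 • Z with hpt
  have hptc : Continuous pt := by rw [hpt]; fun_prop
  set a : Conf d → ℝ × ℝ → ℝ := fun V p => ∑ l, V l * A l (pt p) with ha
  set a' : Conf d → Conf d → ℝ × ℝ → ℝ := fun V e p =>
    ∑ l, V l * fderiv ℝ (A l) (pt p) e with ha'
  have hac : ∀ V, Continuous (a V) := fun V =>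
    continuous_finsetSum _ fun l _ => continuous_const.mul ((hAc l).comp hptc)
  have ha'c : ∀ V e, Continuous (a' V e) := fun V e =>
    continuous_finsetSum _ fun l _ => continuous_const.mul
      (((hAs l).continuous_fderiv (by simp)).comp hptc |>.clm_apply continuous_const)
  have hds : ∀ V s t, HasDerivAt (fun s => a V (s, t)) (a' V Y (s, t)) s := by
    intro V s t
    have h1 : HasDerivAt (fun s : ℝ => pt (s, t)) Y s := by
      exact ((((hasDerivAt_id s).smul_const Y).const_add x).add_const (t • Z)).congr_deriv
        (one_smul _ _)
    exact HasDerivAt.fun_sum fun l _ => (((hAs l).differentiable (by simp)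
      (pt (s, t))).hasFDerivAt.comp_hasDerivAt s h1).const_mul (V l)
  have hdt : ∀ V s t, HasDerivAt (fun t => a V (s, t)) (a' V Z (s, t)) t := by
    intro V s t
    have h1 : HasDerivAt (fun t : ℝ => pt (s, t)) Z t := by
      exact (((hasDerivAt_id t).smul_const Z).const_add (x + s • Y)).congr_deriv
        (one_smul _ _)
    exact HasDerivAt.fun_sum fun l _ => (((hAs l).differentiable (by simp)
      (pt (s, t))).hasFDerivAt.comp_hasDerivAt t h1).const_mul (V l)
  have hexp : ∀ V : Conf d, V = ∑ l, V l • stdVec l := by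
    intro V
    ext j
    simp [stdVec, Pi.single_apply]
  -- The form $dA$ on the edge vectors equals $\partial_Y(A\cdot Z)-\partial_Z(A\cdot Y)$, so each
  -- term can be integrated in its own variable by the fundamental theorem; one of them first needs
  -- the order of integration reversed.
  have hBint : ∀ s t, (∑ l, ∑ j, B l j (x + s • (y - x) + t • (z - x)) * (y l - x l) *
      (z j - x j)) = a' Z Y (s, t) - a' Y Z (s, t) := by
    intro s t
    have e1 : a' Z Y (s, t) = ∑ l, ∑ j, fderiv ℝ (A j) (pt (s, t)) (stdVec l) * Y l * Z j := by
      simp only [ha']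
      rw [Finset.sum_comm]
      refine Finset.sum_congr rfl fun j _ => ?_
      conv_lhs => rw [hexp Y, map_sum, Finset.mul_sum]
      refine Finset.sum_congr rfl fun l _ => ?_
      rw [map_smul, smul_eq_mul]; ring
    have e2 : a' Y Z (s, t) = ∑ l, ∑ j, fderiv ℝ (A l) (pt (s, t)) (stdVec j) * Y l * Z j := by
      simp only [ha']
      refine Finset.sum_congr rfl fun l _ => ?_
      conv_lhs => rw [hexp Z, map_sum, Finset.mul_sum]
      refine Finset.sum_congr rfl fun j _ => ?_
      rw [map_smul, smul_eq_mul]; ring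
    rw [e1, e2, ← Finset.sum_sub_distrib]
    refine Finset.sum_congr rfl fun l _ => ?_
    rw [← Finset.sum_sub_distrib]
    refine Finset.sum_congr rfl fun j _ => ?_
    rw [hA.2 l j]
    simp only [hpt, hY, hZ, PiLp.sub_apply]
    ring
  have hii : ∀ {f : ℝ → ℝ} {u v : ℝ}, Continuous f → IntervalIntegrable f volume u v :=
    fun hf => hf.intervalIntegrable _ _
  have hcs : ∀ (F : ℝ × ℝ → ℝ), Continuous F →
      Continuous fun s => ∫ t in (0 : ℝ)..(1 - s), F (s, t) := fun F hF =>
    intervalIntegral.continuous_parametric_intervalIntegral_of_continuous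
      (f := fun s t => F (s, t)) (s := fun s => 1 - s) hF (by fun_prop)
  have h1 : flux B x y z = (∫ s in (0 : ℝ)..1, ∫ t in (0 : ℝ)..(1 - s), a' Z Y (s, t)) -
      ∫ s in (0 : ℝ)..1, ∫ t in (0 : ℝ)..(1 - s), a' Y Z (s, t) := by
    rw [← intervalIntegral.integral_sub (hii (hcs _ (ha'c Z Y))) (hii (hcs _ (ha'c Y Z)))]
    unfold flux
    refine intervalIntegral.integral_congr fun s _ => ?_
    simp only
    rw [← intervalIntegral.integral_sub (f := fun t => a' Z Y (s, t))
      (g := fun t => a' Y Z (s, t)) (hii ((ha'c Z Y).comp (Continuous.prodMk_right s)))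
      (hii ((ha'c Y Z).comp (Continuous.prodMk_right s)))]
    exact intervalIntegral.integral_congr fun t _ => hBint s t
  have h2 : ∫ s in (0 : ℝ)..1, ∫ t in (0 : ℝ)..(1 - s), a' Y Z (s, t) =
      (∫ s in (0 : ℝ)..1, a Y (s, 1 - s)) - ∫ s in (0 : ℝ)..1, a Y (s, 0) := by
    have hc := hac Y
    rw [← intervalIntegral.integral_sub (hii (by fun_prop)) (hii (by fun_prop))]
    refine intervalIntegral.integral_congr fun s _ => ?_
    exact intervalIntegral.integral_eq_sub_of_hasDerivAt (fun t _ => hdt Y s t)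
      (hii ((ha'c Y Z).comp (Continuous.prodMk_right s)))
  have h3 : ∫ s in (0 : ℝ)..1, ∫ t in (0 : ℝ)..(1 - s), a' Z Y (s, t) =
      (∫ t in (0 : ℝ)..1, a Z (1 - t, t)) - ∫ t in (0 : ℝ)..1, a Z (0, t) := by
    have hc := hac Z
    rw [integral_triangle_swap (ha'c Z Y)]
    rw [← intervalIntegral.integral_sub (hii (by fun_prop)) (hii (by fun_prop))]
    refine intervalIntegral.integral_congr fun t _ => ?_
    have hc' := ha'c Z Y
    exact intervalIntegral.integral_eq_sub_of_hasDerivAt (fun s _ => hds Z s t)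
      (hii (by fun_prop))
  have h4 : ∫ s in (0 : ℝ)..1, a Y (s, 1 - s) = ∫ t in (0 : ℝ)..1, a Y (1 - t, t) := by
    have := intervalIntegral.integral_comp_sub_left (a := 0) (b := 1)
      (fun s => a Y (s, 1 - s)) 1
    simpa using this.symm
  have c1 : circulation A x y = ∫ s in (0 : ℝ)..1, a Y (s, 0) := by
    simp [circulation, ha, hpt, hY]
  have c2 : circulation A x z = ∫ t in (0 : ℝ)..1, a Z (0, t) := by
    simp [circulation, ha, hpt, hZ]
  have c3 : circulation A y z =
      (∫ t in (0 : ℝ)..1, a Z (1 - t, t)) - ∫ t in (0 : ℝ)..1, a Y (1 - t, t) := by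
    have hc := hac Z
    have hc' := hac Y
    rw [← intervalIntegral.integral_sub (hii (by fun_prop)) (hii (by fun_prop))]
    unfold circulation
    refine intervalIntegral.integral_congr fun t _ => ?_
    simp only [ha]
    rw [← Finset.sum_sub_distrib]
    refine Finset.sum_congr rfl fun l _ => ?_
    have : y + t • (z - y) = pt (1 - t, t) := by
      simp only [hpt, hY, hZ]
      module
    rw [this]
    simp only [hY, hZ, PiLp.sub_apply]
    ring
  rw [h1, h2, h3, h4, c1, c2, c3]
  ring

end Stokes

/-! ### Quadratic forms and coordinate bounds on configuration space. -/

section BilinearPhases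

variable {Q : Type*} [NormedAddCommGroup Q] [NormedSpace ℝ Q]

lemma hasFDerivAt_quadratic (b : Q →L[ℝ] Q →L[ℝ] ℝ) (q : Q) :
    HasFDerivAt (fun q => b q q) ((b + b.flip) q) q := by
  have h := b.hasFDerivAt_of_bilinear (hasFDerivAt_id q) (hasFDerivAt_id q)
  refine h.congr_fderiv ?_
  ext v
  simp

variable {d : ℕ}

lemma inner_stdVec (x : Conf d) (l : Fin d) : inner ℝ x (stdVec l) = x l := by
  simp [stdVec, EuclideanSpace.inner_single_right]

lemma inner_stdVec_left (x : Conf d) (l : Fin d) : inner ℝ (stdVec l) x = x l := by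
  simp [stdVec, EuclideanSpace.inner_single_left]

lemma sum_smul_stdVec (x : Conf d) : ∑ l, x l • stdVec l = x := by
  ext j
  simp [stdVec, Pi.single_apply]

lemma norm_stdVec (l : Fin d) : ‖(stdVec l : Conf d)‖ = 1 := by simp [stdVec]

lemma one_add_norm_le_prod {c : ℝ} (hc : 0 < c) :
    ∃ C, 0 ≤ C ∧ ∀ x : Conf d, 1 + ‖x‖ ≤ C * ∏ l, (1 + c * |x l|) := by
  refine ⟨(max 1 c⁻¹) ^ d, by positivity, fun x => ?_⟩
  have h1 : ‖x‖ ≤ ∑ l, |x l| := by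
    conv_lhs => rw [← sum_smul_stdVec x]
    refine (norm_sum_le _ _).trans (Finset.sum_le_sum fun l _ => ?_)
    rw [norm_smul, norm_stdVec, mul_one, Real.norm_eq_abs]
  have h2 : ∀ s : Finset (Fin d), 1 + ∑ l ∈ s, |x l| ≤ ∏ l ∈ s, (1 + |x l|) := by
    intro s
    induction s using Finset.cons_induction with
    | empty => simp
    | cons a s ha ih =>
      rw [Finset.sum_cons, Finset.prod_cons]
      have h0 : 0 ≤ ∑ l ∈ s, |x l| := Finset.sum_nonneg fun l _ => abs_nonneg _
      nlinarith [abs_nonneg (x a), mul_le_mul_of_nonneg_left ih (abs_nonneg (x a)),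
        mul_nonneg (abs_nonneg (x a)) h0]
  calc 1 + ‖x‖ ≤ ∏ l, (1 + |x l|) := (add_le_add_right h1 1).trans (h2 _)
    _ ≤ ∏ l, (max 1 c⁻¹ * (1 + c * |x l|)) := by
        refine Finset.prod_le_prod (fun l _ => by positivity) fun l _ => ?_
        have e1 : (1 : ℝ) ≤ max 1 c⁻¹ := le_max_left _ _
        have e2 : |x l| ≤ max 1 c⁻¹ * (c * |x l|) := by
          calc |x l| = c⁻¹ * (c * |x l|) := by field_simp
            _ ≤ _ := by gcongr; exact le_max_right _ _
        linarith
    _ = _ := by rw [Finset.prod_mul_distrib]; simp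

lemma one_add_norm_prod_le {E F : Type*} [NormedAddCommGroup E] [NormedAddCommGroup F]
    (p : E × F) : 1 + ‖p‖ ≤ (1 + ‖p.1‖) * (1 + ‖p.2‖) := by
  rw [Prod.norm_def]
  have h1 := norm_nonneg p.1
  have h2 := norm_nonneg p.2
  have h3 := mul_nonneg h1 h2
  rcases max_choice ‖p.1‖ ‖p.2‖ with h | h <;> rw [h] <;> nlinarith

end BilinearPhases

/-! ### The phase of the product formula. -/

section SymplecticForm

variable {d : ℕ}

/-- The symplectic form as a continuous bilinear map. -/
def sympL (d : ℕ) : Phase d →L[ℝ] Phase d →L[ℝ] ℝ :=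
  (innerSL ℝ).bilinearComp (ContinuousLinearMap.snd ℝ (Conf d) (Conf d))
      (ContinuousLinearMap.fst ℝ (Conf d) (Conf d)) -
    (innerSL ℝ).bilinearComp (ContinuousLinearMap.fst ℝ (Conf d) (Conf d))
      (ContinuousLinearMap.snd ℝ (Conf d) (Conf d))

@[simp] lemma sympL_apply (X Y : Phase d) : sympL d X Y = symp X Y := by
  simp [sympL, symp]

/-- The phase `-(2/ε) σ(Y, Z)` of the product formula. -/
def productPhase (d : ℕ) {ε : ℝ} (hε : 0 < ε) :
    OscPhase (Phase d × Phase d) (Conf d × Conf d) (Conf d × Conf d) where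
  Φ q := -(2 / ε * symp q.1 q.2)
  L := (-(2 / ε)) • ((sympL d).bilinearComp (ContinuousLinearMap.fst ℝ (Phase d) (Phase d))
      (ContinuousLinearMap.snd ℝ (Phase d) (Phase d)) +
    ((sympL d).bilinearComp (ContinuousLinearMap.fst ℝ (Phase d) (Phase d))
      (ContinuousLinearMap.snd ℝ (Phase d) (Phase d))).flip)
  hasFDerivAt q := by
    have h := (hasFDerivAt_quadratic ((sympL d).bilinearComp
      (ContinuousLinearMap.fst ℝ (Phase d) (Phase d))
      (ContinuousLinearMap.snd ℝ (Phase d) (Phase d))) q).const_smul (-(2 / ε))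
    refine (h.congr_of_eventuallyEq (Eventually.of_forall fun q => ?_))
    simp
  -- Positions are horizontal and momenta vertical, because the flux factor depends on positions
  -- only.
  πu := (ContinuousLinearMap.fst ℝ (Conf d) (Conf d)).prodMap
    (ContinuousLinearMap.fst ℝ (Conf d) (Conf d))
  πv := (ContinuousLinearMap.snd ℝ (Conf d) (Conf d)).prodMap
    (ContinuousLinearMap.snd ℝ (Conf d) (Conf d))
  -- The symplectic form pairs positions with momenta: differentiating the phase in a position
  -- direction produces a momentum coordinate, and conversely for `dB`.
  dA := List.ofFn (fun l => (((stdVec l, 0), 0) : Phase d × Phase d)) ++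
    List.ofFn (fun l => ((0, (stdVec l, 0)) : Phase d × Phase d))
  dB := List.ofFn (fun l => (((0, stdVec l), 0) : Phase d × Phase d)) ++
    List.ofFn (fun l => ((0, (0, stdVec l)) : Phase d × Phase d))
  isotropic q hq := by
    simp only [List.mem_append, List.mem_ofFn] at hq
    rcases hq with (⟨l, rfl⟩ | ⟨l, rfl⟩) | (⟨l, rfl⟩ | ⟨l, rfl⟩) <;> simp [symp]
  vertical q hq := by
    simp only [List.mem_append, List.mem_ofFn] at hq
    rcases hq with ⟨l, rfl⟩ | ⟨l, rfl⟩ <;> simp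
  boundA := by
    obtain ⟨C, hC, h⟩ := one_add_norm_le_prod (d := d) (c := 2 / ε) (by positivity)
    refine ⟨C * C, fun q => ?_⟩
    refine (one_add_norm_prod_le _).trans ?_
    refine (mul_le_mul (h _) (h _) (by positivity)
      (mul_nonneg hC (Finset.prod_nonneg fun _ _ => by positivity))).trans (le_of_eq ?_)
    simp [List.map_ofFn, List.prod_ofFn, symp, Function.comp_def, inner_stdVec,
      inner_stdVec_left, abs_mul, abs_div, abs_of_pos hε]
    ring
  boundB := by
    obtain ⟨C, hC, h⟩ := one_add_norm_le_prod (d := d) (c := 2 / ε) (by positivity)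
    refine ⟨C * C, fun q => ?_⟩
    refine (one_add_norm_prod_le _).trans ?_
    refine (mul_le_mul (h _) (h _) (by positivity)
      (mul_nonneg hC (Finset.prod_nonneg fun _ _ => by positivity))).trans (le_of_eq ?_)
    simp [List.map_ofFn, List.prod_ofFn, symp, Function.comp_def, inner_stdVec,
      inner_stdVec_left, abs_mul, abs_div, abs_of_pos hε]
    ring
  boundQ := by
    refine ⟨1, fun q => ?_⟩
    rw [one_mul]
    refine le_trans ?_ (one_add_norm_prod_le (((q.1.1, q.2.1), (q.1.2, q.2.2)) :
      (Conf d × Conf d) × (Conf d × Conf d)))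
    simp only [Prod.norm_def]
    rw [max_max_max_comm]

end SymplecticForm

/-! ### Weights which are moderate under translation. -/

section ModerateWeights

variable {E : Type*} [NormedAddCommGroup E] [NormedSpace ℝ E] {ι : Type*}

/-- A family of weights of polynomial growth, uniformly with respect to translations. -/
structure IsModerate (m : ℕ) (w : ι → E → ℝ) : Prop where
  nonneg : ∀ i X, 0 ≤ w i X
  le_mul : ∃ C, 0 ≤ C ∧ ∀ i X Y, w i (X + Y) ≤ C * (w i X * (1 + ‖Y‖) ^ m)

lemma IsModerate.locBdd {m : ℕ} {w : ι → E → ℝ} (hw : IsModerate m w) (i : ι) (x : E) :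
    ∃ C, ∀ᶠ y in 𝓝 x, w i y ≤ C := by
  obtain ⟨C, hC, h⟩ := hw.le_mul
  refine ⟨C * (w i x * (1 + 1) ^ m), ?_⟩
  filter_upwards [Metric.ball_mem_nhds x one_pos] with y hy
  have h1 := h i x (y - x)
  rw [add_sub_cancel] at h1
  refine h1.trans ?_
  have h2 : ‖y - x‖ ≤ 1 := by rw [← dist_eq_norm]; exact (Metric.mem_ball.1 hy).le
  have := hw.nonneg i x
  gcongr

lemma IsModerate.mul {m₁ m₂ : ℕ} {w₁ w₂ : ι → E → ℝ} (h₁ : IsModerate m₁ w₁)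
    (h₂ : IsModerate m₂ w₂) : IsModerate (m₁ + m₂) fun i X => w₁ i X * w₂ i X := by
  obtain ⟨C₁, hC₁, h₁'⟩ := h₁.le_mul
  obtain ⟨C₂, hC₂, h₂'⟩ := h₂.le_mul
  refine ⟨fun i X => mul_nonneg (h₁.nonneg i X) (h₂.nonneg i X), C₁ * C₂, by positivity,
    fun i X Y => ?_⟩
  have n1 := h₁.nonneg i X
  have n2 := h₂.nonneg i X
  refine (mul_le_mul (h₁' i X Y) (h₂' i X Y) (h₂.nonneg _ _) (by positivity)).trans (le_of_eq ?_)
  ring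

lemma IsModerate.const_mul {m : ℕ} {w : ι → E → ℝ} (hw : IsModerate m w) {c : ι → ℝ}
    (hc : ∀ i, 0 ≤ c i) : IsModerate m fun i X => c i * w i X := by
  obtain ⟨C, hC, h⟩ := hw.le_mul
  refine ⟨fun i X => mul_nonneg (hc i) (hw.nonneg i X), C, hC, fun i X Y => ?_⟩
  refine (mul_le_mul_of_nonneg_left (h i X Y) (hc i)).trans (le_of_eq ?_)
  ring

lemma IsModerate.reindex {ι' : Type*} {m : ℕ} {w : ι → E → ℝ} (hw : IsModerate m w)
    (φ : ι' → ι) : IsModerate m fun i => w (φ i) := by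
  obtain ⟨C, hC, h⟩ := hw.le_mul
  exact ⟨fun i X => hw.nonneg _ X, C, hC, fun i X Y => h _ X Y⟩

lemma one_add_norm_add_le (X Y : E) : 1 + ‖X + Y‖ ≤ (1 + ‖X‖) * (1 + ‖Y‖) := by
  nlinarith [norm_add_le X Y, norm_nonneg X, norm_nonneg Y, mul_nonneg (norm_nonneg X)
    (norm_nonneg Y)]

lemma isModerate_pow (m : ℕ) : IsModerate m fun (_ : ι) (X : E) => (1 + ‖X‖) ^ m := by
  refine ⟨fun i X => by positivity, 1, zero_le_one, fun i X Y => ?_⟩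
  rw [one_mul, ← mul_pow]
  gcongr
  exact one_add_norm_add_le X Y

lemma isModerate_pow_inv (m : ℕ) :
    IsModerate m fun (_ : ι) (X : E) => ((1 + ‖X‖) ^ m)⁻¹ := by
  refine ⟨fun i X => by positivity, 1, zero_le_one, fun i X Y => ?_⟩
  rw [one_mul, inv_mul_eq_div, le_div_iff₀ (by positivity), inv_mul_le_iff₀ (by positivity),
    ← mul_pow]
  gcongr
  have := one_add_norm_add_le (X + Y) (-Y)
  rwa [add_neg_cancel_right, norm_neg] at this

end ModerateWeights

/-! ### The magnetic Weyl product as an oscillatory integral. -/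

section Product

instance (d : ℕ) : (volume : Measure (Phase d)).IsAddHaarMeasure :=
  Measure.prod.instIsAddHaarMeasure (volume : Measure (Conf d)) (volume : Measure (Conf d))

instance (d : ℕ) : (volume : Measure (Phase d × Phase d)).IsAddHaarMeasure :=
  Measure.prod.instIsAddHaarMeasure (volume : Measure (Phase d)) (volume : Measure (Phase d))

variable {d : ℕ} {ι : Type*} {ε lam : ℝ} {B : Fin d → Fin d → Conf d → ℝ}

/-- Since `B` and its derivatives are bounded, the flux and its derivatives are controlled by the
square of the edge lengths, uniformly in the base point `L₀ p`. Each derivative of the exponential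
therefore costs two powers of `g`. -/
lemma isAmp_fluxExp (hB : ∀ l j, IsBCInfty (B l j)) (ε lam : ℝ)
    {D : Type*} [NormedAddCommGroup D] [NormedSpace ℝ D] [FiniteDimensional ℝ D]
    (L₀ L₁ L₂ : D →L[ℝ] Conf d) {g : D → ℝ} (hg : ∀ p, 1 ≤ g p)
    (h₁ : ∃ C, ∀ p, ‖L₁ p‖ ≤ C * g p) (h₂ : ∃ C, ∀ p, ‖L₂ p‖ ≤ C * g p) :
    IsAmp (ContinuousLinearMap.id ℝ D) (fun k (_ : Unit) p => g p ^ (2 * k))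
      fun _ p => fluxExp ε lam B (L₀ p) (L₀ p + L₁ p) (L₀ p + L₂ p) := by
  have hg0 : ∀ p, 0 ≤ g p := fun p => zero_le_one.trans (hg p)
  have h := (isAmp_flux hB L₀ L₁ L₂ hg h₁ h₂).smul (-(lam / ε : ℝ) : ℂ)
    (fun k i p => pow_nonneg (hg0 p) 2)
  have h' : IsAmp (ContinuousLinearMap.id ℝ D) (fun _ (_ : Unit) p => g p ^ 2)
      fun _ p => ((-(lam / ε * flux B (L₀ p) (L₀ p + L₁ p) (L₀ p + L₂ p)) : ℝ) : ℂ) := by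
    convert h using 3 with i p
    push_cast; ring
  refine isAmp_cis h' (fun k i p => pow_nonneg (hg0 p) _) (fun k i p => pow_nonneg (hg0 p) _)
    (fun i p => by simp) fun j k => ⟨1, fun i p => ?_⟩
  rw [one_mul, ← pow_add]
  exact pow_le_pow_right₀ (hg p) (by omega)

/-- The amplitude of the product formula, centred at `X`. -/
def prodAmp (ε lam : ℝ) (B : Fin d → Fin d → Conf d → ℝ) (f g : Phase d → ℂ)
    (p : Phase d × (Phase d × Phase d)) : ℂ :=
  fluxExp ε lam B (p.1.1 + p.2.1.1 - p.2.2.1) (p.1.1 + p.2.1.1 + p.2.2.1)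
    (p.1.1 - p.2.1.1 + p.2.2.1) * (f (p.1 + p.2.1) * g (p.1 + p.2.2))

/-- With `u`, `v` the positions relative to the centre, the edges at the first corner are $2v$ and
$2v-2u$. The growth thus involves neither the centre nor the momenta. -/
lemma isAmp_prodFluxExp (hB : ∀ l j, IsBCInfty (B l j)) (hε : 0 < ε) (lam : ℝ) :
    IsAmp ((productPhase d hε).hz (Phase d))
      (fun k (_ : ι) p => (1 + ‖(productPhase d hε).πu p.2‖) ^ (2 * k))
      fun _ p => fluxExp ε lam B (p.1.1 + p.2.1.1 - p.2.2.1) (p.1.1 + p.2.1.1 + p.2.2.1)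
        (p.1.1 - p.2.1.1 + p.2.2.1) := by
  set c := ContinuousLinearMap.fst ℝ (Conf d) (Conf d × Conf d)
  set u := (ContinuousLinearMap.fst ℝ (Conf d) (Conf d)).comp
    (ContinuousLinearMap.snd ℝ (Conf d) (Conf d × Conf d))
  set v := (ContinuousLinearMap.snd ℝ (Conf d) (Conf d)).comp
    (ContinuousLinearMap.snd ℝ (Conf d) (Conf d × Conf d))
  have hb : ∀ T : Conf d × Conf d →L[ℝ] Conf d, ∃ C, ∀ p : Conf d × (Conf d × Conf d),
      ‖T p.2‖ ≤ C * (1 + ‖p.2‖) := fun T => ⟨‖T‖, fun p => (T.le_opNorm _).trans (by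
        have := norm_nonneg T
        nlinarith [norm_nonneg p.2])⟩
  have h := isAmp_fluxExp hB ε lam (c + u - v) ((2 : ℝ) • v) ((2 : ℝ) • v - (2 : ℝ) • u)
    (g := fun p => 1 + ‖p.2‖) (fun p => one_le_one_add_norm _)
    (hb ((2 : ℝ) • ContinuousLinearMap.snd ℝ (Conf d) (Conf d)))
    (hb ((2 : ℝ) • ContinuousLinearMap.snd ℝ (Conf d) (Conf d) -
      (2 : ℝ) • ContinuousLinearMap.fst ℝ (Conf d) (Conf d)))
  have h2 := h.comp_clm (hz' := (productPhase d hε).hz (Phase d))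
    (((ContinuousLinearMap.fst ℝ (Conf d) (Conf d)).comp (ContinuousLinearMap.fst ℝ _ _)).prod
      ((productPhase d hε).πu.comp (ContinuousLinearMap.snd ℝ (Phase d) (Phase d × Phase d))))
    (fun e he => by
      simp only [OscPhase.hz_apply, Prod.mk_eq_zero] at he
      simp [he.1, he.2])
    (fun k i p => by positivity)
    (fun i p => fun k l hkl => pow_le_pow_right₀ (one_le_one_add_norm _) (by omega))
  have h3 := h2.reindex (fun _ : ι => ())
  refine (congrArg (IsAmp ((productPhase d hε).hz (Phase d))
    fun k (_ : ι) p => (1 + ‖(productPhase d hε).πu p.2‖) ^ (2 * k)) (funext fun i => funext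
    fun p => ?_)).mpr h3
  simp only [c, u, v, productPhase]
  congr 1
  all_goals
    simp
    try module

lemma isAmp_translate {H : Type*} [NormedAddCommGroup H] [NormedSpace ℝ H]
    {hz : Phase d × (Phase d × Phase d) →L[ℝ] H} {w : ι → Phase d → ℝ} {m : ℕ}
    {f : ι → Phase d → ℂ} (hf : IsAmp (ContinuousLinearMap.id ℝ _) (fun _ => w) f)
    (hw : IsModerate m w) (T : Phase d × Phase d →L[ℝ] Phase d) (hT : ∀ q, ‖T q‖ ≤ ‖q‖) :
    IsAmp hz (fun _ i p => w i p.1 * (1 + ‖p.2‖) ^ m) fun i p => f i (p.1 + T p.2) := by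
  have h := hf.comp_clm_const (hz' := hz) (ContinuousLinearMap.fst ℝ _ _ +
    T.comp (ContinuousLinearMap.snd ℝ (Phase d) (Phase d × Phase d)))
  obtain ⟨C, hC, hC'⟩ := hw.le_mul
  refine h.mono (fun k i p => hw.nonneg _ _) fun k => ⟨C, fun i p => ?_⟩
  refine (hC' i p.1 (T p.2)).trans ?_
  have := hw.nonneg i p.1
  gcongr
  exact hT p.2

/-- The weights are taken at the centre; moderateness charges the translation to powers of the
integration variable, which `boundQ` splits between positions and momenta. The flux contributes the
`2 * k`. -/
lemma isAmp_prodAmp (hB : ∀ l j, IsBCInfty (B l j)) (hε : 0 < ε) (lam : ℝ)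
    {w₁ w₂ : ι → Phase d → ℝ} {m₁ m₂ : ℕ} {f g : ι → Phase d → ℂ}
    (hf : IsAmp (ContinuousLinearMap.id ℝ _) (fun _ => w₁) f) (hw₁ : IsModerate m₁ w₁)
    (hg : IsAmp (ContinuousLinearMap.id ℝ _) (fun _ => w₂) g) (hw₂ : IsModerate m₂ w₂) :
    IsAmp ((productPhase d hε).hz (Phase d))
      ((productPhase d hε).wt (fun _ i X => w₁ i X * w₂ i X) (fun k => 2 * k + (m₁ + m₂))
        (m₁ + m₂)) fun i => prodAmp ε lam B (f i) (g i) := by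
  obtain ⟨C, hC⟩ := (productPhase d hε).boundQ
  have hfg := (isAmp_translate (hz := (productPhase d hε).hz (Phase d)) hf hw₁
      (ContinuousLinearMap.fst ℝ _ _) (fun q => norm_fst_le q)).mul
    (isAmp_translate hg hw₂ (ContinuousLinearMap.snd ℝ _ _) (fun q => norm_snd_le q))
    (W₃ := fun _ i p => (w₁ i p.1 * w₂ i p.1) * (1 + ‖p.2‖) ^ (m₁ + m₂))
    (fun k i p => mul_nonneg (hw₁.nonneg _ _) (by positivity))
    (fun k i p => mul_nonneg (hw₂.nonneg _ _) (by positivity))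
    (fun j k => ⟨1, fun i p => le_of_eq (by ring)⟩)
  refine (isAmp_prodFluxExp hB hε lam).mul hfg (fun k i p => by positivity)
    (fun k i p => mul_nonneg (mul_nonneg (hw₁.nonneg _ _) (hw₂.nonneg _ _)) (by positivity))
    fun j k => ⟨C ^ (m₁ + m₂), fun i p => ?_⟩
  have h1 := hw₁.nonneg i p.1
  have h2 := hw₂.nonneg i p.1
  set u := ‖(productPhase d hε).πu p.2‖
  set v := ‖(productPhase d hε).πv p.2‖
  have hu : 0 ≤ u := norm_nonneg _
  have hv : 0 ≤ v := norm_nonneg _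
  calc (1 + u) ^ (2 * j) * (w₁ i p.1 * w₂ i p.1 * (1 + ‖p.2‖) ^ (m₁ + m₂))
      ≤ (1 + u) ^ (2 * j) * (w₁ i p.1 * w₂ i p.1 * (C * ((1 + u) * (1 + v))) ^ (m₁ + m₂)) := by
        gcongr
        exact hC p.2
    _ = C ^ (m₁ + m₂) * ((w₁ i p.1 * w₂ i p.1) * (1 + u) ^ (2 * j + (m₁ + m₂)) *
          (1 + v) ^ (m₁ + m₂)) := by
        rw [mul_pow, mul_pow, pow_add]; ring
    _ ≤ _ := by
        have hC0 : 0 ≤ C := by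
          have := hC 0
          simp at this
          linarith
        unfold OscPhase.wt
        gcongr
        · linarith
        · dsimp only; omega

/-- The magnetic Weyl product, as an oscillatory integral. -/
def weylProd (hε : 0 < ε) (lam : ℝ) (B : Fin d → Fin d → Conf d → ℝ) (f g : Phase d → ℂ)
    (X : Phase d) : ℂ :=
  ((((Real.pi * ε) ^ (2 * d) : ℝ) : ℂ))⁻¹ * (productPhase d hε).osc (prodAmp ε lam B f g) X

lemma IsModerate.isWeight {m : ℕ} {w : ι → Phase d → ℝ} (hw : IsModerate m w) :
    OscPhase.IsWeight fun (_ : ℕ) => w :=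
  ⟨fun _ => hw.nonneg, fun _ _ => monotone_const, fun _ => hw.locBdd⟩

lemma monotone_two_mul_add (m : ℕ) : Monotone fun k : ℕ => 2 * k + m := fun k l h => by
  dsimp only; omega

/-- The weights do not depend on the order of differentiation, so the shift by `loss` is invisible
and no order is lost. Uniformity in the index is what the regularization arguments use later. -/
lemma isAmp_weylProd (hB : ∀ l j, IsBCInfty (B l j)) (hε : 0 < ε) (lam : ℝ)
    {w₁ w₂ : ι → Phase d → ℝ} {m₁ m₂ : ℕ} {f g : ι → Phase d → ℂ}
    (hf : IsAmp (ContinuousLinearMap.id ℝ _) (fun _ => w₁) f) (hw₁ : IsModerate m₁ w₁)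
    (hg : IsAmp (ContinuousLinearMap.id ℝ _) (fun _ => w₂) g) (hw₂ : IsModerate m₂ w₂) :
    IsAmp (ContinuousLinearMap.id ℝ _) (fun _ i X => w₁ i X * w₂ i X)
      fun i => weylProd hε lam B (f i) (g i) :=
  ((productPhase d hε).isAmp_osc (isAmp_prodAmp hB hε lam hf hw₁ hg hw₂)
    (hw₁.mul hw₂).isWeight (monotone_two_mul_add _)).smul _
    (fun _ => (hw₁.mul hw₂).nonneg)

/-- The flux factor is constant when the centre moves in a momentum direction, so only the two
symbols are differentiated. -/
lemma dirDeriv_prodAmp (hB : ∀ l j, IsBCInfty (B l j)) (hε : 0 < ε) (lam : ℝ)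
    {f g : Phase d → ℂ} (hf : ContDiff ℝ ∞ f) (hg : ContDiff ℝ ∞ g) (e : Conf d) :
    dirDeriv (((0, e), 0) : Phase d × (Phase d × Phase d)) (prodAmp ε lam B f g) =
      fun p => prodAmp ε lam B (dirDeriv (0, e) f) g p +
        prodAmp ε lam B f (dirDeriv (0, e) g) p := by
  have hΩ := ((isAmp_prodFluxExp (ι := Unit) hB hε lam).smooth ())
  set A := ContinuousLinearMap.fst ℝ (Phase d) (Phase d × Phase d) +
    (ContinuousLinearMap.fst ℝ _ _).comp
      (ContinuousLinearMap.snd ℝ (Phase d) (Phase d × Phase d)) with hA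
  set A' := ContinuousLinearMap.fst ℝ (Phase d) (Phase d × Phase d) +
    (ContinuousLinearMap.snd ℝ _ _).comp
      (ContinuousLinearMap.snd ℝ (Phase d) (Phase d × Phase d)) with hA'
  have e1 : dirDeriv (((0, e), 0) : Phase d × (Phase d × Phase d))
      (fun p => f (p.1 + p.2.1)) = fun p => dirDeriv (0, e) f (p.1 + p.2.1) := by
    have := dirDeriv_comp_clm hf A (((0, e), 0) : Phase d × (Phase d × Phase d))
    simpa [hA] using this
  have e2 : dirDeriv (((0, e), 0) : Phase d × (Phase d × Phase d))
      (fun p => g (p.1 + p.2.2)) = fun p => dirDeriv (0, e) g (p.1 + p.2.2) := by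
    have := dirDeriv_comp_clm hg A' (((0, e), 0) : Phase d × (Phase d × Phase d))
    simpa [hA'] using this
  have e0 : dirDeriv (((0, e), 0) : Phase d × (Phase d × Phase d)) (fun p =>
      fluxExp ε lam B (p.1.1 + p.2.1.1 - p.2.2.1) (p.1.1 + p.2.1.1 + p.2.2.1)
        (p.1.1 - p.2.1.1 + p.2.2.1)) = fun _ => 0 := by
    funext p
    have hd := ((hΩ.differentiable (by simp) p).hasFDerivAt.comp_hasDerivAt_of_eq (0 : ℝ)
      (f := fun t : ℝ => p + t • (((0, e), 0) : Phase d × (Phase d × Phase d)))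
      (((hasDerivAt_id (0 : ℝ)).smul_const _).const_add p) (by simp))
    have hc := hasDerivAt_const (0 : ℝ) (fluxExp ε lam B (p.1.1 + p.2.1.1 - p.2.2.1)
      (p.1.1 + p.2.1.1 + p.2.2.1) (p.1.1 - p.2.1.1 + p.2.2.1))
    have hu := hd.unique (hc.congr_of_eventuallyEq (Eventually.of_forall fun t => by
      simp))
    simpa [dirDeriv] using hu
  have hfA : ContDiff ℝ ∞ fun p : Phase d × (Phase d × Phase d) => f (p.1 + p.2.1) :=
    hf.comp (by fun_prop)
  have hgA : ContDiff ℝ ∞ fun p : Phase d × (Phase d × Phase d) => g (p.1 + p.2.2) :=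
    hg.comp (by fun_prop)
  unfold prodAmp
  rw [dirDeriv_mul hΩ (hfA.mul hgA), e0, dirDeriv_mul hfA hgA, e1, e2]
  funext p
  ring

lemma weylProd_sub_left (hB : ∀ l j, IsBCInfty (B l j)) (hε : 0 < ε) (lam : ℝ)
    {w₁ w₂ : Unit → Phase d → ℝ} {m₁ m₂ : ℕ} {f f' g : Phase d → ℂ}
    (hf : IsAmp (ContinuousLinearMap.id ℝ _) (fun _ => w₁) fun _ => f)
    (hf' : IsAmp (ContinuousLinearMap.id ℝ _) (fun _ => w₁) fun _ => f')
    (hw₁ : IsModerate m₁ w₁)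
    (hg : IsAmp (ContinuousLinearMap.id ℝ _) (fun _ => w₂) fun _ => g)
    (hw₂ : IsModerate m₂ w₂) (X : Phase d) :
    weylProd hε lam B (fun Y => f Y - f' Y) g X =
      weylProd hε lam B f g X - weylProd hε lam B f' g X := by
  have h := (productPhase d hε).osc_sub (isAmp_prodAmp hB hε lam hf hw₁ hg hw₂)
    (isAmp_prodAmp hB hε lam hf' hw₁ hg hw₂) (hw₁.mul hw₂).isWeight
    (monotone_two_mul_add _) () X
  unfold weylProd
  rw [← mul_sub, ← h]
  congr 2
  funext p
  unfold prodAmp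
  ring

lemma weylProd_sub_right (hB : ∀ l j, IsBCInfty (B l j)) (hε : 0 < ε) (lam : ℝ)
    {w₁ w₂ : Unit → Phase d → ℝ} {m₁ m₂ : ℕ} {f g g' : Phase d → ℂ}
    (hf : IsAmp (ContinuousLinearMap.id ℝ _) (fun _ => w₁) fun _ => f)
    (hw₁ : IsModerate m₁ w₁)
    (hg : IsAmp (ContinuousLinearMap.id ℝ _) (fun _ => w₂) fun _ => g)
    (hg' : IsAmp (ContinuousLinearMap.id ℝ _) (fun _ => w₂) fun _ => g')
    (hw₂ : IsModerate m₂ w₂) (X : Phase d) :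
    weylProd hε lam B f (fun Y => g Y - g' Y) X =
      weylProd hε lam B f g X - weylProd hε lam B f g' X := by
  have h := (productPhase d hε).osc_sub (isAmp_prodAmp hB hε lam hf hw₁ hg hw₂)
    (isAmp_prodAmp hB hε lam hf hw₁ hg' hw₂) (hw₁.mul hw₂).isWeight
    (monotone_two_mul_add _) () X
  unfold weylProd
  rw [← mul_sub, ← h]
  congr 2
  funext p
  unfold prodAmp
  ring

lemma dirDeriv_weylProd (hB : ∀ l j, IsBCInfty (B l j)) (hε : 0 < ε) (lam : ℝ)
    {w₁ w₂ : Unit → Phase d → ℝ} {m₁ m₂ : ℕ} {f g : Phase d → ℂ}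
    (hf : IsAmp (ContinuousLinearMap.id ℝ _) (fun _ => w₁) fun _ => f) (hw₁ : IsModerate m₁ w₁)
    (hg : IsAmp (ContinuousLinearMap.id ℝ _) (fun _ => w₂) fun _ => g)
    (hw₂ : IsModerate m₂ w₂) (e : Conf d) :
    dirDeriv ((0, e) : Phase d) (weylProd hε lam B f g) = fun X =>
      weylProd hε lam B (dirDeriv (0, e) f) g X + weylProd hε lam B f (dirDeriv (0, e) g) X := by
  have ha := isAmp_prodAmp hB hε lam hf hw₁ hg hw₂
  have hN := monotone_two_mul_add (m₁ + m₂)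
  have hw := (hw₁.mul hw₂).isWeight
  have h1 := (productPhase d hε).dirDeriv_osc ha hw hN () (0, e)
  unfold weylProd
  rw [dirDeriv_const_mul ((productPhase d hε).contDiff_osc ha hw hN ()), h1,
    dirDeriv_prodAmp hB hε lam (hf.smooth ()) (hg.smooth ())]
  funext X
  rw [← mul_add]
  congr 1
  exact (productPhase d hε).osc_add
    (isAmp_prodAmp hB hε lam (hf.deriv (0, e)) hw₁ hg hw₂)
    (isAmp_prodAmp hB hε lam hf hw₁ (hg.deriv (0, e)) hw₂) hw hN () X

end Product

/-! ### Iterated directional derivatives. -/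

section IteratedDerivatives

variable {D : Type*} [NormedAddCommGroup D] [NormedSpace ℝ D]

/-- Iterated directional derivatives. -/
def iterDir : List D → (D → ℂ) → D → ℂ
  | [], f => f
  | e :: l, f => dirDeriv e (iterDir l f)

lemma contDiff_iterDir {f : D → ℂ} (hf : ContDiff ℝ ∞ f) (l : List D) :
    ContDiff ℝ ∞ (iterDir l f) := by
  induction l with
  | nil => exact hf
  | cons e l ih => exact contDiff_dirDeriv ih e

lemma iterDir_append (l l' : List D) (f : D → ℂ) :
    iterDir (l ++ l') f = iterDir l (iterDir l' f) := by
  induction l with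
  | nil => rfl
  | cons e l ih => simp only [List.cons_append, iterDir, ih]

lemma iterDir_perm {f : D → ℂ} (hf : ContDiff ℝ ∞ f) {l l' : List D} (h : l.Perm l') :
    iterDir l f = iterDir l' f := by
  induction h with
  | nil => rfl
  | cons e _ ih => simp only [iterDir, ih]
  | swap e e' l => exact dirDeriv_comm (contDiff_iterDir hf l) _ _
  | trans _ _ ih ih' => exact ih.trans ih'

lemma iterDir_add {f g : D → ℂ} (hf : ContDiff ℝ ∞ f) (hg : ContDiff ℝ ∞ g) (l : List D) :
    iterDir l (fun p => f p + g p) = fun p => iterDir l f p + iterDir l g p := by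
  induction l with
  | nil => rfl
  | cons e l ih =>
    simp only [iterDir, ih]
    exact dirDeriv_add (contDiff_iterDir hf l) (contDiff_iterDir hg l) e

lemma iteratedFDeriv_apply_eq_iterDir {f : D → ℂ} (hf : ContDiff ℝ ∞ f) {n : ℕ} (v : Fin n → D)
    (x : D) : iteratedFDeriv ℝ n f x v = iterDir (List.ofFn v) f x := by
  induction n generalizing x with
  | zero => simp [iterDir]
  | succ n ih =>
    rw [iteratedFDeriv_succ_apply_left, List.ofFn_succ]
    have hd : DifferentiableAt ℝ (iteratedFDeriv ℝ n f) x :=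
      hf.differentiable_iteratedFDeriv (WithTop.coe_lt_coe.2 (by exact_mod_cast ENat.natCast_lt_top n)) x
    have h : (fun y => iteratedFDeriv ℝ n f y (Fin.tail v)) =
        iterDir (List.ofFn (Fin.tail v)) f := funext fun y => ih _ y
    have h2 := (fderiv_continuousMultilinear_apply_const_apply hd (Fin.tail v) (v 0)).symm
    rw [h2, h]
    rfl

lemma IsAmp.iterDir {ι : Type*} {w : ι → D → ℝ} {f : ι → D → ℂ}
    (hf : IsAmp (ContinuousLinearMap.id ℝ D) (fun _ => w) f) (l : List D) :
    IsAmp (ContinuousLinearMap.id ℝ D) (fun _ => w) fun i => iterDir l (f i) := by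
  induction l with
  | nil => exact hf
  | cons e l ih => exact ih.deriv e

end IteratedDerivatives

/-! ### Hörmander symbols and the symbol estimate for the product. -/

section Symbols

variable {d : ℕ} {m m₁ m₂ ρ : ℝ} {f g : Phase d → ℂ}

/-- A coordinate direction in configuration space. -/
def posDir (l : Fin d) : Phase d := (stdVec l, 0)

/-- A coordinate direction in momentum space. -/
def momDir (l : Fin d) : Phase d := (0, stdVec l)

lemma mixedPartial_eq (hf : ContDiff ℝ ∞ f) {p q : ℕ} (a : Fin p → Fin d) (b : Fin q → Fin d)
    (X : Phase d) : mixedPartial f a b X =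
      iterDir ((List.ofFn a).map posDir ++ (List.ofFn b).map momDir) f X := by
  unfold mixedPartial
  rw [iteratedFDeriv_apply_eq_iterDir hf, List.ofFn_fin_append, List.map_ofFn, List.map_ofFn]
  rfl

lemma isSymbol_iff : IsSymbol m ρ f ↔ ContDiff ℝ ∞ f ∧ ∀ la lb : List (Fin d), ∃ C, ∀ X,
    ‖iterDir (la.map posDir ++ lb.map momDir) f X‖ ≤
      C * japanese X.2 ^ (m - (lb.length : ℝ) * ρ) := by
  refine and_congr_right fun hf => ⟨fun h la lb => ?_, fun h p q a b => ?_⟩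
  · obtain ⟨C, hC⟩ := h la.length lb.length la.get lb.get
    refine ⟨C, fun X => ?_⟩
    have := hC X
    rwa [mixedPartial_eq hf, List.ofFn_get, List.ofFn_get] at this
  · obtain ⟨C, hC⟩ := h (List.ofFn a) (List.ofFn b)
    refine ⟨C, fun X => ?_⟩
    have := hC X
    rwa [List.length_ofFn, ← mixedPartial_eq hf] at this

lemma one_le_japanese (ξ : Conf d) : 1 ≤ japanese ξ := by
  unfold japanese
  rw [Real.one_le_sqrt]
  nlinarith [sq_nonneg ‖ξ‖]

lemma japanese_pos (ξ : Conf d) : 0 < japanese ξ := zero_lt_one.trans_le (one_le_japanese ξ)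

lemma japanese_add_le (ξ η : Conf d) : japanese (ξ + η) ≤ japanese ξ * (1 + ‖η‖) := by
  unfold japanese
  refine Real.sqrt_le_iff.2 ⟨by positivity, ?_⟩
  rw [mul_pow, Real.sq_sqrt (by positivity)]
  have h := norm_add_le ξ η
  have h1 := norm_nonneg ξ
  have h2 := norm_nonneg η
  have h3 : ‖ξ + η‖ ^ 2 ≤ (‖ξ‖ + ‖η‖) ^ 2 := by gcongr
  have h4 : 0 ≤ ‖η‖ * (‖ξ‖ - 1) ^ 2 := by positivity
  nlinarith [mul_nonneg h1 h2, mul_nonneg (sq_nonneg ‖ξ‖) (sq_nonneg ‖η‖)]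

/-- Peetre's inequality. For negative `s` the case of exponent one is applied to $\xi+\eta$ and
$-\eta$; the exponent is rounded up so that it becomes a polynomial weight. -/
lemma japanese_rpow_add_le (s : ℝ) (ξ η : Conf d) :
    japanese (ξ + η) ^ s ≤ japanese ξ ^ s * (1 + ‖η‖) ^ ⌈|s|⌉₊ := by
  have h1 := japanese_pos ξ
  have h2 := japanese_pos (ξ + η)
  have h3 : (1 : ℝ) ≤ 1 + ‖η‖ := one_le_one_add_norm η
  have h4 : (1 + ‖η‖) ^ |s| ≤ (1 + ‖η‖) ^ ⌈|s|⌉₊ := by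
    rw [← Real.rpow_natCast]
    exact Real.rpow_le_rpow_of_exponent_le h3 (Nat.le_ceil _)
  refine le_trans ?_ (mul_le_mul_of_nonneg_left h4 (by positivity))
  rcases le_total 0 s with hs | hs
  · rw [abs_of_nonneg hs, ← Real.mul_rpow (by positivity) (by positivity)]
    exact Real.rpow_le_rpow h2.le (japanese_add_le ξ η) hs
  · rw [abs_of_nonpos hs, Real.rpow_neg (by positivity), ← Real.inv_rpow (by positivity),
      ← Real.mul_rpow (by positivity) (by positivity)]
    refine Real.rpow_le_rpow_of_nonpos (by positivity) ?_ hs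
    rw [← div_eq_mul_inv, div_le_iff₀ (by positivity)]
    have h := japanese_add_le (ξ + η) (-η)
    rwa [add_neg_cancel_right, norm_neg] at h

lemma isModerate_japanese {ι : Type*} (s : ℝ) :
    IsModerate ⌈|s|⌉₊ fun (_ : ι) (X : Phase d) => japanese X.2 ^ s := by
  refine ⟨fun i X => (Real.rpow_pos_of_pos (japanese_pos _) _).le, 1, zero_le_one,
    fun i X Y => ?_⟩
  rw [one_mul]
  refine (japanese_rpow_add_le s X.2 Y.2).trans ?_
  have := Real.rpow_pos_of_pos (japanese_pos X.2) s
  gcongr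
  exact norm_snd_le Y

lemma japanese_rpow_mono (ξ : Conf d) {s t : ℝ} (h : s ≤ t) : japanese ξ ^ s ≤ japanese ξ ^ t :=
  Real.rpow_le_rpow_of_exponent_le (one_le_japanese ξ) h

lemma IsSymbol.mono (hf : IsSymbol m₁ ρ f) (h : m₁ ≤ m₂) : IsSymbol m₂ ρ f := by
  refine ⟨hf.1, fun p q a b => ?_⟩
  obtain ⟨C, hC⟩ := hf.2 p q a b
  refine ⟨|C|, fun X => (hC X).trans ?_⟩
  have h1 := Real.rpow_pos_of_pos (japanese_pos X.2) (m₁ - q * ρ)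
  exact mul_le_mul (le_abs_self C) (japanese_rpow_mono _ (by linarith)) h1.le (abs_nonneg _)

lemma IsSymbol.posDeriv (hf : IsSymbol m ρ f) (l : Fin d) :
    IsSymbol m ρ (dirDeriv (posDir l) f) := by
  rw [isSymbol_iff] at hf ⊢
  refine ⟨contDiff_dirDeriv hf.1 _, fun la lb => ?_⟩
  obtain ⟨C, hC⟩ := hf.2 (l :: la) lb
  refine ⟨C, fun X => ?_⟩
  have h := hC X
  rwa [iterDir_perm hf.1 (l' := (la.map posDir ++ lb.map momDir) ++ [posDir l]) (by
    simpa using (List.perm_append_singleton (posDir l) (la.map posDir ++ lb.map momDir)).symm),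
    iterDir_append] at h

lemma IsSymbol.momDeriv (hf : IsSymbol m ρ f) (l : Fin d) :
    IsSymbol (m - ρ) ρ (dirDeriv (momDir l) f) := by
  rw [isSymbol_iff] at hf ⊢
  refine ⟨contDiff_dirDeriv hf.1 _, fun la lb => ?_⟩
  obtain ⟨C, hC⟩ := hf.2 la (lb ++ [l])
  refine ⟨C, fun X => ?_⟩
  have h := hC X
  rw [List.map_append, ← List.append_assoc, iterDir_append] at h
  refine h.trans (le_of_eq ?_)
  congr 2
  rw [List.length_append]
  push_cast
  simp
  ring

lemma dirDeriv_expand (hf : ContDiff ℝ ∞ f) (e : Phase d) :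
    dirDeriv e f = fun X => (∑ l, ((e.1 l : ℝ) : ℂ) * dirDeriv (posDir l) f X) +
      ∑ l, ((e.2 l : ℝ) : ℂ) * dirDeriv (momDir l) f X := by
  funext X
  have he : e = (∑ l, e.1 l • posDir l) + ∑ l, e.2 l • momDir l := by
    ext1
    · simp [posDir, momDir, sum_smul_stdVec, Prod.fst_sum]
    · simp [posDir, momDir, sum_smul_stdVec, Prod.snd_sum]
  unfold dirDeriv
  conv_lhs => rw [he]
  simp only [map_add, map_sum, map_smul, Complex.real_smul]

/-- The gain of $\rho$ per momentum derivative is discarded here, which is harmless for nonnegative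
$\rho$. It is recovered in `isAmp_momDeriv_weylProd` by applying the bound to differentiated
symbols. -/
lemma IsSymbol.isAmp (hf : IsSymbol m ρ f) (hρ : 0 ≤ ρ) :
    IsAmp (ContinuousLinearMap.id ℝ _) (fun _ (_ : Unit) X => japanese X.2 ^ m) fun _ => f := by
  have hW : ∀ (k : ℕ) (i : Unit) (X : Phase d), 0 ≤ japanese X.2 ^ m :=
    fun k i X => (Real.rpow_pos_of_pos (japanese_pos _) _).le
  intro n
  induction n generalizing f with
  | zero =>
    refine ⟨fun _ => hf.1, ?_⟩
    obtain ⟨C, hC⟩ := (isSymbol_iff.1 hf).2 [] []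
    exact ⟨C, fun _ X => by simpa [MagneticWeyl.iterDir] using hC X⟩
  | succ n ih =>
    obtain ⟨C, hC⟩ := (isSymbol_iff.1 hf).2 [] []
    refine ⟨⟨fun _ => hf.1, C, fun _ X => by simpa [MagneticWeyl.iterDir] using hC X⟩,
      fun e => ?_⟩
    have h : IsAmpN (ContinuousLinearMap.id ℝ _) n (fun _ (_ : Unit) X => japanese X.2 ^ m)
        fun _ => dirDeriv e f := by
      rw [dirDeriv_expand hf.1 e]
      exact (IsAmpN.sum (fun l _ => (ih (hf.posDeriv l)).smul _ hW) hW).add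
        (IsAmpN.sum (fun l _ => (ih ((hf.momDeriv l).mono (by linarith))).smul _ hW) hW)
    exact h

variable {ε : ℝ} {B : Fin d → Fin d → Conf d → ℝ}

/-- Induction on the momentum derivatives by the Leibniz rule: in each of the two terms one factor
has order lowered by $\rho$, so both terms have the total order asserted. -/
lemma isAmp_momDeriv_weylProd (hB : ∀ l j, IsBCInfty (B l j)) (hε : 0 < ε) (lam : ℝ)
    (hρ : 0 ≤ ρ) (lb : List (Fin d)) (hf : IsSymbol m₁ ρ f) (hg : IsSymbol m₂ ρ g) :
    IsAmp (ContinuousLinearMap.id ℝ _)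
      (fun _ (_ : Unit) X => japanese X.2 ^ (m₁ + m₂ - (lb.length : ℝ) * ρ))
      fun _ => iterDir (lb.map momDir) (weylProd hε lam B f g) := by
  have hH : ∀ {s t : ℝ} {u v : Phase d → ℂ}, IsSymbol s ρ u → IsSymbol t ρ v →
      IsAmp (ContinuousLinearMap.id ℝ _) (fun _ (_ : Unit) X => japanese X.2 ^ (s + t))
        fun _ => weylProd hε lam B u v := by
    intro s t u v hu hv
    have h := isAmp_weylProd hB hε lam (hu.isAmp hρ) (isModerate_japanese s) (hv.isAmp hρ)
      (isModerate_japanese t)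
    simpa only [← Real.rpow_add (japanese_pos _)] using h
  induction lb using List.reverseRecOn generalizing m₁ m₂ f g with
  | nil => simpa [MagneticWeyl.iterDir] using hH hf hg
  | append_singleton lb l ih =>
    rw [List.map_append, iterDir_append]
    have h1 := ih (hf.momDeriv l) hg
    have h2 := ih hf (hg.momDeriv l)
    have e : iterDir ([l].map momDir) (weylProd hε lam B f g) = fun X =>
        weylProd hε lam B (dirDeriv (momDir l) f) g X +
          weylProd hε lam B f (dirDeriv (momDir l) g) X :=
      dirDeriv_weylProd hB hε lam (hf.isAmp hρ) (isModerate_japanese m₁) (hg.isAmp hρ)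
        (isModerate_japanese m₂) (stdVec l)
    rw [e, iterDir_add ((hH (hf.momDeriv l) hg).smooth ()) ((hH hf (hg.momDeriv l)).smooth ())]
    have e1 : m₁ - ρ + m₂ - (lb.length : ℝ) * ρ = m₁ + m₂ - ((lb ++ [l]).length : ℝ) * ρ := by
      rw [List.length_append]; push_cast; simp; ring
    have e2 : m₁ + (m₂ - ρ) - (lb.length : ℝ) * ρ = m₁ + m₂ - ((lb ++ [l]).length : ℝ) * ρ := by
      rw [List.length_append]; push_cast; simp; ring
    rw [e1] at h1
    rw [e2] at h2
    exact h1.add h2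

/-- The magnetic Weyl product of two symbols is a symbol. -/
lemma isSymbol_weylProd (hB : ∀ l j, IsBCInfty (B l j)) (hε : 0 < ε) (lam : ℝ) (hρ : 0 ≤ ρ)
    (hf : IsSymbol m₁ ρ f) (hg : IsSymbol m₂ ρ g) :
    IsSymbol (m₁ + m₂) ρ (weylProd hε lam B f g) := by
  rw [isSymbol_iff]
  refine ⟨(isAmp_momDeriv_weylProd hB hε lam hρ [] hf hg).smooth (), fun la lb => ?_⟩
  obtain ⟨C, -, hC⟩ := ((isAmp_momDeriv_weylProd hB hε lam hρ lb hf hg).iterDir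
    (la.map posDir)).bound fun k i X => (Real.rpow_pos_of_pos (japanese_pos _) _).le
  exact ⟨C, fun X => by rw [iterDir_append]; exact hC () X⟩

end Symbols

/-! ### Regularization of functions of polynomial growth. -/

section Regularization

variable {D : Type*} [NormedAddCommGroup D] [NormedSpace ℝ D] {ι : Type*}

lemma exists_schwartz_of_isAmp [FiniteDimensional ℝ D] {f : D → ℂ}
    (hf : ∀ K : ℕ, IsAmp (ContinuousLinearMap.id ℝ D)
      (fun _ (_ : Unit) p => ((1 + ‖p‖) ^ K)⁻¹) fun _ => f) :
    ∃ ψ : 𝓢(D, ℂ), ⇑ψ = f := by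
  refine ⟨⟨f, (hf 0).smooth (), fun k n => ?_⟩, rfl⟩
  obtain ⟨C, hC, h⟩ := (hf k).norm_iteratedFDeriv_le (fun _ _ _ => by positivity)
    (fun _ _ => monotone_const) n
  refine ⟨C, fun p => ?_⟩
  calc ‖p‖ ^ k * ‖iteratedFDeriv ℝ n f p‖ ≤ (1 + ‖p‖) ^ k * (C * ((1 + ‖p‖) ^ k)⁻¹) := by
        gcongr
        · linarith
        · exact h () p
    _ = C := by
        have : (1 + ‖p‖) ^ k ≠ 0 := by positivity
        field_simp

/-- The regularization converges at rate `δ` at the price of one power of the norm. Keeping the rate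
inside the weight makes all later limits consequences of linear estimates. -/
lemma isAmp_regularize_sub {H : Type*} [NormedAddCommGroup H] [NormedSpace ℝ H]
    {hz : D →L[ℝ] H} {w : D → ℝ} {f : D → ℂ}
    (hf : IsAmp hz (fun _ (_ : Unit) => w) fun _ => f) (hw : ∀ p, 0 ≤ w p)
    {χ : 𝓢(D, ℂ)} (hχ : χ 0 = 1) :
    IsAmp hz (fun _ (δ : Set.Ioc (0 : ℝ) 1) p => δ * ((1 + ‖p‖) * w p))
      fun δ p => regularize χ δ f p - f p := by
  have h := (isAmp_cutoff hz χ).mul (hf.reindex fun _ : Set.Ioc (0 : ℝ) 1 => ())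
    (W₃ := fun _ (δ : Set.Ioc (0 : ℝ) 1) p => δ * ((1 + ‖p‖) * w p))
    (fun _ δ p => mul_nonneg δ.2.1.le (by positivity)) (fun k _ p => hw p)
    fun j k => ⟨1, fun δ p => le_of_eq (by ring)⟩
  simp only [hχ, sub_mul, one_mul] at h
  exact h

lemma isAmp_regularize {H : Type*} [NormedAddCommGroup H] [NormedSpace ℝ H]
    {hz : D →L[ℝ] H} {w : D → ℝ} {f : D → ℂ}
    (hf : IsAmp hz (fun _ (_ : Unit) => w) fun _ => f) (hw : ∀ p, 0 ≤ w p)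
    {χ : 𝓢(D, ℂ)} (hχ : χ 0 = 1) :
    IsAmp hz (fun _ (_ : Set.Ioc (0 : ℝ) 1) p => (1 + ‖p‖) * w p)
      fun δ p => regularize χ δ f p := by
  have hw' : ∀ p, w p ≤ (1 + ‖p‖) * w p := fun p =>
    le_mul_of_one_le_left (hw p) (one_le_one_add_norm p)
  have h := ((isAmp_regularize_sub hf hw hχ).mono
    (W' := fun _ _ p => (1 + ‖p‖) * w p)
    (fun _ δ p => mul_nonneg δ.2.1.le (mul_nonneg (by positivity) (hw p)))
    fun k => ⟨1, fun δ p => by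
      rw [one_mul]
      exact mul_le_of_le_one_left (mul_nonneg (by positivity) (hw p)) δ.2.2⟩).add
    ((hf.reindex fun _ : Set.Ioc (0 : ℝ) 1 => ()).mono (fun _ _ p => hw p)
      fun k => ⟨1, fun _ p => by rw [one_mul]; exact hw' p⟩)
  simpa only [sub_add_cancel] using h

lemma exists_schwartz_regularize [FiniteDimensional ℝ D] {f : D → ℂ} {M : ℕ}
    (hf : IsAmp (ContinuousLinearMap.id ℝ D) (fun _ (_ : Unit) p => (1 + ‖p‖) ^ M) fun _ => f)
    (χ : 𝓢(D, ℂ)) {δ : ℝ} (hδ : 0 < δ) : ∃ ψ : 𝓢(D, ℂ), ⇑ψ = regularize χ δ f := by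
  refine exists_schwartz_of_isAmp fun K => ?_
  refine (isAmp_dilation _ χ hδ (K + M)).mul hf (fun _ _ _ => by positivity)
    (fun _ _ _ => by positivity) fun j k => ⟨1, fun i p => le_of_eq ?_⟩
  have : (1 + ‖p‖) ^ M ≠ 0 := by positivity
  rw [pow_add]
  field_simp

lemma tendsto_of_isAmp_sub {H : Type*} [NormedAddCommGroup H] [NormedSpace ℝ H]
    {hz : D →L[ℝ] H} {w : D → ℝ} {a : D → ℂ} {b : ℝ → D → ℂ} (hw : ∀ p, 0 ≤ w p)
    (h : IsAmp hz (fun _ (δ : Set.Ioc (0 : ℝ) 1) p => δ * w p) fun δ p => b δ p - a p) (p : D) :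
    Tendsto (fun δ => b δ p) (𝓝[>] 0) (𝓝 (a p)) := by
  obtain ⟨C, hC, hb⟩ := h.bound fun _ δ p => mul_nonneg δ.2.1.le (hw p)
  rw [tendsto_iff_norm_sub_tendsto_zero]
  refine squeeze_zero' (Eventually.of_forall fun _ => norm_nonneg _)
    (g := fun δ => C * (δ * w p)) ?_ ?_
  · filter_upwards [Ioc_mem_nhdsGT zero_lt_one] with δ hδ
    exact hb ⟨δ, hδ⟩ p
  · have : Tendsto (fun δ : ℝ => C * (δ * w p)) (𝓝 0) (𝓝 (C * (0 * w p))) :=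
      Continuous.tendsto (by fun_prop) 0
    rw [zero_mul, mul_zero] at this
    exact this.mono_left nhdsWithin_le_nhds

end Regularization

/-! ### Cut-offs which also involve the parameter. -/

namespace OscPhase

variable {P Q U V : Type*} [NormedAddCommGroup P] [NormedSpace ℝ P]
  [NormedAddCommGroup Q] [NormedSpace ℝ Q] [NormedAddCommGroup U] [NormedSpace ℝ U]
  [NormedAddCommGroup V] [NormedSpace ℝ V] (S : OscPhase Q U V)
  [FiniteDimensional ℝ Q] [MeasureSpace Q] [BorelSpace Q]
  [(volume : Measure Q).IsAddHaarMeasure]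
  {w : ℕ → Unit → P → ℝ} {N : ℕ → ℕ} {M : ℕ}
  {E : Type*} [NormedAddCommGroup E] [NormedSpace ℝ E]

lemma inv_pow_le_of_le_mul {a b c C : ℝ} (ha : 0 < a) (hb : 0 < b)
    (h : a ≤ C * (b * c)) (K : ℕ) : (b ^ K)⁻¹ ≤ C ^ K * (c ^ K * (a ^ K)⁻¹) := by
  rw [← mul_assoc, ← div_eq_mul_inv, le_div_iff₀ (by positivity), inv_mul_le_iff₀ (by positivity),
    ← mul_pow, ← mul_pow]
  exact pow_le_pow_left₀ ha.le (h.trans (le_of_eq (by ring))) K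

lemma isAmp_decay_comp (A : P × Q →L[ℝ] E)
    (hA : ∃ C, ∀ p, 1 + ‖p.2‖ ≤ C * ((1 + ‖A p‖) * (1 + ‖p.1‖))) {ψ : E → ℂ} {K : ℕ}
    {H : Type*} [NormedAddCommGroup H] [NormedSpace ℝ H] {hz : E →L[ℝ] H}
    (hψ : IsAmp hz (fun _ (_ : Unit) p => ((1 + ‖p‖) ^ K)⁻¹) fun _ => ψ) :
    IsAmp (S.hz P) (fun _ (_ : Unit) p => (1 + ‖p.1‖) ^ K * ((1 + ‖p.2‖) ^ K)⁻¹)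
      fun _ p => ψ (A p) := by
  obtain ⟨C, hC⟩ := hA
  exact (hψ.comp_clm_const (hz' := S.hz P) A).mono (fun _ _ _ => by positivity)
    fun k => ⟨C ^ K, fun i p => inv_pow_le_of_le_mul (by positivity) (by positivity) (hC p) K⟩

lemma isDecaying_cutoff_mul {a : P × Q → ℂ} (ha : IsAmp (S.hz P) (S.wt w N M) fun _ => a)
    (hw : IsWeight w) (A : P × Q →L[ℝ] E)
    (hA : ∃ C, ∀ p, 1 + ‖p.2‖ ≤ C * ((1 + ‖A p‖) * (1 + ‖p.1‖))) (χ : 𝓢(E, ℂ)) {δ : ℝ}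
    (hδ : 0 < δ) : S.IsDecaying fun p => χ (δ • A p) * a p := by
  have h := S.isDecaying_mul (c := fun p => χ (δ • A p)) (g := fun K x => (1 + ‖x‖) ^ K) ha hw
    (fun _ _ => by positivity) fun K => S.isAmp_decay_comp A hA (ψ := fun p => χ (δ • p))
      (isAmp_dilation (0 : E →L[ℝ] E) χ hδ K)
  simpa only [mul_comm] using h

/-- The theorem centres its cut-offs at the origin of phase space, whereas the amplitude is centred
at `X`. After translation the cut-off depends on `x` and `q` together, and the error only acquires
an extra factor $1+|x|$. -/
lemma tendsto_osc_cutoff {a : P × Q → ℂ} (ha : IsAmp (S.hz P) (S.wt w N M) fun _ => a)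
    (hw : IsWeight w) (hN : Monotone N) (A : P × Q →L[ℝ] E)
    (hA : ∃ C, ∀ p, 1 + ‖p.2‖ ≤ C * ((1 + ‖A p‖) * (1 + ‖p.1‖))) {χ : 𝓢(E, ℂ)} (hχ : χ 0 = 1)
    (x : P) : Tendsto (fun δ : ℝ => ∫ q, cis (S.Φ q) * (χ (δ • A (x, q)) * a (x, q))) (𝓝[>] 0)
      (𝓝 (S.osc a x)) := by
  obtain ⟨C, hC⟩ := S.boundQ
  have hC0 : 0 ≤ C := by
    have h0 := hC 0
    simp only [map_zero, norm_zero, add_zero, mul_one] at h0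
    linarith
  have h1 := (isAmp_cutoff (0 : E →L[ℝ] E) χ).comp_clm_const (hz' := S.hz P) A
  have h2 := h1.mul (W₃ := S.wt (fun k (δ : Set.Ioc (0 : ℝ) 1) x => δ * ((1 + ‖x‖) * w k () x))
      (fun k => N k + 1) (M + 1)) (ha.reindex (fun _ : Set.Ioc (0 : ℝ) 1 => ()))
    (fun _ δ p => mul_nonneg δ.2.1.le (by positivity)) (fun k _ p => S.wt_nonneg hw.nonneg _ _ _)
    fun j k => ⟨(1 + ‖A‖) * C, fun δ p => ?_⟩
  · simp only [hχ, sub_mul, one_mul] at h2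
    exact S.tendsto_osc ha hw hN (fun δ hδ => S.isDecaying_cutoff_mul ha hw A hA χ hδ) h2
      (fun k x => mul_nonneg (by positivity) (hw.nonneg _ _ _))
      (fun x => fun k l hkl => mul_le_mul_of_nonneg_left (hw.mono () x hkl) (by positivity))
      (fun k l hkl => Nat.add_le_add_right (hN hkl) 1) x
  · have h3 : 1 + ‖A p‖ ≤ (1 + ‖A‖) * ((1 + ‖p.1‖) *
        (C * ((1 + ‖S.πu p.2‖) * (1 + ‖S.πv p.2‖)))) := by
      refine (one_add_norm_clm_le A p).trans ?_
      gcongr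
      refine (one_add_norm_prod_le p).trans ?_
      gcongr
      exact hC p.2
    have h4 := S.wt_monotone (M := M) hw.nonneg hw.mono hN () p (Nat.le_add_left k j)
    have h5 := S.wt_nonneg (N := N) (M := M) hw.nonneg k () p
    have h6 := δ.2.1.le
    calc (δ : ℝ) * (1 + ‖A p‖) * S.wt w N M k () p
        ≤ δ * ((1 + ‖A‖) * ((1 + ‖p.1‖) * (C * ((1 + ‖S.πu p.2‖) * (1 + ‖S.πv p.2‖))))) *
          S.wt w N M (j + k) () p := by
          gcongr
      _ = _ := by simp only [wt]; ring

end OscPhase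

/-! ### The phase-space formula, and products of regularized or Schwartz functions. -/

section ProductLimits

variable {d : ℕ} {ε lam : ℝ} {B : Fin d → Fin d → Conf d → ℝ} {f g : Phase d → ℂ} {M₁ M₂ : ℕ}

lemma IsSymbol.isAmp_pow {m ρ : ℝ} (hf : IsSymbol m ρ f) (hρ : 0 ≤ ρ) :
    IsAmp (ContinuousLinearMap.id ℝ _) (fun _ (_ : Unit) X => (1 + ‖X‖) ^ ⌈|m|⌉₊)
      fun _ => f := by
  refine (hf.isAmp hρ).mono (fun _ _ X => (Real.rpow_pos_of_pos (japanese_pos _) _).le)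
    fun _ => ⟨1, fun _ X => ?_⟩
  have h := japanese_rpow_add_le m 0 X.2
  rw [zero_add] at h
  refine h.trans ?_
  have h0 : japanese (0 : Conf d) = 1 := by simp [japanese]
  rw [h0, Real.one_rpow]
  gcongr
  exact norm_snd_le X

/-- From $f_\delta\sharp g_\delta-f\sharp g=(f_\delta-f)\sharp g_\delta+f\sharp(g_\delta-g)$ and the
uniform product estimate. The exponent is `M₁ + 1` plus `M₂ + 1`. -/
lemma isAmp_weylProd_regularize_sub (hB : ∀ l j, IsBCInfty (B l j)) (hε : 0 < ε) (lam : ℝ)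
    (hf : IsAmp (ContinuousLinearMap.id ℝ _) (fun _ (_ : Unit) X => (1 + ‖X‖) ^ M₁) fun _ => f)
    (hg : IsAmp (ContinuousLinearMap.id ℝ _) (fun _ (_ : Unit) X => (1 + ‖X‖) ^ M₂) fun _ => g)
    {χ₁ χ₂ : 𝓢(Phase d, ℂ)} (h₁ : χ₁ 0 = 1) (h₂ : χ₂ 0 = 1) :
    IsAmp (ContinuousLinearMap.id ℝ _)
      (fun _ (δ : Set.Ioc (0 : ℝ) 1) X => δ * (1 + ‖X‖) ^ (M₁ + M₂ + 2)) fun δ X =>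
      weylProd hε lam B (regularize χ₁ δ f) (regularize χ₂ δ g) X - weylProd hε lam B f g X := by
  have hp : ∀ (M : ℕ) (X : Phase d), 0 ≤ (1 + ‖X‖) ^ M := fun M X => by positivity
  have f1 := isAmp_regularize_sub hf (hp M₁) h₁
  have f2 := isAmp_regularize hf (hp M₁) h₁
  have g1 := isAmp_regularize_sub hg (hp M₂) h₂
  have g2 := isAmp_regularize hg (hp M₂) h₂
  simp only [← pow_succ'] at f1 f2 g1 g2
  have hδ : ∀ δ : Set.Ioc (0 : ℝ) 1, 0 ≤ (δ : ℝ) := fun δ => δ.2.1.le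
  have hf' : IsAmp (ContinuousLinearMap.id ℝ _)
      (fun _ (_ : Unit) X => (1 + ‖X‖) ^ (M₁ + 1)) fun _ => f :=
    hf.mono (fun _ _ X => hp _ X) fun _ => ⟨1, fun _ X => by
      rw [one_mul]; exact pow_le_pow_right₀ (one_le_one_add_norm X) (by omega)⟩
  have hg' : IsAmp (ContinuousLinearMap.id ℝ _)
      (fun _ (_ : Unit) X => (1 + ‖X‖) ^ (M₂ + 1)) fun _ => g :=
    hg.mono (fun _ _ X => hp _ X) fun _ => ⟨1, fun _ X => by
      rw [one_mul]; exact pow_le_pow_right₀ (one_le_one_add_norm X) (by omega)⟩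
  have k1 := isAmp_weylProd hB hε lam f1 ((isModerate_pow (M₁ + 1)).const_mul hδ) g2
    (isModerate_pow (M₂ + 1))
  have k2 := isAmp_weylProd hB hε lam (hf'.reindex fun _ : Set.Ioc (0 : ℝ) 1 => ())
    ((isModerate_pow (M₁ + 1)).reindex fun _ => ()) g1 ((isModerate_pow (M₂ + 1)).const_mul hδ)
  have key := (k1.mono (W' := fun _ (δ : Set.Ioc (0 : ℝ) 1) X => δ * (1 + ‖X‖) ^ (M₁ + M₂ + 2))
    (fun _ δ X => mul_nonneg (mul_nonneg (hδ δ) (hp _ X)) (hp _ X))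
    fun _ => ⟨1, fun δ X => le_of_eq (by ring)⟩).add
    (k2.mono (fun _ δ X => mul_nonneg (hp _ X) (mul_nonneg (hδ δ) (hp _ X)))
    fun _ => ⟨1, fun δ X => le_of_eq (by ring)⟩)
  refine (congrArg (IsAmp _ _) (funext fun δ => funext fun X => ?_)).mpr key
  have e1 := weylProd_sub_left hB hε lam (f2.reindex fun _ : Unit => δ) hf'
    (isModerate_pow (M₁ + 1)) (g2.reindex fun _ : Unit => δ) (isModerate_pow (M₂ + 1)) X
  have e2 := weylProd_sub_right hB hε lam hf' (isModerate_pow (M₁ + 1))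
    (g2.reindex fun _ : Unit => δ) hg' (isModerate_pow (M₂ + 1)) X
  refine Eq.trans ?_ (congrArg₂ (· + ·) e1 e2).symm
  ring

/-- The second integral formula for the magnetic Weyl product. -/
lemma hasOscIntegral_productIntegrand (hB : ∀ l j, IsBCInfty (B l j)) (hε : 0 < ε) (lam : ℝ)
    (hf : IsAmp (ContinuousLinearMap.id ℝ _) (fun _ (_ : Unit) X => (1 + ‖X‖) ^ M₁) fun _ => f)
    (hg : IsAmp (ContinuousLinearMap.id ℝ _) (fun _ (_ : Unit) X => (1 + ‖X‖) ^ M₂) fun _ => g)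
    (X : Phase d) : HasOscIntegral (productIntegrand ε lam B f g X)
      ((((Real.pi * ε) ^ (2 * d) : ℝ) : ℂ) * weylProd hε lam B f g X) := by
  intro χ hχ
  have ha := isAmp_prodAmp hB hε lam hf (isModerate_pow M₁) hg (isModerate_pow M₂)
  have hw := ((isModerate_pow (ι := Unit) (E := Phase d) M₁).mul (isModerate_pow M₂)).isWeight
  -- The translation by $(X,X)$ from the amplitude's coordinates to those of the integrand, in which
  -- the cut-off is given.
  set A : Phase d × (Phase d × Phase d) →L[ℝ] Phase d × Phase d :=
    ((ContinuousLinearMap.fst ℝ _ _).prod (ContinuousLinearMap.fst ℝ _ _)) +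
      ContinuousLinearMap.snd ℝ _ _ with hA
  have hAe : ∀ p, A p = (p.1, p.1) + p.2 := fun p => by simp [hA]
  have hAb : ∃ C, ∀ p : Phase d × (Phase d × Phase d),
      1 + ‖p.2‖ ≤ C * ((1 + ‖A p‖) * (1 + ‖p.1‖)) := by
    refine ⟨1, fun p => ?_⟩
    have h := one_add_norm_add_le (A p) (-(p.1, p.1))
    have e : A p + -(p.1, p.1) = p.2 := by rw [hAe]; abel
    have e' : ‖(p.1, p.1)‖ = ‖p.1‖ := by rw [Prod.norm_mk, max_self]
    rwa [e, norm_neg, e', ← one_mul ((1 + ‖A p‖) * _)] at h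
  have key : ∀ δ : ℝ, ∀ q : Phase d × Phase d, regularize χ δ (productIntegrand ε lam B f g X)
      ((X, X) + q) = cis ((productPhase d hε).Φ q) *
        (χ (δ • A (X, q)) * prodAmp ε lam B f g (X, q)) := by
    intro δ q
    have e1 : X.1 + (X.1 + q.1.1) - (X.1 + q.2.1) = X.1 + q.1.1 - q.2.1 := by abel
    have e2 : -X.1 + (X.1 + q.1.1) + (X.1 + q.2.1) = X.1 + q.1.1 + q.2.1 := by abel
    have e3 : X.1 - (X.1 + q.1.1) + (X.1 + q.2.1) = X.1 - q.1.1 + q.2.1 := by abel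
    simp only [regularize, productIntegrand, prodAmp, hAe, productPhase, Prod.fst_add,
      Prod.snd_add, add_sub_cancel_left, e1, e2, e3]
    ring
  refine ⟨fun δ hδ => ?_, ?_⟩
  · have h1 := (productPhase d hε).integrable_phase_mul
      (((productPhase d hε).isDecaying_cutoff_mul ha hw A hAb χ hδ).integrable X)
    simp only [← key] at h1
    refine (h1.comp_add_left (-(X, X))).congr (Eventually.of_forall fun q => ?_)
    simp only [add_neg_cancel_left]
  · have hne : (((Real.pi * ε) ^ (2 * d) : ℝ) : ℂ) ≠ 0 := by
      have : (Real.pi * ε) ^ (2 * d) ≠ 0 := by positivity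
      exact_mod_cast this
    unfold weylProd
    rw [mul_inv_cancel_left₀ hne]
    have h1 := (productPhase d hε).tendsto_osc_cutoff ha hw (monotone_two_mul_add _) A hAb hχ X
    simp only [← key] at h1
    refine h1.congr fun δ => ?_
    exact integral_add_left_eq_self (regularize χ δ (productIntegrand ε lam B f g X)) (X, X)

/-- The decay of the two Schwartz factors beats the growth of all derivatives of the flux factor, so
no regularization is needed. -/
lemma weylProd_eq_integral (hB : ∀ l j, IsBCInfty (B l j)) (hε : 0 < ε) (lam : ℝ)
    (u v : 𝓢(Phase d, ℂ)) (X : Phase d) :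
    Integrable (fun q => cis ((productPhase d hε).Φ q) * prodAmp ε lam B u v (X, q)) ∧
    weylProd hε lam B u v X = ((((Real.pi * ε) ^ (2 * d) : ℝ) : ℂ))⁻¹ *
      ∫ q, cis ((productPhase d hε).Φ q) * prodAmp ε lam B u v (X, q) := by
  have hΩ : IsAmp ((productPhase d hε).hz (Phase d))
      ((productPhase d hε).wt (fun _ (_ : Unit) _ => 1) (fun k => 2 * k) 0) _ :=
    (isAmp_prodFluxExp hB hε lam).mono (fun _ _ _ => by positivity)
      fun k => ⟨1, fun i p => by simp [OscPhase.wt]⟩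
  have hT : ∀ (T : Phase d × Phase d →L[ℝ] Phase d) (ψ : 𝓢(Phase d, ℂ)) (K : ℕ),
      IsAmp ((productPhase d hε).hz (Phase d))
        (fun _ (_ : Unit) p => (1 + ‖p.1‖) ^ K * ((1 + ‖T p.2‖) ^ K)⁻¹)
        fun _ p => ψ (p.1 + T p.2) := by
    intro T ψ K
    have h := (isAmp_schwartz (ι := Unit) (0 : Phase d →L[ℝ] Phase d) ψ K).comp_clm_const
      (hz' := (productPhase d hε).hz (Phase d)) (ContinuousLinearMap.fst ℝ _ _ +
        T.comp (ContinuousLinearMap.snd ℝ (Phase d) (Phase d × Phase d)))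
    refine h.mono (fun _ _ _ => by positivity) fun k => ⟨1, fun i p => ?_⟩
    have := one_add_norm_add_le (p.1 + T p.2) (-p.1)
    rw [add_neg_cancel_comm, norm_neg, ← one_mul ((1 + ‖p.1 + T p.2‖) * _)] at this
    simpa using OscPhase.inv_pow_le_of_le_mul (by positivity) (by positivity) this K
  have hd : (productPhase d hε).IsDecaying (prodAmp ε lam B u v) := by
    refine (productPhase d hε).isDecaying_mul (g := fun K X => (1 + ‖X‖) ^ (2 * K)) hΩ
      ⟨fun _ _ _ => zero_le_one, fun _ _ => monotone_const,
        fun _ _ _ => ⟨1, Eventually.of_forall fun _ => le_rfl⟩⟩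
      (fun _ _ => by positivity) fun K => ?_
    refine (hT (ContinuousLinearMap.fst ℝ _ _) u K).mul (hT (ContinuousLinearMap.snd ℝ _ _) v K)
      (fun _ _ _ => by positivity) (fun _ _ _ => by positivity) fun j k => ⟨1, fun i p => ?_⟩
    have h1 := one_add_norm_prod_le p.2
    have h2 : ((1 + ‖p.2.1‖) ^ K)⁻¹ * ((1 + ‖p.2.2‖) ^ K)⁻¹ ≤ ((1 + ‖p.2‖) ^ K)⁻¹ := by
      rw [← mul_inv, ← mul_pow]
      gcongr
    simp only [ContinuousLinearMap.coe_fst', ContinuousLinearMap.coe_snd']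
    calc _ = (1 + ‖p.1‖) ^ (2 * K) * (((1 + ‖p.2.1‖) ^ K)⁻¹ * ((1 + ‖p.2.2‖) ^ K)⁻¹) := by ring
      _ ≤ (1 + ‖p.1‖) ^ (2 * K) * ((1 + ‖p.2‖) ^ K)⁻¹ := by gcongr
      _ = _ := by ring
  refine ⟨(productPhase d hε).integrable_phase_mul (hd.integrable X), ?_⟩
  have hs : ∀ ψ : 𝓢(Phase d, ℂ), IsAmp (ContinuousLinearMap.id ℝ _)
      (fun _ (_ : Unit) X => (1 + ‖X‖) ^ 0) fun _ => ψ := fun ψ => by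
    simpa using isAmp_schwartz (ι := Unit) (ContinuousLinearMap.id ℝ (Phase d)) ψ 0
  unfold weylProd
  rw [(productPhase d hε).osc_eq_integral (a := fun _ : Unit => prodAmp ε lam B u v)
    (isAmp_prodAmp hB hε lam (hs u) (isModerate_pow 0) (hs v) (isModerate_pow 0))
    ((isModerate_pow 0).mul (isModerate_pow 0)).isWeight (monotone_two_mul_add _) () hd X]

/-- Inverse powers are moderate weights too, so the product inherits the arbitrary decay of `u`; of
`v` only boundedness is used. -/
lemma exists_schwartz_weylProd (hB : ∀ l j, IsBCInfty (B l j)) (hε : 0 < ε) (lam : ℝ)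
    (u v : 𝓢(Phase d, ℂ)) : ∃ ψ : 𝓢(Phase d, ℂ), ⇑ψ = weylProd hε lam B u v := by
  refine exists_schwartz_of_isAmp fun K => ?_
  have h := isAmp_weylProd hB hε lam
    (isAmp_schwartz (ι := Unit) (ContinuousLinearMap.id ℝ (Phase d)) u K) (isModerate_pow_inv K)
    (isAmp_schwartz (ι := Unit) (ContinuousLinearMap.id ℝ (Phase d)) v 0) (isModerate_pow_inv 0)
  simpa using h

end ProductLimits

/-! ### Decay of Fourier integrals, uniformly in families. -/

section FourierDecay

variable {V : Type*} [NormedAddCommGroup V] [NormedSpace ℝ V] [FiniteDimensional ℝ V]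
  [MeasureSpace V] [BorelSpace V] [(volume : Measure V).IsAddHaarMeasure]
  {H : Type*} [NormedAddCommGroup H] [NormedSpace ℝ H] {hz : V →L[ℝ] H} {ι W : Type*}

open OscPhase in
lemma integrable_cis_mul {θ : V → ℝ} (hθ : Continuous θ) {g : V → ℂ} (hg : Integrable g) :
    Integrable fun v => cis (θ v) * g v :=
  hg.bdd_mul (c := 1) (continuous_cis.comp hθ).aestronglyMeasurable
    (Eventually.of_forall fun _ => (norm_cis _).le)

lemma integral_cis_clm_mul {L : V →L[ℝ] ℝ} {a : V → ℂ} (ha : ContDiff ℝ ∞ a) (e : V)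
    (h1 : Integrable a) (h2 : Integrable (dirDeriv e a)) :
    (1 + Complex.I * (L e : ℝ)) * ∫ v, cis (L v) * a v =
      ∫ v, cis (L v) * (a v - dirDeriv e a v) := by
  have hder : ∀ v, HasLineDerivAt ℝ (fun v => cis (L v) * a v)
      (Complex.I * (L e : ℝ) * (cis (L v) * a v) + cis (L v) * dirDeriv e a v) v e := by
    intro v
    have hc : HasDerivAt (fun t : ℝ => cis (L (v + t • e))) (L e • (Complex.I * cis (L v))) 0 := by
      have h0 : HasDerivAt (fun t : ℝ => L (v + t • e)) (L e) 0 := by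
        have := ((hasDerivAt_id (0 : ℝ)).mul_const (L e)).const_add (L v)
        simpa using this
      have h := (hasDerivAt_cis (L (v + (0 : ℝ) • e))).scomp 0 h0
      simp only [zero_smul, add_zero] at h
      exact h
    have ha' : HasDerivAt (fun t : ℝ => a (v + t • e)) (dirDeriv e a v) 0 :=
      ((ha.differentiable (by simp) v).hasFDerivAt.hasLineDerivAt e)
    have h := hc.mul ha'
    simp only [zero_smul, add_zero] at h
    refine HasDerivAt.congr_deriv h ?_
    rw [Complex.real_smul]
    ring
  have hi1 := integrable_cis_mul L.continuous h1
  have hi2 := integrable_cis_mul L.continuous h2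
  set G' : V → ℂ := fun v =>
    Complex.I * (L e : ℝ) * (cis (L v) * a v) + cis (L v) * dirDeriv e a v with hG'
  have hG'i : Integrable G' := (hi1.const_mul (Complex.I * (L e : ℝ))).add hi2
  have h0 : ∫ v, G' v = 0 := by
    have h := integral_bilinear_hasLineDerivAt_right_eq_neg_left_of_integrable
      (μ := (volume : Measure V)) (f := fun _ : V => (1 : ℂ)) (f' := fun _ => 0)
      (g := fun v => cis (L v) * a v) (g' := G') (v := e) (B := ContinuousLinearMap.mul ℝ ℂ)
      (by simp) (by simpa using hG'i) (by simpa using hi1)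
      (fun v _ => by simpa [HasLineDerivAt] using hasDerivAt_const (0 : ℝ) (1 : ℂ))
      (fun v _ => hder v)
    simpa using h
  simp only [hG'] at h0
  rw [integral_add (hi1.const_mul _) hi2, integral_const_mul] at h0
  simp only [mul_sub]
  rw [integral_sub hi1 hi2]
  linear_combination h0

open OscPhase in
-- Integration by parts with a linear phase: each factor $1+i\beta(e)$ is exchanged for
-- $a-\partial_e a$, which satisfies bounds of the same kind.
lemma exists_fourier_decay (β : W → V →L[ℝ] ℝ) {a : ι → V → ℂ} {c : ι → ℝ}
    (ha : IsAmp hz (fun _ i v => c i * decay v) a) (hc : ∀ i, 0 ≤ c i) (l : List V) :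
    ∃ C, 0 ≤ C ∧ ∀ i w, (l.map fun e => 1 + |β w e|).prod * ‖∫ v, cis (β w v) * a i v‖ ≤
      C * c i := by
  have hW : ∀ (k : ℕ) i (v : V), 0 ≤ c i * decay v := fun k i v =>
    mul_nonneg (hc i) (decay_pos v).le
  have hint : ∀ {b : ι → V → ℂ}, IsAmp hz (fun _ i v => c i * decay v) b → ∀ i,
      Integrable (b i) := by
    intro b hb i
    obtain ⟨C, hC, h⟩ := hb.bound hW
    exact integrable_of_decay (hb.smooth i).continuous (C := C * c i) fun v => by
      rw [mul_assoc]; exact h i v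
  induction l generalizing a with
  | nil =>
    obtain ⟨C, hC, h⟩ := ha.bound hW
    refine ⟨C * ∫ v : V, decay v, mul_nonneg hC (integral_nonneg fun v => (decay_pos v).le),
      fun i w => ?_⟩
    simp only [List.map_nil, List.prod_nil, one_mul]
    refine (norm_integral_le_of_norm_le ((integrable_decay (Q := V)).const_mul (C * c i))
      (Eventually.of_forall fun v => ?_)).trans (le_of_eq ?_)
    · rw [norm_mul, norm_cis, one_mul, mul_assoc]
      exact h i v
    · rw [integral_const_mul]; ring
  | cons e l ih =>
    obtain ⟨C, hC, h⟩ := ih (ha.sub (ha.deriv e) hW)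
    refine ⟨2 * C, by positivity, fun i w => ?_⟩
    have h1 := h i w
    rw [← integral_cis_clm_mul (ha.smooth i) e (hint ha i) (hint (ha.deriv e) i), norm_mul] at h1
    have h2 : 1 + |β w e| ≤ 2 * ‖1 + Complex.I * ((β w e : ℝ) : ℂ)‖ := by
      have h3 := Complex.abs_re_le_norm (1 + Complex.I * ((β w e : ℝ) : ℂ))
      have h4 := Complex.abs_im_le_norm (1 + Complex.I * ((β w e : ℝ) : ℂ))
      simp at h3 h4
      linarith
    have h5 : 0 ≤ (l.map fun e => 1 + |β w e|).prod := List.prod_nonneg (by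
      intro x hx
      obtain ⟨y, -, rfl⟩ := List.mem_map.1 hx
      positivity)
    rw [List.map_cons, List.prod_cons]
    calc _ ≤ 2 * ‖1 + Complex.I * ((β w e : ℝ) : ℂ)‖ * (l.map fun e => 1 + |β w e|).prod *
          ‖∫ v, cis (β w v) * a i v‖ := by gcongr
      _ = 2 * ((l.map fun e => 1 + |β w e|).prod * (‖1 + Complex.I * ((β w e : ℝ) : ℂ)‖ *
          ‖∫ v, cis (β w v) * a i v‖)) := by ring
      _ ≤ _ := by linarith

lemma prod_map_rep {l : List V} (K : ℕ) (f : V → ℝ) :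
    ((OscPhase.rep K l).map f).prod = (l.map f).prod ^ K := by
  induction K with
  | zero => simp [OscPhase.rep]
  | succ K ih =>
    simp only [OscPhase.rep, List.replicate_succ, List.flatten_cons, List.map_append,
      List.prod_append] at ih ⊢
    rw [ih, pow_succ']

lemma exists_fourier_decay_pow (β : W → V →L[ℝ] ℝ) {a : ι → V → ℂ} {c : ι → ℝ} {N : W → ℝ}
    (ha : IsAmp hz (fun _ i v => c i * OscPhase.decay v) a) (hc : ∀ i, 0 ≤ c i) (l : List V)
    (hN : ∀ w, 0 < N w) (hl : ∃ C, ∀ w, N w ≤ C * (l.map fun e => 1 + |β w e|).prod) (K : ℕ) :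
    ∃ C, 0 ≤ C ∧ ∀ i w, ‖∫ v, cis (β w v) * a i v‖ ≤ C * (c i * ((N w) ^ K)⁻¹) := by
  obtain ⟨C, hC, h⟩ := exists_fourier_decay β ha hc (OscPhase.rep K l)
  obtain ⟨C', hl⟩ := hl
  refine ⟨|C'| ^ K * C, by positivity, fun i w => ?_⟩
  have h1 := h i w
  rw [prod_map_rep] at h1
  have hN' := hN w
  rw [← mul_assoc, ← div_eq_mul_inv, le_div_iff₀ (by positivity)]
  have h0 : 0 ≤ (l.map fun e => 1 + |β w e|).prod := List.prod_nonneg (by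
    intro x hx
    obtain ⟨y, -, rfl⟩ := List.mem_map.1 hx
    positivity)
  have h2 : N w ^ K ≤ |C'| ^ K * (l.map fun e => 1 + |β w e|).prod ^ K := by
    rw [← mul_pow]
    exact pow_le_pow_left₀ hN'.le ((hl w).trans (mul_le_mul_of_nonneg_right (le_abs_self _) h0)) K
  calc _ ≤ ‖∫ v, cis (β w v) * a i v‖ *
        (|C'| ^ K * (l.map fun e => 1 + |β w e|).prod ^ K) := by gcongr
    _ = |C'| ^ K * ((l.map fun e => 1 + |β w e|).prod ^ K * ‖∫ v, cis (β w v) * a i v‖) := by ring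
    _ ≤ |C'| ^ K * (C * c i) := by gcongr
    _ = _ := by ring

lemma IsAmp.slice {A : Type*} [NormedAddCommGroup A] [NormedSpace ℝ A] {H' : Type*}
    [NormedAddCommGroup H'] [NormedSpace ℝ H'] {hz' : A × V →L[ℝ] H'} {w : A × V → ℝ}
    {u : A × V → ℂ} (h : IsAmp hz' (fun _ (_ : Unit) => w) fun _ => u) :
    IsAmp hz (fun _ q v => w (q, v)) fun q v => u (q, v) := by
  have hs : ∀ {u : A × V → ℂ}, ContDiff ℝ ∞ u → ∀ q, ContDiff ℝ ∞ fun v => u (q, v) :=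
    fun hu q => hu.comp (by fun_prop)
  intro n
  induction n generalizing u with
  | zero =>
    obtain ⟨h1, C, hC⟩ := h 0
    exact ⟨hs (h1 ()), C, fun q v => hC () (q, v)⟩
  | succ n ih =>
    obtain ⟨h1, C, hC⟩ := h 0
    refine ⟨⟨hs (h1 ()), C, fun q v => hC () (q, v)⟩, fun e => ?_⟩
    have h2 := ih (h.deriv (0, e))
    have e1 : (fun q => dirDeriv e fun v => u (q, v)) = fun q v => dirDeriv (0, e) u (q, v) := by
      funext q v
      have h3 : HasFDerivAt (fun v : V => (q, v)) (ContinuousLinearMap.inr ℝ A V) v :=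
        hasFDerivAt_prodMk_right q v
      have h4 := (((h1 ()).differentiable (by simp) (q, v)).hasFDerivAt.comp v h3).fderiv
      have h5 := congrArg (fun L : V →L[ℝ] ℂ => L e) h4
      simpa [dirDeriv, Function.comp_def] using h5
    rw [e1]
    exact h2

end FourierDecay

/-! ### Fourier inversion and the partial Fourier transform in momentum. -/

section FourierInversion

variable {d : ℕ}

open FourierTransform in
-- The inversion theorem without $2\pi$ in the exponent; the dilation by $2\pi$ produces the
-- constant $(2\pi)^d$.
lemma fourier_inversion {v : Conf d → ℂ} (hv : Continuous v) (hi : Integrable v)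
    (hi' : Integrable fun η : Conf d => ∫ x, cis (inner ℝ η x) * v x) (q : Conf d) :
    ∫ η : Conf d, cis (-inner ℝ η q) * ∫ x, cis (inner ℝ η x) * v x =
      (((2 * Real.pi) ^ d : ℝ) : ℂ) * v q := by
  have hπ : (0 : ℝ) < 2 * Real.pi := by positivity
  set Vh : Conf d → ℂ := fun η => ∫ x, cis (inner ℝ η x) * v x with hVh
  have h1 : ∀ w : Conf d, 𝓕⁻ v w = Vh ((2 * Real.pi) • w) := by
    intro w
    rw [Real.fourierInv_eq']
    refine integral_congr_ae (Eventually.of_forall fun x => ?_)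
    simp only [cis, inner_smul_left, smul_eq_mul, real_inner_comm]
    congr 2
    push_cast
    simp
    ring
  have h2 : Integrable (𝓕⁻ v) := by
    rw [show 𝓕⁻ v = fun w => Vh ((2 * Real.pi) • w) from funext h1]
    exact hi'.comp_smul hπ.ne'
  have h3 := congrFun (hv.fourier_fourierInv_eq hi
    (by
      have h4 : Integrable fun w => (𝓕⁻ v) (-w) := h2.comp_neg
      refine h4.congr (Eventually.of_forall fun w => ?_)
      simp only [Real.fourierInv_eq_fourier_neg, neg_neg])) q
  rw [Real.fourier_eq'] at h3
  have h5 := Measure.integral_comp_smul (volume : Measure (Conf d))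
    (fun η : Conf d => cis (-inner ℝ η q) * Vh η) (2 * Real.pi)
  rw [← h3]
  have h6 : ∫ w : Conf d, Complex.exp (((-2 * Real.pi * inner ℝ w q : ℝ) : ℂ) * Complex.I) •
      𝓕⁻ v w = ∫ w : Conf d, cis (-inner ℝ ((2 * Real.pi) • w) q) * Vh ((2 * Real.pi) • w) := by
    refine integral_congr_ae (Eventually.of_forall fun w => ?_)
    simp only [h1, cis, inner_smul_left, smul_eq_mul]
    congr 2
    push_cast
    simp
    ring
  rw [h6, h5, finrank_euclideanSpace_fin, abs_of_pos (by positivity), Complex.real_smul,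
    ← mul_assoc, ← Complex.ofReal_mul, mul_inv_cancel₀ (by positivity), Complex.ofReal_one, one_mul]

/-- The partial Fourier transform in the momentum variable. -/
def partialFourier (u : Phase d → ℂ) (q y : Conf d) : ℂ :=
  ∫ ξ, cis (-inner ℝ y ξ) * u (q, ξ)

open OscPhase in
lemma schwartz_slice_isAmp (u : 𝓢(Phase d, ℂ)) (K : ℕ) :
    IsAmp (0 : Conf d →L[ℝ] Conf d) (fun _ (q : Conf d) ξ => ((1 + ‖q‖) ^ K)⁻¹ * decay ξ)
      fun q ξ => u (q, ξ) := by
  refine ((isAmp_schwartz (ι := Unit) (0 : Phase d →L[ℝ] Conf d) u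
    (K + decayExp (Conf d))).slice).mono (fun _ _ _ => by positivity) fun k => ⟨1, fun q ξ => ?_⟩
  rw [one_mul, decay, ← mul_inv, pow_add]
  gcongr
  · exact norm_fst_le (q, ξ)
  · exact norm_snd_le (q, ξ)

lemma norm_schwartz_le (u : 𝓢(Phase d, ℂ)) (K : ℕ) : ∃ C, 0 ≤ C ∧ ∀ q ξ,
    ‖u (q, ξ)‖ ≤ C * (((1 + ‖q‖) ^ K)⁻¹ * OscPhase.decay ξ) :=
  (schwartz_slice_isAmp u K).bound fun _ _ ξ =>
    mul_nonneg (by positivity) (OscPhase.decay_pos ξ).le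

lemma exists_partialFourier_le (u : 𝓢(Phase d, ℂ)) (K K' : ℕ) : ∃ C, 0 ≤ C ∧ ∀ q y,
    ‖partialFourier u q y‖ ≤ C * (((1 + ‖q‖) ^ K)⁻¹ * ((1 + ‖y‖) ^ K')⁻¹) := by
  obtain ⟨C, hC, h⟩ := one_add_norm_le_prod (d := d) one_pos
  refine exists_fourier_decay_pow (fun y : Conf d => -innerSL ℝ y) (schwartz_slice_isAmp u K)
    (fun q => by positivity) (List.ofFn stdVec) (N := fun y => 1 + ‖y‖) (fun y => by positivity)
    ⟨C, fun y => (h y).trans (le_of_eq ?_)⟩ K'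
  simp [List.map_ofFn, List.prod_ofFn, inner_stdVec]

lemma continuous_partialFourier (u : 𝓢(Phase d, ℂ)) :
    Continuous fun p : Conf d × Conf d => partialFourier u p.1 p.2 := by
  obtain ⟨C, hC, h⟩ := norm_schwartz_le u 0
  refine continuous_of_dominated (F := fun (p : Conf d × Conf d) ξ =>
    cis (-inner ℝ p.2 ξ) * u (p.1, ξ)) (bound := fun ξ => C * OscPhase.decay ξ)
    (fun p => ?_) (fun p => Eventually.of_forall fun ξ => ?_)
    (OscPhase.integrable_decay.const_mul C) (Eventually.of_forall fun ξ => ?_)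
  · exact ((continuous_cis.comp (by fun_prop)).mul
      (u.continuous.comp (by fun_prop))).aestronglyMeasurable
  · rw [norm_mul, norm_cis, one_mul]
    simpa using h p.1 ξ
  · exact (continuous_cis.comp (by fun_prop)).mul (u.continuous.comp (by fun_prop))

lemma exists_sympFourier_le (u : 𝓢(Phase d, ℂ)) (K : ℕ) : ∃ C, 0 ≤ C ∧ ∀ Y,
    ‖sympFourier u Y‖ ≤ C * ((1 + ‖Y‖) ^ K)⁻¹ := by
  obtain ⟨C, hC, h⟩ := one_add_norm_le_prod (d := d) one_pos
  have hu := isAmp_schwartz (ι := Unit) (0 : Phase d →L[ℝ] Conf d) u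
    (OscPhase.decayExp (Phase d))
  obtain ⟨C', hC', h'⟩ := exists_fourier_decay_pow (fun Y : Phase d => sympL d Y)
    (c := fun _ : Unit => (1 : ℝ)) (by simpa [OscPhase.decay] using hu)
    (fun _ => zero_le_one) (List.ofFn posDir ++ List.ofFn momDir)
    (N := fun Y => 1 + ‖Y‖) (fun Y => by positivity)
    ⟨C * C, fun Y => by
      refine (one_add_norm_prod_le Y).trans ?_
      refine (mul_le_mul (h _) (h _) (by positivity)
        (mul_nonneg hC (Finset.prod_nonneg fun _ _ => by positivity))).trans (le_of_eq ?_)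
      simp [List.map_ofFn, List.prod_ofFn, symp, posDir, momDir, Function.comp_def, inner_stdVec]
      ring⟩ K
  refine ⟨‖((((2 * Real.pi) ^ d : ℝ) : ℂ))⁻¹‖ * C', by positivity, fun Y => ?_⟩
  rw [sympFourier, norm_mul, mul_assoc]
  gcongr
  simpa using h' () Y

lemma continuous_symp {α : Type*} [TopologicalSpace α] {f g : α → Phase d} (hf : Continuous f)
    (hg : Continuous g) : Continuous fun a => symp (f a) (g a) := by
  unfold symp
  fun_prop

lemma continuous_sympFourier (u : 𝓢(Phase d, ℂ)) : Continuous (sympFourier u) := by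
  refine continuous_const.mul (continuous_of_dominated (bound := fun X => ‖u X‖) (fun Y => ?_)
    (fun Y => Eventually.of_forall fun X => ?_) (SchwartzMap.integrable u).norm
    (Eventually.of_forall fun X => ?_))
  · exact ((continuous_cis.comp (continuous_symp continuous_const continuous_id)).mul
      u.continuous).aestronglyMeasurable
  · rw [norm_mul, norm_cis, one_mul]
  · exact (continuous_cis.comp (continuous_symp continuous_id continuous_const)).mul
      continuous_const

lemma integrable_sympFourier (u : 𝓢(Phase d, ℂ)) : Integrable (sympFourier u) := by
  obtain ⟨C, -, h⟩ := exists_sympFourier_le u (OscPhase.decayExp (Phase d))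
  exact OscPhase.integrable_of_decay (continuous_sympFourier u) h

lemma sympFourier_eq (u : 𝓢(Phase d, ℂ)) (y η : Conf d) :
    ∫ x, cis (inner ℝ η x) * partialFourier u x y =
      (((2 * Real.pi) ^ d : ℝ) : ℂ) * sympFourier u (y, η) := by
  have hne : (((2 * Real.pi) ^ d : ℝ) : ℂ) ≠ 0 := by
    have : (2 * Real.pi) ^ d ≠ 0 := by positivity
    exact_mod_cast this
  rw [sympFourier, mul_inv_cancel_left₀ hne]
  have hi : Integrable (fun X : Phase d => cis (symp (y, η) X) * u X) :=
    integrable_cis_mul (continuous_symp continuous_const continuous_id) (SchwartzMap.integrable u)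
  refine Eq.trans ?_ (integral_prod _ hi).symm
  refine integral_congr_ae (Eventually.of_forall fun x => ?_)
  simp only [partialFourier]
  rw [← integral_const_mul]
  refine integral_congr_ae (Eventually.of_forall fun ξ => ?_)
  simp only [symp, sub_eq_add_neg, cis_add, mul_assoc]

/-- At $(y,\eta)$ the symplectic transform is, up to $(2\pi)^{-d}$, the Fourier transform in
position of the partial transform at $y$. Inverting in $\eta$ therefore leaves the partial
transform. -/
lemma integral_sympFourier (u : 𝓢(Phase d, ℂ)) (q y : Conf d) :
    ∫ η, cis (-inner ℝ η q) * sympFourier u (y, η) = partialFourier u q y := by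
  have hne : (((2 * Real.pi) ^ d : ℝ) : ℂ) ≠ 0 := by
    have : (2 * Real.pi) ^ d ≠ 0 := by positivity
    exact_mod_cast this
  have hc : Continuous fun x => partialFourier u x y := by
    simpa only [Function.comp_def] using
      (continuous_partialFourier u).comp (by fun_prop : Continuous fun x : Conf d => (x, y))
  have hi : Integrable fun x => partialFourier u x y := by
    obtain ⟨C, -, h⟩ := exists_partialFourier_le u (OscPhase.decayExp (Conf d)) 0
    exact OscPhase.integrable_of_decay hc fun x => by
      simpa [OscPhase.decay] using h x y
  have hi' : Integrable fun η => sympFourier u (y, η) := by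
    obtain ⟨C, hC, h⟩ := exists_sympFourier_le u (OscPhase.decayExp (Conf d))
    refine OscPhase.integrable_of_decay ((continuous_sympFourier u).comp
      (by fun_prop : Continuous fun η : Conf d => (y, η))) (C := C) fun η => (h _).trans ?_
    unfold OscPhase.decay
    gcongr
    exact norm_snd_le (y, η)
  have hV : (fun η => ∫ x, cis (inner ℝ η x) * partialFourier u x y) =
      fun η => (((2 * Real.pi) ^ d : ℝ) : ℂ) * sympFourier u (y, η) :=
    funext fun η => sympFourier_eq u y η
  have h := fourier_inversion hc hi (by rw [hV]; exact hi'.const_mul _) q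
  refine mul_left_cancel₀ hne (Eq.trans ?_ h)
  rw [← integral_const_mul]
  refine integral_congr_ae (Eventually.of_forall fun η => ?_)
  beta_reduce
  rw [sympFourier_eq u y η]
  ring

end FourierInversion

/-! ### The first integral formula. -/

section ProductOfSchwartz

variable {d : ℕ} {ε lam : ℝ} {B : Fin d → Fin d → Conf d → ℝ}

lemma measurePreserving_prodProdProdComm : MeasurePreserving
    (fun p : (Conf d × Conf d) × (Conf d × Conf d) => ((p.1.1, p.2.1), (p.1.2, p.2.2))) := by
  have hid : MeasurePreserving (id : Conf d → Conf d) := MeasurePreserving.id _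
  have hswap : MeasurePreserving (Prod.swap : Conf d × Conf d → Conf d × Conf d) :=
    Measure.measurePreserving_swap
  have ha : ∀ {α β γ : Type} [MeasureSpace α] [MeasureSpace β] [MeasureSpace γ]
      [SFinite (volume : Measure α)] [SFinite (volume : Measure β)]
      [SFinite (volume : Measure γ)],
      MeasurePreserving (MeasurableEquiv.prodAssoc : (α × β) × γ ≃ᵐ α × β × γ) :=
    fun {α β γ} _ _ _ _ _ _ => measurePreserving_prodAssoc volume volume volume
  have h1 := ha (α := Conf d) (β := Conf d) (γ := Conf d × Conf d)
  have h2 := hid.prod (ha (α := Conf d) (β := Conf d) (γ := Conf d)).symm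
  have h3 := hid.prod (hswap.prod hid)
  have h4 := hid.prod (ha (α := Conf d) (β := Conf d) (γ := Conf d))
  have h5 := (ha (α := Conf d) (β := Conf d) (γ := Conf d × Conf d)).symm
  exact h5.comp (h4.comp (h3.comp (h2.comp h1)))

lemma integral_prodProdProdComm {F : Phase d × Phase d → ℂ} (hF : Integrable F) :
    ∫ P, F P = ∫ p : Conf d × Conf d, ∫ r : Conf d × Conf d, F ((p.1, r.1), (p.2, r.2)) := by
  have he : MeasurableEmbedding (fun p : (Conf d × Conf d) × (Conf d × Conf d) =>
      ((p.1.1, p.2.1), (p.1.2, p.2.2))) :=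
    (Homeomorph.prodProdProdComm (Conf d) (Conf d) (Conf d) (Conf d)).measurableEmbedding
  have hm := measurePreserving_prodProdProdComm (d := d)
  have hi : Integrable (fun p : (Conf d × Conf d) × (Conf d × Conf d) =>
      F ((p.1.1, p.2.1), (p.1.2, p.2.2))) := (hm.integrable_comp_emb he).2 hF
  rw [← hm.integral_comp he F]
  exact integral_prod _ hi

lemma norm_fluxExp (x y z : Conf d) : ‖fluxExp ε lam B x y z‖ = 1 := norm_cis _

lemma continuous_fluxExp (hB : ∀ l j, IsBCInfty (B l j)) (ε lam : ℝ) {α : Type*}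
    [TopologicalSpace α] {a b c : α → Conf d} (ha : Continuous a) (hb : Continuous b)
    (hc : Continuous c) : Continuous fun t => fluxExp ε lam B (a t) (b t) (c t) := by
  set p0 : Conf d × Conf d × Conf d →L[ℝ] Conf d := ContinuousLinearMap.fst ℝ _ _
  set p1 : Conf d × Conf d × Conf d →L[ℝ] Conf d :=
    (ContinuousLinearMap.fst ℝ _ _).comp (ContinuousLinearMap.snd ℝ _ _)
  set p2 : Conf d × Conf d × Conf d →L[ℝ] Conf d :=
    (ContinuousLinearMap.snd ℝ _ _).comp (ContinuousLinearMap.snd ℝ _ _)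
  have hb' : ∀ T : Conf d × Conf d × Conf d →L[ℝ] Conf d, ∃ C, ∀ p, ‖T p‖ ≤ C * (1 + ‖p‖) :=
    fun T => ⟨‖T‖, fun p => (T.le_opNorm _).trans (by
        have := norm_nonneg T
        nlinarith [norm_nonneg p])⟩
  have h := ((isAmp_fluxExp hB ε lam p0 (p1 - p0) (p2 - p0) (g := fun p => 1 + ‖p‖)
    (fun p => one_le_one_add_norm _) (hb' _) (hb' _)).smooth ()).continuous
  have h2 := h.comp (ha.prodMk (hb.prodMk hc))
  simpa [Function.comp_def, p0, p1, p2] using h2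

lemma measurePreserving_neg_swap :
    MeasurePreserving (fun p : Conf d × Conf d => (-p.2, p.1)) := by
  have hid : MeasurePreserving (id : Conf d → Conf d) := MeasurePreserving.id _
  have hneg : MeasurePreserving (fun x : Conf d => -x) := Measure.measurePreserving_neg _
  exact (hneg.prod hid).comp (Measure.measurePreserving_swap (μ := (volume : Measure (Conf d)))
    (ν := (volume : Measure (Conf d))))

lemma integral_comp_rotate (G : Conf d × Conf d → ℂ) {c : ℝ} (hc : 0 < c) :
    ∫ p : Conf d × Conf d, G (-(c • p.2), c • p.1) = (((c ^ (2 * d))⁻¹ : ℝ) : ℂ) * ∫ p, G p := by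
  have he : MeasurableEmbedding (fun p : Conf d × Conf d => (-p.2, p.1)) :=
    (((Homeomorph.prodComm (Conf d) (Conf d)).trans
      ((Homeomorph.neg (Conf d)).prodCongr (Homeomorph.refl (Conf d))))).measurableEmbedding
  have h := Measure.integral_comp_smul (volume : Measure (Conf d × Conf d))
    (fun p => G (-p.2, p.1)) c
  rw [measurePreserving_neg_swap.integral_comp he G] at h
  refine h.trans ?_
  rw [Module.finrank_prod, finrank_euclideanSpace_fin, ← two_mul, abs_of_pos (by positivity),
    Complex.real_smul]

lemma integral_translate_partialFourier (u : Phase d → ℂ) (q ξ y : Conf d) :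
    ∫ η, cis (-inner ℝ y η) * u (q, ξ + η) = cis (inner ℝ y ξ) * partialFourier u q y := by
  rw [partialFourier, ← integral_add_left_eq_self (fun η => cis (-inner ℝ y η) * u (q, η)) ξ,
    ← integral_const_mul]
  refine integral_congr_ae (Eventually.of_forall fun η => ?_)
  beta_reduce
  rw [← mul_assoc, ← cis_add, inner_add_right]
  congr 2
  ring

/-- The magnetic Weyl product of Schwartz functions in terms of partial Fourier transforms. -/
lemma weylProd_eq_partialFourier (hB : ∀ l j, IsBCInfty (B l j)) (hε : 0 < ε) (lam : ℝ)
    (u v : 𝓢(Phase d, ℂ)) (X : Phase d) :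
    (((2 * Real.pi) ^ (2 * d) : ℝ) : ℂ) * weylProd hε lam B u v X = ∫ p : Conf d × Conf d,
      fluxExp ε lam B (X.1 - (ε / 2) • (p.1 + p.2)) (X.1 + (ε / 2) • (p.1 - p.2))
        (X.1 + (ε / 2) • (p.1 + p.2)) * cis (inner ℝ (p.1 + p.2) X.2) *
        (partialFourier u (X.1 - (ε / 2) • p.2) p.1 *
          partialFourier v (X.1 + (ε / 2) • p.1) p.2) := by
  obtain ⟨hi, he⟩ := weylProd_eq_integral hB hε lam u v X
  set G : Conf d × Conf d → ℂ := fun p =>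
    fluxExp ε lam B (X.1 + p.1 - p.2) (X.1 + p.1 + p.2) (X.1 - p.1 + p.2) *
      cis (inner ℝ ((2 / ε) • (p.2 - p.1)) X.2) *
        (partialFourier u (X.1 + p.1) ((2 / ε) • p.2) *
          partialFourier v (X.1 + p.2) (-((2 / ε) • p.1))) with hG
  -- For fixed positions the flux is constant and the phase is linear in each momentum, so the
  -- momentum integrals separate into two partial Fourier transforms.
  have h1 : ∫ q, cis ((productPhase d hε).Φ q) * prodAmp ε lam B u v (X, q) = ∫ p, G p := by
    rw [integral_prodProdProdComm hi]
    refine integral_congr_ae (Eventually.of_forall fun p => ?_)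
    have h2 : ∀ r : Conf d × Conf d,
        cis ((productPhase d hε).Φ ((p.1, r.1), (p.2, r.2))) *
          prodAmp ε lam B u v (X, ((p.1, r.1), (p.2, r.2))) =
        fluxExp ε lam B (X.1 + p.1 - p.2) (X.1 + p.1 + p.2) (X.1 - p.1 + p.2) *
          ((cis (-inner ℝ ((2 / ε) • p.2) r.1) * u (X.1 + p.1, X.2 + r.1)) *
          (cis (-inner ℝ (-((2 / ε) • p.1)) r.2) * v (X.1 + p.2, X.2 + r.2))) := by
      intro r
      have h3 : cis ((productPhase d hε).Φ ((p.1, r.1), (p.2, r.2))) =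
          cis (-inner ℝ ((2 / ε) • p.2) r.1) * cis (-inner ℝ (-((2 / ε) • p.1)) r.2) := by
        rw [← cis_add]
        congr 1
        simp only [productPhase, symp, inner_smul_left, inner_neg_left, real_inner_comm]
        simp
        ring
      rw [h3]
      have e1 : X + (p.1, r.1) = (X.1 + p.1, X.2 + r.1) := rfl
      have e2 : X + (p.2, r.2) = (X.1 + p.2, X.2 + r.2) := rfl
      simp only [prodAmp, e1, e2]
      ring
    simp only [h2]
    rw [integral_const_mul]
    have h4 := integral_prod_mul (μ := (volume : Measure (Conf d)))
      (ν := (volume : Measure (Conf d)))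
      (fun η => cis (-inner ℝ ((2 / ε) • p.2) η) * u (X.1 + p.1, X.2 + η))
      (fun ζ => cis (-inner ℝ (-((2 / ε) • p.1)) ζ) * v (X.1 + p.2, X.2 + ζ))
    rw [← Measure.volume_eq_prod] at h4
    rw [h4, integral_translate_partialFourier, integral_translate_partialFourier]
    simp only [hG]
    have h5 : cis (inner ℝ ((2 / ε) • (p.2 - p.1)) X.2) = cis (inner ℝ ((2 / ε) • p.2) X.2) *
        cis (inner ℝ (-((2 / ε) • p.1)) X.2) := by
      rw [← cis_add, ← inner_add_left]
      congr 2
      module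
    rw [h5]
    ring
  have h6 := integral_comp_rotate G (c := ε / 2) (by positivity)
  have hπ : Real.pi ≠ 0 := Real.pi_ne_zero
  rw [he, h1, ← mul_assoc, ← Complex.ofReal_inv, ← Complex.ofReal_mul]
  -- The normalizations of the two formulas differ exactly by the Jacobian of
  -- $(y,z)\mapsto(-\frac\varepsilon2z,\frac\varepsilon2y)$, which makes $y$ and $z$ the frequencies
  -- of the partial transforms.
  have h7 : (2 * Real.pi) ^ (2 * d) * ((Real.pi * ε) ^ (2 * d))⁻¹ = ((ε / 2) ^ (2 * d))⁻¹ := by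
    rw [← inv_pow, ← inv_pow, ← mul_pow]
    congr 1
    field_simp
  rw [h7, ← h6]
  refine integral_congr_ae (Eventually.of_forall fun p => ?_)
  have hε' : (2 / ε) * (ε / 2) = 1 := by field_simp
  simp only [hG, smul_neg, smul_sub, smul_smul, hε', one_smul, neg_neg, sub_neg_eq_add]
  congr 1
  congr 1
  congr 1 <;> module

/-- The term $\frac\varepsilon2\sigma(Y,Z)$ only displaces the base points: to
$x-\frac\varepsilon2z$ for $\eta$ and to $x+\frac\varepsilon2y$ for $\zeta$. The integrals over
$\eta$ and $\zeta$ then decouple. -/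
lemma productKernel_mul_eq (u v : Phase d → ℂ) (X : Phase d) (y η z ζ : Conf d) :
    productKernel ε lam B X (y, η) (z, ζ) * u (y, η) * v (z, ζ) =
      fluxExp ε lam B (X.1 - (ε / 2) • (y + z)) (X.1 + (ε / 2) • (y - z))
        (X.1 + (ε / 2) • (y + z)) * cis (inner ℝ (y + z) X.2) *
        ((cis (-inner ℝ η (X.1 - (ε / 2) • z)) * u (y, η)) *
          (cis (-inner ℝ ζ (X.1 + (ε / 2) • y)) * v (z, ζ))) := by
  have h : cis (symp X ((y, η) + (z, ζ))) * cis (ε / 2 * symp (y, η) (z, ζ)) =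
      cis (inner ℝ (y + z) X.2) * (cis (-inner ℝ η (X.1 - (ε / 2) • z)) *
        cis (-inner ℝ ζ (X.1 + (ε / 2) • y))) := by
    simp only [← cis_add]
    congr 1
    simp only [symp, Prod.mk_add_mk, inner_add_right, inner_sub_right,
      inner_smul_right, real_inner_comm X.2, real_inner_comm X.1, real_inner_comm y ζ]
    ring
  simp only [productKernel]
  rw [h]
  ring

lemma integrable_productKernel_mul (hB : ∀ l j, IsBCInfty (B l j)) (ε lam : ℝ)
    (u v : 𝓢(Phase d, ℂ)) (X : Phase d) : Integrable fun P : Phase d × Phase d =>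
      productKernel ε lam B X P.1 P.2 * sympFourier u P.1 * sympFourier v P.2 := by
  have h := (integrable_sympFourier u).mul_prod (integrable_sympFourier v)
  rw [← Measure.volume_eq_prod] at h
  simp only [mul_assoc]
  refine h.bdd_mul (c := 1) (Continuous.aestronglyMeasurable ?_) (Eventually.of_forall fun P => ?_)
  · unfold productKernel
    refine ((continuous_cis.comp (continuous_symp continuous_const (by fun_prop))).mul
      (continuous_cis.comp (continuous_const.mul (continuous_symp continuous_fst
        continuous_snd)))).mul (continuous_fluxExp hB ε lam ?_ ?_ ?_) <;> fun_prop
  · simp [productKernel, norm_cis, norm_fluxExp]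

/-- The first integral formula for the magnetic Weyl product of Schwartz functions. -/
lemma integral_productKernel (hB : ∀ l j, IsBCInfty (B l j)) (hε : 0 < ε) (lam : ℝ)
    (u v : 𝓢(Phase d, ℂ)) (X : Phase d) : ∫ P : Phase d × Phase d,
      productKernel ε lam B X P.1 P.2 * sympFourier u P.1 * sympFourier v P.2 =
      (((2 * Real.pi) ^ (2 * d) : ℝ) : ℂ) * weylProd hε lam B u v X := by
  rw [weylProd_eq_partialFourier hB hε lam u v X,
    integral_prodProdProdComm (integrable_productKernel_mul hB ε lam u v X)]
  refine integral_congr_ae (Eventually.of_forall fun p => ?_)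
  simp only [productKernel_mul_eq]
  rw [integral_const_mul]
  have h4 := integral_prod_mul (μ := (volume : Measure (Conf d)))
    (ν := (volume : Measure (Conf d)))
    (fun η => cis (-inner ℝ η (X.1 - (ε / 2) • p.2)) * sympFourier u (p.1, η))
    (fun ζ => cis (-inner ℝ ζ (X.1 + (ε / 2) • p.1)) * sympFourier v (p.2, ζ))
  rw [← Measure.volume_eq_prod] at h4
  rw [h4, integral_sympFourier, integral_sympFourier]

/-- The first integral formula for the magnetic Weyl product. -/
lemma hasFourierOscIntegral₂_productKernel (hB : ∀ l j, IsBCInfty (B l j)) (hε : 0 < ε) (lam : ℝ)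
    {f g : Phase d → ℂ} {M₁ M₂ : ℕ}
    (hf : IsAmp (ContinuousLinearMap.id ℝ _) (fun _ (_ : Unit) X => (1 + ‖X‖) ^ M₁) fun _ => f)
    (hg : IsAmp (ContinuousLinearMap.id ℝ _) (fun _ (_ : Unit) X => (1 + ‖X‖) ^ M₂) fun _ => g)
    (X : Phase d) : HasFourierOscIntegral₂ (productKernel ε lam B X) f g
      ((((2 * Real.pi) ^ (2 * d) : ℝ) : ℂ) * weylProd hε lam B f g X) := by
  intro χ₁ χ₂ h₁ h₂
  refine ⟨fun δ hδ => ?_, ?_⟩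
  · obtain ⟨u, hu⟩ := exists_schwartz_regularize hf χ₁ hδ
    obtain ⟨v, hv⟩ := exists_schwartz_regularize hg χ₂ hδ
    rw [← hu, ← hv]
    exact integrable_productKernel_mul hB ε lam u v X
  · have h := (tendsto_of_isAmp_sub (b := fun δ X =>
      weylProd hε lam B (regularize χ₁ δ f) (regularize χ₂ δ g) X) (fun _ => by positivity)
      (isAmp_weylProd_regularize_sub hB hε lam hf hg h₁ h₂) X).const_mul
      ((((2 * Real.pi) ^ (2 * d) : ℝ) : ℂ))
    refine h.congr' ?_
    filter_upwards [self_mem_nhdsWithin] with δ hδ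
    obtain ⟨u, hu⟩ := exists_schwartz_regularize hf χ₁ hδ
    obtain ⟨v, hv⟩ := exists_schwartz_regularize hg χ₂ hδ
    rw [← hu, ← hv]
    exact (integral_productKernel hB hε lam u v X).symm

end ProductOfSchwartz

/-! ### The amplitude of the magnetic Weyl quantization. -/

section Quantization

variable {d : ℕ} {ε lam : ℝ} {A : Fin d → Conf d → ℝ} {ι : Type*}

/-- The pairing of positions and momenta as a bilinear form on phase space. -/
def pairing (d : ℕ) : Phase d →L[ℝ] Phase d →L[ℝ] ℝ :=
  (innerSL ℝ).bilinearComp (ContinuousLinearMap.fst ℝ (Conf d) (Conf d))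
    (ContinuousLinearMap.snd ℝ (Conf d) (Conf d))

@[simp] lemma pairing_apply (X Y : Phase d) : pairing d X Y = inner ℝ X.1 Y.2 := by
  simp [pairing]

/-- The symmetric bilinear form of the phase of the magnetic Weyl quantization. -/
def quantForm (d : ℕ) : Phase d →L[ℝ] Phase d →L[ℝ] ℝ :=
  (-1 : ℝ) • (pairing d + (pairing d).flip)

lemma quantForm_apply (X Y : Phase d) :
    quantForm d X Y = -(inner ℝ X.1 Y.2 + inner ℝ Y.1 X.2) := by
  have h : quantForm d X Y = (-1 : ℝ) * (pairing d X Y + pairing d Y X) := rfl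
  rw [h, pairing_apply, pairing_apply]
  ring

/-- The phase `-y · ξ` of the magnetic Weyl quantization. -/
def quantPhase (d : ℕ) : OscPhase (Phase d) (Conf d) (Conf d) where
  Φ q := -inner ℝ q.1 q.2
  L := quantForm d
  hasFDerivAt q := by
    have h := (hasFDerivAt_quadratic (pairing d) q).const_smul (-1 : ℝ)
    refine (h.congr_of_eventuallyEq (Eventually.of_forall fun q => ?_))
    simp
  πu := ContinuousLinearMap.fst ℝ (Conf d) (Conf d)
  πv := ContinuousLinearMap.snd ℝ (Conf d) (Conf d)
  dA := List.ofFn posDir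
  dB := List.ofFn momDir
  isotropic q hq := by
    simp only [List.mem_append, List.mem_ofFn] at hq
    rcases hq with ⟨l, rfl⟩ | ⟨l, rfl⟩ <;>
      simp [quantForm_apply, posDir, momDir]
  vertical q hq := by
    simp only [List.mem_ofFn] at hq
    obtain ⟨l, rfl⟩ := hq
    simp [momDir]
  boundA := by
    obtain ⟨C, hC, h⟩ := one_add_norm_le_prod (d := d) one_pos
    refine ⟨C, fun q => (h _).trans (le_of_eq ?_)⟩
    simp [List.map_ofFn, List.prod_ofFn, posDir, Function.comp_def, inner_stdVec_left,
      quantForm_apply]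
  boundB := by
    obtain ⟨C, hC, h⟩ := one_add_norm_le_prod (d := d) one_pos
    refine ⟨C, fun q => (h _).trans (le_of_eq ?_)⟩
    simp [List.map_ofFn, List.prod_ofFn, momDir, Function.comp_def, inner_stdVec,
      quantForm_apply]
  boundQ := ⟨1, fun q => by rw [one_mul]; exact one_add_norm_prod_le q⟩

/-- The magnetic phase factor of the segment from `ε x` to `ε (x + y)`. -/
def transport (ε lam : ℝ) (A : Fin d → Conf d → ℝ) (x y : Conf d) : ℂ :=
  cis (-(lam * scaledCirculation ε A x (x + y)))

/-- The amplitude of the magnetic Weyl quantization. -/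
def quantAmp (ε lam : ℝ) (A : Fin d → Conf d → ℝ) (f : Phase d → ℂ) (φ : Conf d → ℂ)
    (p : Conf d × Phase d) : ℂ :=
  transport ε lam A p.1 p.2.1 *
    (f (ε • (p.1 + (2 : ℝ)⁻¹ • p.2.1), p.2.2) * φ (p.1 + p.2.1))

/-- The magnetic Weyl quantization of `f`, as an oscillatory integral. -/
def quantFun (ε lam : ℝ) (A : Fin d → Conf d → ℝ) (f : Phase d → ℂ) (φ : Conf d → ℂ)
    (x : Conf d) : ℂ :=
  ((((2 * Real.pi) ^ d : ℝ) : ℂ))⁻¹ * (quantPhase d).osc (quantAmp ε lam A f φ) x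

lemma isAmp_transport (hA : ∀ l, (A l).HasTemperateGrowth) (ε lam : ℝ) :
    ∃ n : ℕ → ℕ, Monotone n ∧ IsAmp (ContinuousLinearMap.id ℝ (Conf d × Conf d))
      (fun k (_ : Unit) p => (1 + ‖p‖) ^ n k) fun _ p => transport ε lam A p.1 p.2 := by
  obtain ⟨N, hN, h⟩ := isAmp_circulation hA (ε • ContinuousLinearMap.fst ℝ (Conf d) (Conf d))
    (ε • ContinuousLinearMap.snd ℝ (Conf d) (Conf d))
  -- At order `k` the exponential contributes at most `k` factors, each a derivative of the
  -- circulation of growth at most `N k`.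
  have hn : Monotone fun k => k * N k := fun k l hkl => Nat.mul_le_mul hkl (hN hkl)
  refine ⟨_, hn, ?_⟩
  have h' := h.smul (-(lam * ε⁻¹ : ℝ) : ℂ) (fun k i p => by positivity)
  have h2 : IsAmp (ContinuousLinearMap.id ℝ (Conf d × Conf d))
      (fun k (_ : Unit) p => (1 + ‖p‖) ^ N k)
      fun _ p => ((-(lam * scaledCirculation ε A p.1 (p.1 + p.2)) : ℝ) : ℂ) := by
    convert h' using 3 with i p
    simp only [scaledCirculation, smul_add]
    push_cast
    simp [mul_assoc]
  refine isAmp_cis h2 (fun _ _ _ => by positivity) (fun _ _ _ => by positivity)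
    (fun i p => by simp) fun j k => ⟨1, fun i p => ?_⟩
  rw [one_mul, ← pow_add]
  refine pow_le_pow_right₀ (one_le_one_add_norm p) ?_
  have h3 := hN (show j + 1 ≤ j + k + 1 by omega)
  have h4 := hN (show k ≤ j + k + 1 by omega)
  nlinarith

lemma continuous_transport (hA : ∀ l, (A l).HasTemperateGrowth) (ε lam : ℝ) :
    Continuous fun p : Conf d × Conf d => transport ε lam A p.1 p.2 := by
  obtain ⟨n, -, h⟩ := isAmp_transport hA ε lam
  exact (h.smooth ()).continuous

lemma norm_transport (x y : Conf d) : ‖transport ε lam A x y‖ = 1 := norm_cis _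

lemma isAmp_transport_pullback (hA : ∀ l, (A l).HasTemperateGrowth) (ε lam : ℝ) (ι : Type*) :
    ∃ n : ℕ → ℕ, Monotone n ∧ IsAmp ((quantPhase d).hz (Conf d))
      (fun k (_ : ι) p => ((1 + ‖p.1‖) * (1 + ‖p.2.1‖)) ^ n k)
      fun _ p => transport ε lam A p.1 p.2.1 := by
  obtain ⟨n, hn, h⟩ := isAmp_transport hA ε lam
  refine ⟨n, hn, ?_⟩
  have h2 := (h.comp_clm (hz' := (quantPhase d).hz (Conf d))
    ((ContinuousLinearMap.fst ℝ (Conf d) (Phase d)).prod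
      ((ContinuousLinearMap.fst ℝ (Conf d) (Conf d)).comp
        (ContinuousLinearMap.snd ℝ (Conf d) (Phase d))))
    (fun e he => he) (fun _ _ _ => by positivity)
    (fun i p => fun k l hkl => pow_le_pow_right₀ (one_le_one_add_norm _) (hn hkl))).reindex
    fun _ : ι => ()
  refine h2.mono (fun _ _ _ => by positivity) fun k => ⟨1, fun i p => ?_⟩
  rw [one_mul]
  gcongr
  exact one_add_norm_prod_le (p.1, p.2.1)

/-- A norm on Schwartz functions. -/
def schwartzNorm (K k : ℕ) (φ : 𝓢(Conf d, ℂ)) : ℝ :=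
  2 ^ K * (Finset.Iic (K, k)).sup (schwartzSeminormFamily ℂ (Conf d) ℂ) φ

lemma schwartzNorm_nonneg (K k : ℕ) (φ : 𝓢(Conf d, ℂ)) : 0 ≤ schwartzNorm K k φ :=
  mul_nonneg (by positivity) (apply_nonneg _ _)

lemma schwartzNorm_mono {K K' k k' : ℕ} (hK : K ≤ K') (hk : k ≤ k') (φ : 𝓢(Conf d, ℂ)) :
    schwartzNorm K k φ ≤ schwartzNorm K' k' φ := by
  have h : (Finset.Iic (K, k)).sup (schwartzSeminormFamily ℂ (Conf d) ℂ) ≤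
      (Finset.Iic (K', k')).sup (schwartzSeminormFamily ℂ (Conf d) ℂ) :=
    Finset.sup_mono (Finset.Iic_subset_Iic.2 ⟨hK, hk⟩)
  exact mul_le_mul (pow_le_pow_right₀ one_le_two hK) (h φ) (apply_nonneg _ _) (by positivity)

lemma schwartzNorm_le_of_forall {K k : ℕ} {φ : 𝓢(Conf d, ℂ)} {C : ℝ} (hC : 0 ≤ C)
    (h : ∀ n ≤ k, ∀ x, (1 + ‖x‖) ^ K * ‖iteratedFDeriv ℝ n φ x‖ ≤ C) :
    schwartzNorm K k φ ≤ 2 ^ K * C := by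
  refine mul_le_mul_of_nonneg_left (Seminorm.finset_sup_apply_le hC fun i hi => ?_)
    (by positivity)
  have hi' := Finset.mem_Iic.1 hi
  refine SchwartzMap.seminorm_le_bound ℂ _ _ _ hC fun x => ?_
  refine le_trans ?_ (h i.2 hi'.2 x)
  gcongr
  calc ‖x‖ ^ i.1 ≤ (1 + ‖x‖) ^ i.1 := by gcongr; linarith
    _ ≤ (1 + ‖x‖) ^ K := pow_le_pow_right₀ (one_le_one_add_norm x) hi'.1

lemma isAmp_schwartz_family (K : ℕ) : IsAmp (ContinuousLinearMap.id ℝ (Conf d))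
    (fun k (φ : 𝓢(Conf d, ℂ)) x => schwartzNorm K k φ * ((1 + ‖x‖) ^ K)⁻¹)
    fun φ => φ := by
  refine isAmpN_of_iteratedFDeriv (fun φ => φ.smooth ⊤)
    (fun k φ x => mul_nonneg (schwartzNorm_nonneg _ _ _) (by positivity))
    fun k => ⟨1, fun φ x => ?_⟩
  rw [one_mul, ← div_eq_mul_inv, le_div_iff₀ (by positivity), mul_comm]
  exact SchwartzMap.one_add_le_sup_seminorm_apply (𝕜 := ℂ) (m := (K, k)) le_rfl le_rfl φ x

/-- The point at which the symbol is evaluated in the quantization, as a linear map. -/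
def midpointMap (d : ℕ) (ε : ℝ) : Conf d × Phase d →L[ℝ] Phase d :=
  (ε • (ContinuousLinearMap.fst ℝ (Conf d) (Phase d) + (2 : ℝ)⁻¹ •
    (ContinuousLinearMap.fst ℝ (Conf d) (Conf d)).comp
      (ContinuousLinearMap.snd ℝ (Conf d) (Phase d)))).prod
    ((ContinuousLinearMap.snd ℝ (Conf d) (Conf d)).comp
      (ContinuousLinearMap.snd ℝ (Conf d) (Phase d)))

lemma midpointMap_apply (p : Conf d × Phase d) :
    midpointMap d ε p = (ε • (p.1 + (2 : ℝ)⁻¹ • p.2.1), p.2.2) := by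
  simp [midpointMap]

lemma one_add_norm_triple_le (p : Conf d × Phase d) :
    1 + ‖p‖ ≤ (1 + ‖p.1‖) * (1 + ‖p.2.1‖) * (1 + ‖p.2.2‖) := by
  refine (one_add_norm_prod_le p).trans ?_
  rw [mul_assoc]
  gcongr
  exact one_add_norm_prod_le p.2

/-- The Schwartz function is part of the index and its seminorm part of the weight, so continuity of
the operator comes out of the general bounds. The exponents are fixed before `f`, so that two
symbols can share one weight. Decay in `x` is taken from $\varphi(x+y)$ at the cost of powers of
$y$, which the oscillation absorbs. -/
lemma isAmp_quantAmp (hA : ∀ l, (A l).HasTemperateGrowth) (ε lam : ℝ) {c : ι → ℝ} (M : ℕ)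
    (hc : ∀ i, 0 ≤ c i) (K₀ : ℕ) :
    ∃ N K : ℕ → ℕ, Monotone N ∧ Monotone K ∧ ∀ {f : ι → Phase d → ℂ},
      IsAmp (ContinuousLinearMap.id ℝ _) (fun _ i X => c i * (1 + ‖X‖) ^ M) f →
      IsAmp ((quantPhase d).hz (Conf d))
      ((quantPhase d).wt (fun k (i : ι × 𝓢(Conf d, ℂ)) x =>
        c i.1 * schwartzNorm (K k) k i.2 * ((1 + ‖x‖) ^ K₀)⁻¹) N M)
      fun i => quantAmp ε lam A (f i.1) i.2 := by
  obtain ⟨n, hn, hκ⟩ := isAmp_transport_pullback hA ε lam (ι × 𝓢(Conf d, ℂ))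
  -- Decay required of the Schwartz function: it pays for the transport, for the symbol and for the
  -- `K₀` powers to be gained in `x`. Moving this decay from $x+y$ to $x$ adds `K k` to the exponent
  -- of $1+|y|$ below.
  set K : ℕ → ℕ := fun k => n k + M + K₀ with hK
  have hKm : Monotone K := fun k l hkl => by
    have := hn hkl
    simp only [hK]; omega
  set N : ℕ → ℕ := fun k => n k + M + K k with hNd
  have hNm : Monotone N := fun k l hkl => by
    have h1 := hn hkl
    have h2 := hKm hkl
    simp only [hNd]; omega
  refine ⟨N, K, hNm, hKm, fun {f} hf => ?_⟩
  have hf' := (hf.comp_clm_const (hz' := (quantPhase d).hz (Conf d)) (midpointMap d ε)).reindex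
    (fun i : ι × 𝓢(Conf d, ℂ) => i.1)
  have hκf := hκ.mul hf' (W₃ := fun k (i : ι × 𝓢(Conf d, ℂ)) (p : Conf d × Phase d) =>
      c i.1 * (((1 + ‖p.1‖) * (1 + ‖p.2.1‖)) ^ (n k + M) * (1 + ‖p.2.2‖) ^ M))
    (fun _ _ _ => by positivity) (fun k i p => mul_nonneg (hc i.1) (by positivity))
    fun j k => ⟨(1 + ‖midpointMap d ε‖) ^ M, fun i p => ?_⟩
  · have hφ : ∀ l, IsAmp ((quantPhase d).hz (Conf d)) (fun k (i : ι × 𝓢(Conf d, ℂ)) p =>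
        schwartzNorm l k i.2 * ((1 + ‖p.1 + p.2.1‖) ^ l)⁻¹)
        (fun i (p : Conf d × Phase d) => i.2 (p.1 + p.2.1)) := fun l =>
      ((isAmp_schwartz_family l).comp_clm (hz' := (quantPhase d).hz (Conf d))
        (ContinuousLinearMap.fst ℝ (Conf d) (Phase d) +
          (ContinuousLinearMap.fst ℝ (Conf d) (Conf d)).comp
            (ContinuousLinearMap.snd ℝ (Conf d) (Phase d)))
        (fun e he => by
          obtain ⟨h1, h2⟩ := Prod.mk_eq_zero.1 he
          change e.1 + e.2.1 = 0
          rw [show e.1 = 0 from h1, show e.2.1 = 0 from h2, add_zero])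
        (fun k φ x => mul_nonneg (schwartzNorm_nonneg _ _ _) (by positivity))
        (fun φ x => fun k k' hk => mul_le_mul_of_nonneg_right
          (schwartzNorm_mono le_rfl hk φ) (by positivity))).reindex
        (fun i : ι × 𝓢(Conf d, ℂ) => i.2)
    have key := hκf.mul_family hφ
      (W₃ := (quantPhase d).wt (fun k (i : ι × 𝓢(Conf d, ℂ)) x =>
        c i.1 * schwartzNorm (K k) k i.2 * ((1 + ‖x‖) ^ K₀)⁻¹) N M)
      (fun k i p => mul_nonneg (hc i.1) (by positivity))
      (fun l k i p => mul_nonneg (schwartzNorm_nonneg _ _ _) (by positivity))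
      fun j k => ⟨K j, 1, fun i p => ?_⟩
    · refine (congrArg (IsAmp _ _) (funext fun i => funext fun p => ?_)).mpr key
      simp only [quantAmp, mul_assoc, midpointMap_apply]
    · have hx : 1 + ‖p.1‖ ≤ 1 * ((1 + ‖p.1 + p.2.1‖) * (1 + ‖p.2.1‖)) := by
        have := one_add_norm_add_le (p.1 + p.2.1) (-p.2.1)
        rwa [add_neg_cancel_right, norm_neg, ← one_mul ((1 + ‖p.1 + p.2.1‖) * _)] at this
      have h1 := OscPhase.inv_pow_le_of_le_mul (by positivity) (by positivity) hx (K j)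
      rw [one_pow, one_mul] at h1
      have h2 := schwartzNorm_mono (hKm (Nat.le_add_right j k)) (Nat.le_add_left k j) i.2
      have h3 : N j ≤ N (j + k) := hNm (Nat.le_add_right j k)
      have hc' := hc i.1
      have hs := schwartzNorm_nonneg (K j) k i.2
      have hs' := schwartzNorm_nonneg (K (j + k)) (j + k) i.2
      have h4 : (1 + ‖p.1‖) ^ (n j + M) * ((1 + ‖p.1‖) ^ K j)⁻¹ = ((1 + ‖p.1‖) ^ K₀)⁻¹ := by
        simp only [hK]
        rw [pow_add _ (n j + M) K₀, mul_inv, mul_inv_cancel_left₀ (by positivity)]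
      calc c i.1 * (((1 + ‖p.1‖) * (1 + ‖p.2.1‖)) ^ (n j + M) * (1 + ‖p.2.2‖) ^ M) *
            (schwartzNorm (K j) k i.2 * ((1 + ‖p.1 + p.2.1‖) ^ K j)⁻¹)
          ≤ c i.1 * (((1 + ‖p.1‖) * (1 + ‖p.2.1‖)) ^ (n j + M) * (1 + ‖p.2.2‖) ^ M) *
            (schwartzNorm (K (j + k)) (j + k) i.2 *
              ((1 + ‖p.2.1‖) ^ K j * ((1 + ‖p.1‖) ^ K j)⁻¹)) := by gcongr
        _ = c i.1 * schwartzNorm (K (j + k)) (j + k) i.2 *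
            ((1 + ‖p.1‖) ^ (n j + M) * ((1 + ‖p.1‖) ^ K j)⁻¹) * (1 + ‖p.2.1‖) ^ N j *
            (1 + ‖p.2.2‖) ^ M := by
            simp only [hNd]
            rw [mul_pow, pow_add (1 + ‖p.2.1‖) (n j + M) (K j)]
            ring
        _ ≤ c i.1 * schwartzNorm (K (j + k)) (j + k) i.2 * ((1 + ‖p.1‖) ^ K₀)⁻¹ *
            (1 + ‖p.2.1‖) ^ N (j + k) * (1 + ‖p.2.2‖) ^ M := by
            rw [h4]
            have := pow_le_pow_right₀ (one_le_one_add_norm p.2.1) h3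
            gcongr
        _ = _ := by
            rw [one_mul]
            rfl
  · have h1 := hc i.1
    have e2 : 1 + ‖midpointMap d ε p‖ ≤ (1 + ‖midpointMap d ε‖) *
        ((1 + ‖p.1‖) * (1 + ‖p.2.1‖) * (1 + ‖p.2.2‖)) :=
      (OscPhase.one_add_norm_clm_le _ _).trans (by
        gcongr; exact one_add_norm_triple_le p)
    have e3 : (1 : ℝ) ≤ (1 + ‖p.1‖) * (1 + ‖p.2.1‖) :=
      one_le_mul_of_one_le_of_one_le (one_le_one_add_norm _) (one_le_one_add_norm _)
    have e4 := pow_le_pow_right₀ e3 (hn (Nat.le_add_right j k))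
    calc _ ≤ ((1 + ‖p.1‖) * (1 + ‖p.2.1‖)) ^ n j * (c i.1 * ((1 + ‖midpointMap d ε‖) *
          ((1 + ‖p.1‖) * (1 + ‖p.2.1‖) * (1 + ‖p.2.2‖))) ^ M) := by gcongr
      _ ≤ ((1 + ‖p.1‖) * (1 + ‖p.2.1‖)) ^ n (j + k) * (c i.1 * ((1 + ‖midpointMap d ε‖) *
          ((1 + ‖p.1‖) * (1 + ‖p.2.1‖) * (1 + ‖p.2.2‖))) ^ M) := by gcongr
      _ = _ := by
          rw [mul_pow (1 + ‖midpointMap d ε‖), mul_pow _ (1 + ‖p.2.2‖), pow_add]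
          ring

end Quantization

/-! ### Quantization as a continuous operator on Schwartz functions. -/

section QuantizationMaps

variable {d : ℕ} {ε lam : ℝ} {A : Fin d → Conf d → ℝ} {ι : Type*}

lemma isWeight_quant {c : ι → ℝ} (hc : ∀ i, 0 ≤ c i) {K : ℕ → ℕ} (hK : Monotone K) (K₀ : ℕ) :
    OscPhase.IsWeight fun k (i : ι × 𝓢(Conf d, ℂ)) (x : Conf d) =>
      c i.1 * schwartzNorm (K k) k i.2 * ((1 + ‖x‖) ^ K₀)⁻¹ := by
  refine ⟨fun k i x => mul_nonneg (mul_nonneg (hc _) (schwartzNorm_nonneg _ _ _)) (by positivity),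
    fun i x => fun k l hkl => ?_, fun k i x => ⟨c i.1 * schwartzNorm (K k) k i.2,
      Eventually.of_forall fun y => ?_⟩⟩
  · exact mul_le_mul_of_nonneg_right (mul_le_mul_of_nonneg_left
      (schwartzNorm_mono (hK hkl) hkl i.2) (hc _)) (by positivity)
  · exact mul_le_of_le_one_right (mul_nonneg (hc _) (schwartzNorm_nonneg _ _ _))
      (inv_le_one_of_one_le₀ (one_le_pow₀ (one_le_one_add_norm y)))

lemma exists_quantFun_le (hA : ∀ l, (A l).HasTemperateGrowth) (ε lam : ℝ) {f : ι → Phase d → ℂ}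
    {c : ι → ℝ} {M : ℕ} (hf : IsAmp (ContinuousLinearMap.id ℝ _)
      (fun _ i X => c i * (1 + ‖X‖) ^ M) f) (hc : ∀ i, 0 ≤ c i) (K₀ n : ℕ) :
    ∃ (C : ℝ) (K k : ℕ), 0 ≤ C ∧ ∀ i (φ : 𝓢(Conf d, ℂ)) x, (1 + ‖x‖) ^ K₀ *
      ‖iteratedFDeriv ℝ n (quantFun ε lam A (f i) φ) x‖ ≤ C * (c i * schwartzNorm K k φ) := by
  obtain ⟨N, K, hN, hK, h⟩ := isAmp_quantAmp hA ε lam M hc K₀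
  have hw := isWeight_quant (d := d) hc hK K₀
  obtain ⟨C, hC, hb⟩ := (((quantPhase d).isAmp_osc (h hf) hw hN).smul
    (((((2 * Real.pi) ^ d : ℝ) : ℂ))⁻¹) (fun _ => hw.nonneg _)).norm_iteratedFDeriv_le
    (fun _ => hw.nonneg _) (fun i x => (hw.shift _).mono i x) n
  refine ⟨C, K (n + (quantPhase d).loss (M + 1)), n + (quantPhase d).loss (M + 1), hC,
    fun i φ x => ?_⟩
  have h1 := hb (i, φ) x
  dsimp only at h1
  rw [← mul_assoc, ← div_eq_mul_inv, le_div_iff₀ (by positivity), mul_comm] at h1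
  exact h1

lemma contDiff_quantFun (hA : ∀ l, (A l).HasTemperateGrowth) (ε lam : ℝ) {f : Phase d → ℂ} {M : ℕ}
    (hf : IsAmp (ContinuousLinearMap.id ℝ _) (fun _ (_ : Unit) X => 1 * (1 + ‖X‖) ^ M) fun _ => f)
    (φ : 𝓢(Conf d, ℂ)) : ContDiff ℝ ∞ (quantFun ε lam A f φ) := by
  obtain ⟨N, K, hN, hK, h⟩ := isAmp_quantAmp hA ε lam M (fun _ : Unit => zero_le_one) 0
  exact contDiff_const.mul ((quantPhase d).contDiff_osc (h hf)
    (isWeight_quant (fun _ => zero_le_one) hK 0) hN ((), φ))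

lemma quantFun_sub (hA : ∀ l, (A l).HasTemperateGrowth) (ε lam : ℝ) {f g : Phase d → ℂ} {M : ℕ}
    (hf : IsAmp (ContinuousLinearMap.id ℝ _) (fun _ (_ : Unit) X => 1 * (1 + ‖X‖) ^ M) fun _ => f)
    (hg : IsAmp (ContinuousLinearMap.id ℝ _) (fun _ (_ : Unit) X => 1 * (1 + ‖X‖) ^ M) fun _ => g)
    (φ : 𝓢(Conf d, ℂ)) (x : Conf d) : quantFun ε lam A (fun X => f X - g X) φ x =
      quantFun ε lam A f φ x - quantFun ε lam A g φ x := by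
  obtain ⟨N, K, hN, hK, h⟩ := isAmp_quantAmp hA ε lam M (fun _ : Unit => zero_le_one) 0
  have h1 := (quantPhase d).osc_sub (h hf) (h hg) (isWeight_quant (fun _ => zero_le_one) hK 0) hN
    ((), φ) x
  unfold quantFun
  rw [← mul_sub, ← h1]
  congr 2
  funext p
  simp only [quantAmp]
  ring

/-- The quantization of a function of polynomial growth is a continuous operator. -/
lemma exists_quantOp (hA : ∀ l, (A l).HasTemperateGrowth) (ε lam : ℝ) {f : Phase d → ℂ} {M : ℕ}
    (hf : IsAmp (ContinuousLinearMap.id ℝ _) (fun _ (_ : Unit) X => 1 * (1 + ‖X‖) ^ M) fun _ => f) :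
    ∃ T : 𝓢(Conf d, ℂ) →L[ℂ] 𝓢(Conf d, ℂ), ∀ φ x, T φ x = quantFun ε lam A f φ x := by
  obtain ⟨N, K, hN, hK, h⟩ := isAmp_quantAmp hA ε lam M (fun _ : Unit => zero_le_one) 0
  have hw := isWeight_quant (d := d) (fun _ : Unit => zero_le_one) hK 0
  refine ⟨SchwartzMap.mkCLM (fun φ => quantFun ε lam A f φ) (fun φ ψ x => ?_) (fun c φ x => ?_)
    (fun φ => contDiff_quantFun hA ε lam hf φ) (fun n => ?_), fun φ x => rfl⟩
  -- The three Schwartz functions are three indices of one family of amplitudes.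
  · have h1 := (quantPhase d).osc_add_of_eq (h hf) hw hN (i := ((), φ)) (j := ((), ψ))
      (k := ((), φ + ψ)) (fun p => by simp only [quantAmp, add_apply]; ring) x
    simp only [quantFun]
    rw [h1, mul_add]
  · have h1 := (quantPhase d).osc_const_mul (h hf) hw hN c ((), φ) x
    have h2 : quantAmp ε lam A f (c • φ : 𝓢(Conf d, ℂ)) = fun p => c * quantAmp ε lam A f φ p := by
      funext p
      simp only [quantAmp, smul_apply, smul_eq_mul]
      ring
    simp only [quantFun, RingHom.id_apply, smul_eq_mul]
    rw [h2, h1]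
    ring
  · obtain ⟨C, K, k, hC, hb⟩ := exists_quantFun_le hA ε lam hf (fun _ => zero_le_one) n.1 n.2
    refine ⟨Finset.Iic (K, k), C * 2 ^ K, by positivity, fun φ x => ?_⟩
    refine le_trans ?_ ((hb () φ x).trans (le_of_eq ?_))
    · gcongr
      linarith
    · rw [schwartzNorm, one_mul, mul_assoc]

lemma exists_schwartzNorm_quantOp_le (hA : ∀ l, (A l).HasTemperateGrowth) (ε lam : ℝ)
    {f : ι → Phase d → ℂ} {c : ι → ℝ} {M : ℕ} (hf : IsAmp (ContinuousLinearMap.id ℝ _)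
      (fun _ i X => c i * (1 + ‖X‖) ^ M) f) (hc : ∀ i, 0 ≤ c i)
    {T : ι → 𝓢(Conf d, ℂ) → 𝓢(Conf d, ℂ)}
    (hT : ∀ i φ x, T i φ x = quantFun ε lam A (f i) φ x) (K k : ℕ) :
    ∃ (C : ℝ) (K' k' : ℕ), 0 ≤ C ∧ ∀ i (φ : 𝓢(Conf d, ℂ)),
      schwartzNorm K k (T i φ) ≤ C * (c i * schwartzNorm K' k' φ) := by
  choose C K' k' hC hb using fun n => exists_quantFun_le hA ε lam hf hc K n
  have hsum : ∀ {g : ℕ → ℕ} {n : ℕ}, n ≤ k → g n ≤ ∑ j ∈ Finset.range (k + 1), g j :=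
    fun {g n} hn => Finset.single_le_sum (f := g) (fun _ _ => Nat.zero_le _)
      (Finset.mem_range.2 (by omega))
  refine ⟨2 ^ K * ∑ j ∈ Finset.range (k + 1), C j, ∑ j ∈ Finset.range (k + 1), K' j,
    ∑ j ∈ Finset.range (k + 1), k' j,
    mul_nonneg (by positivity) (Finset.sum_nonneg fun j _ => hC j), fun i φ => ?_⟩
  rw [mul_assoc]
  refine schwartzNorm_le_of_forall (mul_nonneg (Finset.sum_nonneg fun j _ => hC j)
    (mul_nonneg (hc i) (schwartzNorm_nonneg _ _ _))) fun n hn x => ?_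
  have e : ⇑(T i φ) = quantFun ε lam A (f i) φ := funext (hT i φ)
  rw [e]
  refine (hb n i φ x).trans (mul_le_mul ?_ (mul_le_mul_of_nonneg_left
    (schwartzNorm_mono (hsum hn) (hsum hn) φ) (hc i))
    (mul_nonneg (hc i) (schwartzNorm_nonneg _ _ _)) (Finset.sum_nonneg fun j _ => hC j))
  exact Finset.single_le_sum (f := C) (fun j _ => hC j) (Finset.mem_range.2 (by omega))

lemma norm_schwartz_le_schwartzNorm (φ : 𝓢(Conf d, ℂ)) (x : Conf d) :
    ‖φ x‖ ≤ schwartzNorm 0 0 φ := by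
  have h := SchwartzMap.one_add_le_sup_seminorm_apply (𝕜 := ℂ) (m := (0, 0)) (k := 0) (n := 0)
    le_rfl le_rfl φ x
  simp only [pow_zero, one_mul, norm_iteratedFDeriv_zero] at h
  unfold schwartzNorm
  rw [pow_zero, one_mul]
  exact h

lemma exists_norm_quantFun_le (hA : ∀ l, (A l).HasTemperateGrowth) (ε lam : ℝ)
    {f : ι → Phase d → ℂ} {c : ι → ℝ} {M : ℕ} (hf : IsAmp (ContinuousLinearMap.id ℝ _)
      (fun _ i X => c i * (1 + ‖X‖) ^ M) f) (hc : ∀ i, 0 ≤ c i) :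
    ∃ (C : ℝ) (K k : ℕ), 0 ≤ C ∧ ∀ i (φ : 𝓢(Conf d, ℂ)) x,
      ‖quantFun ε lam A (f i) φ x‖ ≤ C * (c i * schwartzNorm K k φ) := by
  obtain ⟨C, K, k, hC, h⟩ := exists_quantFun_le hA ε lam hf hc 0 0
  exact ⟨C, K, k, hC, fun i φ x => by simpa using h i φ x⟩

lemma tendsto_mul_const_nhdsGT (C : ℝ) : Tendsto (fun δ : ℝ => C * δ) (𝓝[>] 0) (𝓝 0) := by
  have h : Tendsto (fun δ : ℝ => C * δ) (𝓝 0) (𝓝 (C * 0)) := Continuous.tendsto (by fun_prop) 0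
  rw [mul_zero] at h
  exact h.mono_left nhdsWithin_le_nhds

/-- Quantization is linear in the symbol, and its bound is linear in the constant `c i`; here that
constant is `δ`. -/
lemma tendsto_quantFun (hA : ∀ l, (A l).HasTemperateGrowth) (ε lam : ℝ) {f : Phase d → ℂ}
    {fδ : ℝ → Phase d → ℂ} {M : ℕ}
    (hf : IsAmp (ContinuousLinearMap.id ℝ _) (fun _ (_ : Unit) X => 1 * (1 + ‖X‖) ^ M) fun _ => f)
    (hd : IsAmp (ContinuousLinearMap.id ℝ _)
      (fun _ (δ : Set.Ioc (0 : ℝ) 1) X => δ * (1 + ‖X‖) ^ M) fun δ X => fδ δ X - f X)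
    (φ : 𝓢(Conf d, ℂ)) (x : Conf d) :
    Tendsto (fun δ => quantFun ε lam A (fδ δ) φ x) (𝓝[>] 0) (𝓝 (quantFun ε lam A f φ x)) := by
  obtain ⟨C, K, k, hC, h⟩ := exists_norm_quantFun_le hA ε lam hd (fun δ => δ.2.1.le)
  rw [tendsto_iff_norm_sub_tendsto_zero]
  refine squeeze_zero' (Eventually.of_forall fun _ => norm_nonneg _)
    (g := fun δ => C * schwartzNorm K k φ * δ) ?_ (tendsto_mul_const_nhdsGT _)
  filter_upwards [Ioc_mem_nhdsGT zero_lt_one] with δ hδ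
  have hd' := (hd.reindex fun _ : Unit => (⟨δ, hδ⟩ : Set.Ioc (0 : ℝ) 1)).mono
    (W' := fun _ _ X => 1 * (1 + ‖X‖) ^ M)
    (fun _ _ X => mul_nonneg hδ.1.le (by positivity)) fun _ => ⟨1, fun _ X => by
      rw [one_mul]; exact mul_le_mul_of_nonneg_right hδ.2 (by positivity)⟩
  have hfδ := hd'.add hf
  simp only [sub_add_cancel] at hfδ
  have h1 := h ⟨δ, hδ⟩ φ x
  rw [quantFun_sub hA ε lam hfδ hf] at h1
  exact h1.trans (le_of_eq (by ring))

end QuantizationMaps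

/-! ### Integral kernels of quantized Schwartz functions. -/

section QuantizationOfSchwartz

variable {d : ℕ} {ε lam : ℝ} {A : Fin d → Conf d → ℝ}

lemma quantFun_eq_integral (hA : ∀ l, (A l).HasTemperateGrowth) (hε : 0 < ε) (lam : ℝ)
    (u : 𝓢(Phase d, ℂ)) (φ : 𝓢(Conf d, ℂ)) (x : Conf d) :
    (((2 * Real.pi) ^ d : ℝ) : ℂ) * quantFun ε lam A u φ x = ∫ y,
      transport ε lam A x y * φ (x + y) * partialFourier u (ε • (x + (2 : ℝ)⁻¹ • y)) y := by
  have hne : (((2 * Real.pi) ^ d : ℝ) : ℂ) ≠ 0 := by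
    have : (2 * Real.pi) ^ d ≠ 0 := by positivity
    exact_mod_cast this
  obtain ⟨n, hn, hκ⟩ := isAmp_transport_pullback hA ε lam Unit
  have hκ' : IsAmp ((quantPhase d).hz (Conf d))
      ((quantPhase d).wt (fun k (_ : Unit) x => (1 + ‖x‖) ^ n k) n 0) _ :=
    hκ.mono (fun _ _ _ => by positivity) fun k => ⟨1, fun i p => by
      simp only [OscPhase.wt, pow_zero, mul_one, one_mul, mul_pow]
      exact le_rfl⟩
  have hdec : (quantPhase d).IsDecaying (quantAmp ε lam A u φ) := by
    refine (quantPhase d).isDecaying_mul (g := fun K x => (1 + ‖x‖) ^ K) hκ'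
      ⟨fun _ _ _ => by positivity,
        fun _ x => fun k l hkl => pow_le_pow_right₀ (one_le_one_add_norm x) (hn hkl),
        fun k _ x => ⟨(1 + (‖x‖ + 1)) ^ n k, ?_⟩⟩ (fun _ _ => by positivity) fun K => ?_
    · filter_upwards [Metric.ball_mem_nhds x one_pos] with y hy
      have h1 : ‖y - x‖ ≤ 1 := by rw [← dist_eq_norm]; exact (Metric.mem_ball.1 hy).le
      have h2 := norm_add_le (y - x) x
      rw [sub_add_cancel] at h2
      gcongr
      linarith
    · have hφ := (isAmp_schwartz (ι := Unit) (0 : Conf d →L[ℝ] Conf d) φ 0).comp_clm_const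
        (hz' := (quantPhase d).hz (Conf d)) (ContinuousLinearMap.fst ℝ (Conf d) (Phase d) +
          (ContinuousLinearMap.fst ℝ (Conf d) (Conf d)).comp
            (ContinuousLinearMap.snd ℝ (Conf d) (Phase d)))
      -- Recovers the displacement $y=2(\varepsilon^{-1}q-x)$ and the momentum from the midpoint
      -- variable and `x`, so decay of the symbol at the midpoint is decay in the integration
      -- variable.
      set R : Phase d × Conf d →L[ℝ] Phase d := ((2 : ℝ) •
        (ε⁻¹ • (ContinuousLinearMap.fst ℝ (Conf d) (Conf d)).comp
          (ContinuousLinearMap.fst ℝ (Phase d) (Conf d)) -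
          ContinuousLinearMap.snd ℝ (Phase d) (Conf d))).prod
        ((ContinuousLinearMap.snd ℝ (Conf d) (Conf d)).comp
          (ContinuousLinearMap.fst ℝ (Phase d) (Conf d))) with hR
      have hu := (quantPhase d).isAmp_decay_comp (midpointMap d ε)
        ⟨1 + ‖R‖, fun p => by
          have e : p.2 = R (midpointMap d ε p, p.1) := by
            rw [midpointMap_apply, hR]
            ext1
            · simp [smul_smul, hε.ne']
            · simp
          conv_lhs => rw [e]
          refine (OscPhase.one_add_norm_clm_le _ _).trans ?_
          gcongr
          exact one_add_norm_prod_le (midpointMap d ε p, p.1)⟩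
        (isAmp_schwartz (ι := Unit) (0 : Phase d →L[ℝ] Conf d) u K)
      have h := hu.mul hφ (W₃ := fun _ (_ : Unit) (p : Conf d × Phase d) =>
        (1 + ‖p.1‖) ^ K * ((1 + ‖p.2‖) ^ K)⁻¹) (fun _ _ _ => by positivity)
        (fun _ _ _ => by positivity) fun j k => ⟨1, fun i p => by simp⟩
      simp only [midpointMap_apply] at h
      exact h
  have hpoly : IsAmp (ContinuousLinearMap.id ℝ _) (fun _ (_ : Unit) X => 1 * (1 + ‖X‖) ^ 0)
      fun _ => (u : Phase d → ℂ) := by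
    simpa using isAmp_schwartz (ι := Unit) (ContinuousLinearMap.id ℝ (Phase d)) u 0
  obtain ⟨N, K, hN, hK, h⟩ := isAmp_quantAmp hA ε lam 0 (fun _ : Unit => zero_le_one) 0
  have h1 := (quantPhase d).osc_eq_integral (h hpoly)
    (isWeight_quant (fun _ => zero_le_one) hK 0) hN ((), φ) hdec x
  have hi := (quantPhase d).integrable_phase_mul (hdec.integrable x)
  rw [quantFun, mul_inv_cancel_left₀ hne, h1]
  refine (integral_prod _ hi).trans (integral_congr_ae (Eventually.of_forall fun y => ?_))
  beta_reduce
  rw [partialFourier, ← integral_const_mul]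
  refine integral_congr_ae (Eventually.of_forall fun ξ => ?_)
  simp only [quantAmp, quantPhase]
  ring

lemma weylSystem_mul_eq (u : Phase d → ℂ) (φ : Conf d → ℂ) (x y η : Conf d) :
    weylSystem ε lam A (y, η) φ x * u (y, η) = transport ε lam A x y * φ (x + y) *
      (cis (-inner ℝ η (ε • (x + (2 : ℝ)⁻¹ • y))) * u (y, η)) := by
  have h : cis (-(ε * inner ℝ (x + (2 : ℝ)⁻¹ • y) η)) =
      cis (-inner ℝ η (ε • (x + (2 : ℝ)⁻¹ • y))) := by
    rw [inner_smul_right, real_inner_comm]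
  simp only [weylSystem, transport]
  rw [h]
  ring

lemma integrable_weylSystem_mul (hA : ∀ l, (A l).HasTemperateGrowth) (ε lam : ℝ)
    (u : 𝓢(Phase d, ℂ)) (φ : 𝓢(Conf d, ℂ)) (x : Conf d) :
    Integrable fun Y => weylSystem ε lam A Y φ x * sympFourier u Y := by
  refine (integrable_sympFourier u).bdd_mul (c := schwartzNorm 0 0 φ)
    (Continuous.aestronglyMeasurable ?_) (Eventually.of_forall fun Y => ?_)
  · unfold weylSystem
    have h1 : Continuous fun Y : Phase d => transport ε lam A x Y.1 := by
      simpa only [Function.comp_def] using (continuous_transport hA ε lam).comp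
        (by fun_prop : Continuous fun Y : Phase d => (x, Y.1))
    unfold transport at h1
    exact ((continuous_cis.comp (by fun_prop)).mul h1).mul (φ.continuous.comp (by fun_prop))
  · rw [weylSystem, norm_mul, norm_mul, norm_cis, norm_cis, one_mul, one_mul]
    exact norm_schwartz_le_schwartzNorm φ _

lemma integral_weylSystem (hA : ∀ l, (A l).HasTemperateGrowth) (hε : 0 < ε) (lam : ℝ)
    (u : 𝓢(Phase d, ℂ)) (φ : 𝓢(Conf d, ℂ)) (x : Conf d) :
    ∫ Y, weylSystem ε lam A Y φ x * sympFourier u Y =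
      (((2 * Real.pi) ^ d : ℝ) : ℂ) * quantFun ε lam A u φ x := by
  rw [quantFun_eq_integral hA hε lam u φ x]
  refine (integral_prod _ (integrable_weylSystem_mul hA ε lam u φ x)).trans
    (integral_congr_ae (Eventually.of_forall fun y => ?_))
  simp only [weylSystem_mul_eq]
  rw [integral_const_mul, integral_sympFourier]

/-- The oscillatory integral defines the magnetic Weyl quantization. -/
lemma isQuantization_of_eq (hA : ∀ l, (A l).HasTemperateGrowth) (hε : 0 < ε) (lam : ℝ)
    {f : Phase d → ℂ} {M : ℕ}
    (hf : IsAmp (ContinuousLinearMap.id ℝ _) (fun _ (_ : Unit) X => (1 + ‖X‖) ^ M) fun _ => f)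
    {T : 𝓢(Conf d, ℂ) →L[ℂ] 𝓢(Conf d, ℂ)} (hT : ∀ φ x, T φ x = quantFun ε lam A f φ x) :
    IsQuantization ε lam A f T := by
  intro φ x χ hχ
  refine ⟨fun δ hδ => ?_, ?_⟩
  · obtain ⟨u, hu⟩ := exists_schwartz_regularize hf χ hδ
    rw [← hu]
    exact integrable_weylSystem_mul hA ε lam u φ x
  · have hd := isAmp_regularize_sub hf (fun X => by positivity) hχ
    simp only [← pow_succ'] at hd
    -- The symbol is given the exponent `M + 1` of the regularization error, so that both obey the
    -- same weight.
    have hf' : IsAmp (ContinuousLinearMap.id ℝ _)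
        (fun _ (_ : Unit) X => 1 * (1 + ‖X‖) ^ (M + 1)) fun _ => f :=
      hf.mono (fun _ _ X => by positivity) fun _ => ⟨1, fun _ X => by
        rw [one_mul, one_mul]; exact pow_le_pow_right₀ (one_le_one_add_norm X) (by omega)⟩
    rw [hT]
    refine ((tendsto_quantFun hA ε lam (fδ := fun δ => regularize χ δ f) hf' hd φ x).const_mul _).congr' ?_
    filter_upwards [self_mem_nhdsWithin] with δ hδ
    obtain ⟨u, hu⟩ := exists_schwartz_regularize hf χ hδ
    rw [← hu]
    exact (integral_weylSystem hA hε lam u φ x).symm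

end QuantizationOfSchwartz

/-! ### Composition of quantized Schwartz functions. -/

section Composition

open OscPhase (decay decayExp integrable_decay decay_pos)

variable {d : ℕ} {ε lam : ℝ} {A : Fin d → Conf d → ℝ} {B : Fin d → Fin d → Conf d → ℝ}

lemma two_pi_pow_ne_zero (n : ℕ) : (((2 * Real.pi) ^ n : ℝ) : ℂ) ≠ 0 := by
  have : (2 * Real.pi) ^ n ≠ 0 := by positivity
  exact_mod_cast this

lemma integrable_of_decay_prod {F : Conf d × Conf d → ℂ} (hF : Continuous F) {C : ℝ}
    (h : ∀ p, ‖F p‖ ≤ C * (decay p.1 * decay p.2)) : Integrable F := by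
  have hi : Integrable fun p : Conf d × Conf d => C * (decay p.1 * decay p.2) := by
    have := (integrable_decay (Q := Conf d)).mul_prod (integrable_decay (Q := Conf d))
    rw [← Measure.volume_eq_prod] at this
    exact this.const_mul C
  exact hi.mono' hF.aestronglyMeasurable (Eventually.of_forall h)

/-- The integrand of the kernel of a composition of magnetic Weyl quantizations. -/
def compIntegrand (ε lam : ℝ) (B : Fin d → Fin d → Conf d → ℝ) (u v : Phase d → ℂ)
    (q w y : Conf d) : ℂ :=
  fluxExp ε lam B (q - (ε / 2) • w) (q - (ε / 2) • w + ε • y) (q + (ε / 2) • w) *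
    (partialFourier u (q + (ε / 2) • (y - w)) y * partialFourier v (q + (ε / 2) • y) (w - y))

lemma continuous_compIntegrand (hB : ∀ l j, IsBCInfty (B l j)) (ε lam : ℝ) (u v : 𝓢(Phase d, ℂ))
    {α : Type*} [TopologicalSpace α] {q w y : α → Conf d} (hq : Continuous q) (hw : Continuous w)
    (hy : Continuous y) : Continuous fun t => compIntegrand ε lam B u v (q t) (w t) (y t) := by
  have h : ∀ (u : 𝓢(Phase d, ℂ)) {a b : α → Conf d}, Continuous a → Continuous b →
      Continuous fun t => partialFourier u (a t) (b t) := fun u a b ha hb => by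
    simpa only [Function.comp_def] using (continuous_partialFourier u).comp (ha.prodMk hb)
  exact (continuous_fluxExp hB ε lam (by fun_prop) (by fun_prop) (by fun_prop)).mul
    ((h u (by fun_prop) (by fun_prop)).mul (h v (by fun_prop) (by fun_prop)))

/-- Half of the decay in $y$ pays for moving the other factor from $w-y$ to $w$; the other half
remains. -/
lemma decay_mul_decay_sub_le (w y : Conf d) :
    ((1 + ‖y‖) ^ (2 * decayExp (Conf d)))⁻¹ * decay (w - y) ≤ decay w * decay y := by
  have h1 : 1 + ‖w‖ ≤ (1 + ‖w - y‖) * (1 + ‖y‖) := by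
    have := one_add_norm_add_le (w - y) y
    rwa [sub_add_cancel] at this
  have h2 : (1 + ‖w‖) ^ decayExp (Conf d) ≤
      (1 + ‖w - y‖) ^ decayExp (Conf d) * (1 + ‖y‖) ^ decayExp (Conf d) := by
    rw [← mul_pow]
    gcongr
  unfold decay
  rw [← mul_inv, ← mul_inv, two_mul, pow_add]
  refine inv_anti₀ (by positivity) ?_
  calc _ ≤ ((1 + ‖w - y‖) ^ decayExp (Conf d) * (1 + ‖y‖) ^ decayExp (Conf d)) *
        (1 + ‖y‖) ^ decayExp (Conf d) := by gcongr
    _ = _ := by ring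

lemma exists_compIntegrand_le (ε lam : ℝ) (B : Fin d → Fin d → Conf d → ℝ)
    (u v : 𝓢(Phase d, ℂ)) : ∃ C, 0 ≤ C ∧ ∀ q w y,
      ‖compIntegrand ε lam B u v q w y‖ ≤ C * (decay w * decay y) := by
  obtain ⟨C₁, h₁, hu⟩ := exists_partialFourier_le u 0 (2 * decayExp (Conf d))
  obtain ⟨C₂, h₂, hv⟩ := exists_partialFourier_le v 0 (decayExp (Conf d))
  refine ⟨C₁ * C₂, by positivity, fun q w y => ?_⟩
  rw [compIntegrand, norm_mul, norm_fluxExp, one_mul, norm_mul]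
  have e1 := hu (q + (ε / 2) • (y - w)) y
  have e2 := hv (q + (ε / 2) • y) (w - y)
  rw [pow_zero, inv_one, one_mul] at e1 e2
  refine (mul_le_mul e1 e2 (norm_nonneg _) (by positivity)).trans ?_
  rw [mul_mul_mul_comm]
  exact mul_le_mul_of_nonneg_left (decay_mul_decay_sub_le w y) (by positivity)

/-- The partial Fourier transform of a magnetic Weyl product of Schwartz functions. -/
lemma partialFourier_weylProd (hB : ∀ l j, IsBCInfty (B l j)) (hε : 0 < ε) (lam : ℝ)
    (u v : 𝓢(Phase d, ℂ)) (q w : Conf d) :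
    (((2 * Real.pi) ^ d : ℝ) : ℂ) * partialFourier (weylProd hε lam B u v) q w =
      ∫ y, compIntegrand ε lam B u v q w y := by
  obtain ⟨C, hC, hb⟩ := exists_compIntegrand_le ε lam B u v
  set k : Conf d → ℂ := fun w => ∫ y, compIntegrand ε lam B u v q w y with hk
  have hkc : Continuous k := by
    refine continuous_of_dominated (bound := fun y => C * decay y) (fun w => ?_)
      (fun w => Eventually.of_forall fun y => ?_) (integrable_decay.const_mul C)
      (Eventually.of_forall fun y => ?_)
    · exact (continuous_compIntegrand hB ε lam u v continuous_const continuous_const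
        continuous_id).aestronglyMeasurable
    · refine (hb q w y).trans (mul_le_mul_of_nonneg_left ?_ hC)
      refine mul_le_of_le_one_left (decay_pos y).le ?_
      exact inv_le_one_of_one_le₀ (one_le_pow₀ (one_le_one_add_norm w))
    · exact continuous_compIntegrand hB ε lam u v continuous_const continuous_id
        continuous_const
  have hi2 : Integrable fun p : Conf d × Conf d => compIntegrand ε lam B u v q p.1 p.2 :=
    integrable_of_decay_prod (continuous_compIntegrand hB ε lam u v continuous_const
      continuous_fst continuous_snd) fun p => hb q p.1 p.2
  have hki : Integrable k := hi2.integral_prod_left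
  -- The product at $(q,\xi)$ is a double integral over $y$ and $z$ whose $\xi$-dependence is
  -- $e^{i(y+z)\cdot\xi}$. With $w=y+z$ it becomes a Fourier transform in $w$, which is inverted
  -- below.
  have hF : ∀ ξ, ∫ w, cis (inner ℝ ξ w) * k w =
      (((2 * Real.pi) ^ (2 * d) : ℝ) : ℂ) * weylProd hε lam B u v (q, ξ) := by
    intro ξ
    have hs : Integrable fun p : Conf d × Conf d =>
        cis (inner ℝ ξ p.2) * compIntegrand ε lam B u v q p.2 p.1 :=
      integrable_cis_mul (θ := fun p : Conf d × Conf d => inner ℝ ξ p.2) (by fun_prop) hi2.swap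
    have hmp : MeasurePreserving (fun p : Conf d × Conf d => (p.1, p.1 + p.2)) :=
      measurePreserving_prod_add volume volume
    have hi3 := hmp.integrable_comp_of_integrable hs
    rw [weylProd_eq_partialFourier hB hε lam u v (q, ξ)]
    have e : ∀ p : Conf d × Conf d, fluxExp ε lam B (q - (ε / 2) • (p.1 + p.2))
          (q + (ε / 2) • (p.1 - p.2)) (q + (ε / 2) • (p.1 + p.2)) *
          cis (inner ℝ (p.1 + p.2) ξ) *
          (partialFourier u (q - (ε / 2) • p.2) p.1 * partialFourier v (q + (ε / 2) • p.1) p.2) =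
        cis (inner ℝ ξ (p.1 + p.2)) * compIntegrand ε lam B u v q (p.1 + p.2) p.1 := by
      intro p
      have e1 : q - (ε / 2) • (p.1 + p.2) + ε • p.1 = q + (ε / 2) • (p.1 - p.2) := by module
      have e2 : q + (ε / 2) • (p.1 - (p.1 + p.2)) = q - (ε / 2) • p.2 := by module
      rw [compIntegrand, e1, e2, add_sub_cancel_left, real_inner_comm ξ]
      ring
    simp only [e]
    calc ∫ w, cis (inner ℝ ξ w) * k w
        = ∫ w, ∫ y, cis (inner ℝ ξ w) * compIntegrand ε lam B u v q w y := by
          simp only [hk, integral_const_mul]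
      _ = ∫ y, ∫ w, cis (inner ℝ ξ w) * compIntegrand ε lam B u v q w y :=
          integral_integral_swap (f := fun w y =>
            cis (inner ℝ ξ w) * compIntegrand ε lam B u v q w y) hs.swap
      _ = ∫ y, ∫ z, cis (inner ℝ ξ (y + z)) * compIntegrand ε lam B u v q (y + z) y := by
          refine integral_congr_ae (Eventually.of_forall fun y => ?_)
          exact (integral_add_left_eq_self (fun w =>
            cis (inner ℝ ξ w) * compIntegrand ε lam B u v q w y) y).symm
      _ = _ := (integral_prod _ hi3).symm
  obtain ⟨ψ, hψ⟩ := exists_schwartz_weylProd hB hε lam u v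
  have hi' : Integrable fun ξ => weylProd hε lam B u v (q, ξ) := by
    obtain ⟨C', -, h'⟩ := norm_schwartz_le ψ 0
    rw [← hψ]
    exact OscPhase.integrable_of_decay (ψ.continuous.comp (by fun_prop)) (C := C') fun ξ => by
      simpa using h' q ξ
  have key := fourier_inversion hkc hki (by
    simp only [hF]
    exact hi'.const_mul _) w
  simp only [hF] at key
  have h2 : (((2 * Real.pi) ^ (2 * d) : ℝ) : ℂ) =
      (((2 * Real.pi) ^ d : ℝ) : ℂ) * (((2 * Real.pi) ^ d : ℝ) : ℂ) := by
    rw [two_mul d, pow_add, Complex.ofReal_mul]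
  refine mul_left_cancel₀ (two_pi_pow_ne_zero d) ?_
  rw [← key, ← mul_assoc, ← h2, partialFourier, ← integral_const_mul]
  refine integral_congr_ae (Eventually.of_forall fun ξ => ?_)
  beta_reduce
  rw [real_inner_comm w ξ]
  ring

/-- Stokes' theorem for the triangle with corners $\varepsilon x$, $\varepsilon(x+y)$,
$\varepsilon(x+w)$: going along two sides differs from the third by the flux. This is where the
potential disappears from the product. -/
lemma transport_mul (hA : IsVectorPotential A B) (x y w : Conf d) :
    transport ε lam A x y * transport ε lam A (x + y) (w - y) =
      transport ε lam A x w * fluxExp ε lam B (ε • x) (ε • (x + y)) (ε • (x + w)) := by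
  simp only [transport, fluxExp, scaledCirculation, ← cis_add, flux_eq_circulation hA]
  rw [show x + y + (w - y) = x + w by abel]
  congr 1
  ring

/-- Composition of magnetic Weyl quantizations of Schwartz functions. -/
lemma quantFun_comp_of_schwartz (hB : ∀ l j, IsBCInfty (B l j)) (hA : IsVectorPotential A B)
    (hε : 0 < ε) (lam : ℝ) (u v : 𝓢(Phase d, ℂ)) {T : 𝓢(Conf d, ℂ) → 𝓢(Conf d, ℂ)}
    (hT : ∀ φ x, T φ x = quantFun ε lam A v φ x) (φ : 𝓢(Conf d, ℂ)) (x : Conf d) :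
    quantFun ε lam A u (T φ) x = quantFun ε lam A (weylProd hε lam B u v) φ x := by
  obtain ⟨ψ, hψ⟩ := exists_schwartz_weylProd hB hε lam u v
  obtain ⟨C, hC, hb⟩ := exists_compIntegrand_le ε lam B u v
  have hc := two_pi_pow_ne_zero d
  set F : Conf d → Conf d → ℂ := fun w y => transport ε lam A x w * φ (x + w) *
    compIntegrand ε lam B u v (ε • (x + (2 : ℝ)⁻¹ • w)) w y with hF
  have hFi : Integrable fun p : Conf d × Conf d => F p.1 p.2 := by
    refine integrable_of_decay_prod (C := schwartzNorm 0 0 φ * C) ?_ fun p => ?_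
    · have h1 : Continuous fun p : Conf d × Conf d => transport ε lam A x p.1 := by
        simpa only [Function.comp_def] using (continuous_transport hA.1 ε lam).comp
          (by fun_prop : Continuous fun p : Conf d × Conf d => (x, p.1))
      exact (h1.mul (φ.continuous.comp (by fun_prop))).mul
        (continuous_compIntegrand hB ε lam u v (by fun_prop) continuous_fst continuous_snd)
    · rw [hF, norm_mul, norm_mul, norm_transport, one_mul, mul_assoc]
      exact mul_le_mul (norm_schwartz_le_schwartzNorm φ _) (hb _ _ _) (norm_nonneg _)
        (schwartzNorm_nonneg _ _ _)
  refine mul_left_cancel₀ hc (mul_left_cancel₀ hc ?_)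
  rw [quantFun_eq_integral hA.1 hε lam u (T φ) x, ← hψ, quantFun_eq_integral hA.1 hε lam ψ φ x, hψ,
    ← integral_const_mul, ← integral_const_mul]
  have hl : ∀ y, (((2 * Real.pi) ^ d : ℝ) : ℂ) * (transport ε lam A x y * T φ (x + y) *
      partialFourier u (ε • (x + (2 : ℝ)⁻¹ • y)) y) = ∫ w, F w y := by
    intro y
    have h1 := quantFun_eq_integral hA.1 hε lam v φ (x + y)
    -- The inner variable becomes the total displacement from `x`, so that the endpoint $x+w$ no
    -- longer depends on `y`.
    rw [← hT, ← integral_sub_right_eq_self _ y] at h1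
    calc _ = transport ε lam A x y * partialFourier u (ε • (x + (2 : ℝ)⁻¹ • y)) y *
        ((((2 * Real.pi) ^ d : ℝ) : ℂ) * T φ (x + y)) := by ring
      _ = _ := by
        rw [h1, ← integral_const_mul]
        refine integral_congr_ae (Eventually.of_forall fun w => ?_)
        have h2 := transport_mul (ε := ε) (lam := lam) hA x y w
        simp only [hF, compIntegrand]
        rw [show ε • (x + (2 : ℝ)⁻¹ • w) - (ε / 2) • w = ε • x by module,
          show ε • x + ε • y = ε • (x + y) by module,
          show ε • (x + (2 : ℝ)⁻¹ • w) + (ε / 2) • w = ε • (x + w) by module,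
          show ε • (x + (2 : ℝ)⁻¹ • w) + (ε / 2) • (y - w) = ε • (x + (2 : ℝ)⁻¹ • y) by module,
          show ε • (x + (2 : ℝ)⁻¹ • w) + (ε / 2) • y =
            ε • (x + y + (2 : ℝ)⁻¹ • (w - y)) by module,
          show x + y + (w - y) = x + w by abel]
        linear_combination partialFourier u (ε • (x + (2 : ℝ)⁻¹ • y)) y * φ (x + w) *
          partialFourier v (ε • (x + y + (2 : ℝ)⁻¹ • (w - y))) (w - y) * h2
  simp only [hl]
  rw [← integral_integral_swap (f := F) hFi]
  refine integral_congr_ae (Eventually.of_forall fun w => ?_)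
  simp only [hF]
  rw [integral_const_mul, ← partialFourier_weylProd hB hε lam u v]
  ring

end Composition

/-! ### Composition for functions of polynomial growth. -/

section CompositionLimit

variable {d : ℕ} {ε lam : ℝ} {A : Fin d → Conf d → ℝ} {B : Fin d → Fin d → Conf d → ℝ}
  {f g : Phase d → ℂ} {M M₁ M₂ : ℕ}

lemma isAmp_one_mul_pow_of_le
    (hf : IsAmp (ContinuousLinearMap.id ℝ _) (fun _ (_ : Unit) X => (1 + ‖X‖) ^ M₁) fun _ => f)
    (h : M₁ ≤ M₂) : IsAmp (ContinuousLinearMap.id ℝ _)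
      (fun _ (_ : Unit) X => 1 * (1 + ‖X‖) ^ M₂) fun _ => f :=
  hf.mono (fun _ _ X => by positivity) fun _ => ⟨1, fun _ X => by
    rw [one_mul, one_mul]
    exact pow_le_pow_right₀ (one_le_one_add_norm X) h⟩

lemma quantFun_map_sub (hA : ∀ l, (A l).HasTemperateGrowth) (ε lam : ℝ)
    (hf : IsAmp (ContinuousLinearMap.id ℝ _) (fun _ (_ : Unit) X => (1 + ‖X‖) ^ M) fun _ => f)
    (φ ψ : 𝓢(Conf d, ℂ)) (x : Conf d) : quantFun ε lam A f (φ - ψ : 𝓢(Conf d, ℂ)) x =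
      quantFun ε lam A f φ x - quantFun ε lam A f ψ x := by
  obtain ⟨T, hT⟩ := exists_quantOp hA ε lam (isAmp_one_mul_pow_of_le hf le_rfl)
  rw [← hT, ← hT, ← hT, map_sub, sub_apply]

/-- Magnetic Weyl quantization turns the magnetic Weyl product into composition. -/
lemma quantFun_comp (hB : ∀ l j, IsBCInfty (B l j)) (hA : IsVectorPotential A B)
    (hε : 0 < ε) (lam : ℝ)
    (hf : IsAmp (ContinuousLinearMap.id ℝ _) (fun _ (_ : Unit) X => (1 + ‖X‖) ^ M₁) fun _ => f)
    (hg : IsAmp (ContinuousLinearMap.id ℝ _) (fun _ (_ : Unit) X => (1 + ‖X‖) ^ M₂) fun _ => g)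
    {T : 𝓢(Conf d, ℂ) → 𝓢(Conf d, ℂ)} (hT : ∀ φ x, T φ x = quantFun ε lam A g φ x)
    (φ : 𝓢(Conf d, ℂ)) (x : Conf d) :
    quantFun ε lam A f (T φ) x = quantFun ε lam A (weylProd hε lam B f g) φ x := by
  set χ := stdCutoff (Phase d) with hχd
  have hχ : χ 0 = 1 := stdCutoff_zero _
  have hp : ∀ (M : ℕ) (X : Phase d), 0 ≤ (1 + ‖X‖) ^ M := fun M X => by positivity
  have f1 := isAmp_regularize_sub hf (hp M₁) hχ
  have g1 := isAmp_regularize_sub hg (hp M₂) hχ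
  have g2 := isAmp_regularize hg (hp M₂) hχ
  simp only [← pow_succ'] at f1 g1 g2
  have g3 : IsAmp (ContinuousLinearMap.id ℝ _)
      (fun _ (_ : Set.Ioc (0 : ℝ) 1) X => 1 * (1 + ‖X‖) ^ (M₂ + 1))
      fun δ X => regularize χ δ g X := by simpa only [one_mul] using g2
  have hδ0 : ∀ δ : Set.Ioc (0 : ℝ) 1, (0 : ℝ) ≤ δ := fun δ => δ.2.1.le
  -- The regularized operators for `g` are bounded between Schwartz seminorms uniformly in `δ`,
  -- which allows the first factor to vary at the same time.
  choose S hS using fun δ : Set.Ioc (0 : ℝ) 1 =>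
    exists_quantOp hA.1 ε lam (g3.reindex fun _ : Unit => δ)
  obtain ⟨C₁, K₁, k₁, h₁, hb₁⟩ := exists_norm_quantFun_le hA.1 ε lam f1 hδ0
  obtain ⟨C₂, K₂, k₂, h₂, hb₂⟩ := exists_schwartzNorm_quantOp_le hA.1 ε lam g3
    (fun _ => zero_le_one) (T := fun δ φ => S δ φ) hS K₁ k₁
  obtain ⟨C₃, K₃, k₃, h₃, hb₃⟩ := exists_norm_quantFun_le hA.1 ε lam
    (isAmp_one_mul_pow_of_le hf le_rfl) (fun _ => zero_le_one)
  obtain ⟨C₄, K₄, k₄, h₄, hb₄⟩ := exists_schwartzNorm_quantOp_le hA.1 ε lam g1 hδ0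
    (T := fun δ φ => S δ φ - T φ) (fun δ φ x => by
      rw [sub_apply, hS, hT, quantFun_sub hA.1 ε lam (g3.reindex fun _ : Unit => δ)
        (isAmp_one_mul_pow_of_le hg (Nat.le_succ _))]) K₃ k₃
  have hlim : Tendsto (fun δ => quantFun ε lam A (weylProd hε lam B (regularize χ δ f)
      (regularize χ δ g)) φ x) (𝓝[>] 0) (𝓝 (quantFun ε lam A f (T φ) x)) := by
    rw [tendsto_iff_norm_sub_tendsto_zero]
    refine squeeze_zero' (Eventually.of_forall fun _ => norm_nonneg _)
      (g := fun δ => (C₁ * (C₂ * schwartzNorm K₂ k₂ φ) + C₃ * (C₄ * schwartzNorm K₄ k₄ φ)) * δ) ?_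
      (tendsto_mul_const_nhdsGT _)
    filter_upwards [Ioc_mem_nhdsGT zero_lt_one] with δ hδ
    obtain ⟨u, hu⟩ := exists_schwartz_regularize hf χ hδ.1
    obtain ⟨v, hv⟩ := exists_schwartz_regularize hg χ hδ.1
    have e1 := quantFun_comp_of_schwartz hB hA hε lam u v (T := fun φ => S ⟨δ, hδ⟩ φ)
      (fun φ x => by rw [hv]; exact hS ⟨δ, hδ⟩ φ x) φ x
    rw [hu, hv] at e1
    have f2 : IsAmp (ContinuousLinearMap.id ℝ _)
        (fun _ (_ : Unit) X => 1 * (1 + ‖X‖) ^ (M₁ + 1)) fun _ => regularize χ δ f := by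
      have h := (isAmp_regularize hf (hp M₁) hχ).reindex
        fun _ : Unit => (⟨δ, hδ⟩ : Set.Ioc (0 : ℝ) 1)
      simpa only [← pow_succ', one_mul] using h
    have e2 := quantFun_sub hA.1 ε lam f2 (isAmp_one_mul_pow_of_le hf (Nat.le_succ _))
      (S ⟨δ, hδ⟩ φ) x
    have e3 := quantFun_map_sub hA.1 ε lam hf (S ⟨δ, hδ⟩ φ) (T φ) x
    -- The first term is small because the symbol error is, acting on uniformly bounded functions;
    -- the second because $S_\delta\varphi-T\varphi$ is small in a seminorm on which
    -- $\mathrm{Op}(f)$ is continuous.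
    have e4 : quantFun ε lam A (regularize χ δ f) (S ⟨δ, hδ⟩ φ) x - quantFun ε lam A f (T φ) x =
        quantFun ε lam A (fun X => regularize χ δ f X - f X) (S ⟨δ, hδ⟩ φ) x +
          quantFun ε lam A f (S ⟨δ, hδ⟩ φ - T φ : 𝓢(Conf d, ℂ)) x := by
      rw [e2, e3]; ring
    rw [← e1, e4]
    refine (norm_add_le _ _).trans ?_
    have b1 := hb₁ ⟨δ, hδ⟩ (S ⟨δ, hδ⟩ φ) x
    have b2 := hb₂ ⟨δ, hδ⟩ φ
    have b3 := hb₃ () (S ⟨δ, hδ⟩ φ - T φ) x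
    have b4 := hb₄ ⟨δ, hδ⟩ φ
    rw [one_mul] at b2 b3
    calc _ ≤ C₁ * (δ * (C₂ * schwartzNorm K₂ k₂ φ)) + C₃ * (C₄ * (δ * schwartzNorm K₄ k₄ φ)) :=
        add_le_add (b1.trans (mul_le_mul_of_nonneg_left
          (mul_le_mul_of_nonneg_left b2 hδ.1.le) h₁))
          (b3.trans (mul_le_mul_of_nonneg_left b4 h₃))
      _ = _ := by ring
  have hfg := (isAmp_weylProd hB hε lam hf (isModerate_pow M₁) hg (isModerate_pow M₂)).mono
    (W' := fun _ _ X => (1 + ‖X‖) ^ (M₁ + M₂)) (fun _ _ X => by positivity)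
    fun _ => ⟨1, fun _ X => le_of_eq (by ring)⟩
  exact tendsto_nhds_unique hlim (tendsto_quantFun hA.1 ε lam
    (fδ := fun δ => weylProd hε lam B (regularize χ δ f) (regularize χ δ g))
    (isAmp_one_mul_pow_of_le hfg (Nat.le_add_right _ 2))
    (isAmp_weylProd_regularize_sub hB hε lam hf hg hχ hχ) φ x)

end CompositionLimit

/-! ### The trace identity. -/

section Trace

open OscPhase (decay decayExp integrable_decay decay_pos)

variable {d : ℕ} {ε lam : ℝ} {B : Fin d → Fin d → Conf d → ℝ}

lemma integrable_slice (u : 𝓢(Phase d, ℂ)) (q : Conf d) : Integrable fun ξ => u (q, ξ) := by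
  obtain ⟨C, -, h⟩ := norm_schwartz_le u 0
  exact OscPhase.integrable_of_decay (u.continuous.comp (by fun_prop)) (C := C) fun ξ => by
    simpa using h q ξ

lemma continuous_partialFourier_neg (u : 𝓢(Phase d, ℂ)) (q : Conf d) :
    Continuous fun y => partialFourier u q (-y) := by
  simpa only [Function.comp_def] using (continuous_partialFourier u).comp
    (by fun_prop : Continuous fun y : Conf d => (q, -y))

lemma integrable_partialFourier_neg (u : 𝓢(Phase d, ℂ)) (q : Conf d) :
    Integrable fun y => partialFourier u q (-y) := by
  obtain ⟨C, -, h⟩ := exists_partialFourier_le u 0 (decayExp (Conf d))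
  exact OscPhase.integrable_of_decay (continuous_partialFourier_neg u q) fun y => by
    simpa [decay] using h q (-y)

lemma integral_partialFourier_neg (u : 𝓢(Phase d, ℂ)) (q ξ : Conf d) :
    ∫ y, cis (-inner ℝ y ξ) * partialFourier u q (-y) =
      (((2 * Real.pi) ^ d : ℝ) : ℂ) * u (q, ξ) := by
  have e : ∀ y, ∫ η, cis (inner ℝ y η) * u (q, η) = partialFourier u q (-y) := fun y => by
    simp only [partialFourier, inner_neg_left, neg_neg]
  have h := fourier_inversion (v := fun ξ => u (q, ξ)) (u.continuous.comp (by fun_prop))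
    (integrable_slice u q) (by simpa only [e] using integrable_partialFourier_neg u q) ξ
  simpa only [e] using h

/-- Parseval's identity in the momentum variable. -/
lemma integral_partialFourier_mul (u v : 𝓢(Phase d, ℂ)) (q : Conf d) :
    ∫ y, partialFourier u q y * partialFourier v q (-y) =
      (((2 * Real.pi) ^ d : ℝ) : ℂ) * ∫ ξ, u (q, ξ) * v (q, ξ) := by
  have hi : Integrable fun p : Conf d × Conf d =>
      cis (-inner ℝ p.1 p.2) * (partialFourier v q (-p.1) * u (q, p.2)) :=
    integrable_cis_mul (θ := fun p : Conf d × Conf d => -inner ℝ p.1 p.2) (by fun_prop)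
      ((integrable_partialFourier_neg v q).mul_prod (integrable_slice u q))
  calc _ = ∫ y, ∫ ξ, cis (-inner ℝ y ξ) * (partialFourier v q (-y) * u (q, ξ)) := by
        refine integral_congr_ae (Eventually.of_forall fun y => ?_)
        beta_reduce
        rw [partialFourier, ← integral_mul_const]
        refine integral_congr_ae (Eventually.of_forall fun ξ => ?_)
        beta_reduce
        ring
    _ = ∫ ξ, ∫ y, cis (-inner ℝ y ξ) * (partialFourier v q (-y) * u (q, ξ)) :=
        integral_integral_swap (f := fun y ξ =>
          cis (-inner ℝ y ξ) * (partialFourier v q (-y) * u (q, ξ))) hi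
    _ = _ := by
        rw [← integral_const_mul]
        refine integral_congr_ae (Eventually.of_forall fun ξ => ?_)
        simp only [← mul_assoc]
        rw [integral_mul_const, integral_partialFourier_neg]
        ring

/-- A degenerate triangle carries no flux. On the diagonal $w=0$ of the composed kernel the magnetic
field therefore drops out. -/
lemma fluxExp_self_right (x y : Conf d) : fluxExp ε lam B x y x = 1 := by
  simp [fluxExp, flux, cis]

/-- The magnetic Weyl product has the trace property. -/
lemma integral_weylProd (hB : ∀ l j, IsBCInfty (B l j)) (hε : 0 < ε) (lam : ℝ)
    (u v : 𝓢(Phase d, ℂ)) : ∫ X, weylProd hε lam B u v X = ∫ X, u X * v X := by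
  obtain ⟨ψ, hψ⟩ := exists_schwartz_weylProd hB hε lam u v
  set G : Conf d → Conf d → ℂ := fun q y => partialFourier u q y * partialFourier v q (-y) with hG
  have hGi : Integrable fun p : Conf d × Conf d => G p.1 p.2 := by
    obtain ⟨C₁, h₁, hu⟩ := exists_partialFourier_le u (decayExp (Conf d)) (decayExp (Conf d))
    obtain ⟨C₂, h₂, hv⟩ := exists_partialFourier_le v 0 0
    refine integrable_of_decay_prod (C := C₁ * C₂) ?_ fun p => ?_
    · refine (continuous_partialFourier u).mul ?_
      simpa only [Function.comp_def] using (continuous_partialFourier v).comp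
        (by fun_prop : Continuous fun p : Conf d × Conf d => (p.1, -p.2))
    · have e1 := hu p.1 p.2
      have e2 := hv p.1 (-p.2)
      simp only [pow_zero, inv_one, mul_one] at e2
      rw [hG, norm_mul]
      refine (mul_le_mul e1 e2 (norm_nonneg _)
        (mul_nonneg h₁ (by positivity))).trans (le_of_eq ?_)
      simp only [decay]
      ring
  -- The base point $q+\frac\varepsilon2y$ is undone by a shear, which preserves the measure; this
  -- gives the integrability needed for Fubini.
  have hs : MeasurePreserving (fun p : Conf d × Conf d => (p.1, p.2 + (ε / 2) • p.1)) :=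
    (MeasurePreserving.id volume).skew_product (g := fun y q => q + (ε / 2) • y)
      (by fun_prop) (Eventually.of_forall fun y =>
        (measurePreserving_add_right volume ((ε / 2) • y)).map_eq)
  have hGs : Integrable fun p : Conf d × Conf d => G (p.2 + (ε / 2) • p.1) p.1 :=
    hs.integrable_comp_of_integrable hGi.swap
  have h1 : ∀ q, (((2 * Real.pi) ^ d : ℝ) : ℂ) * ∫ ξ, weylProd hε lam B u v (q, ξ) =
      ∫ y, G (q + (ε / 2) • y) y := by
    intro q
    have h := partialFourier_weylProd hB hε lam u v q 0
    simp only [partialFourier, inner_zero_left, neg_zero, cis_zero, one_mul] at h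
    rw [h]
    refine integral_congr_ae (Eventually.of_forall fun y => ?_)
    simp only [compIntegrand, smul_zero, sub_zero, add_zero, zero_sub, fluxExp_self_right, one_mul,
      hG]
  refine mul_left_cancel₀ (two_pi_pow_ne_zero d) ?_
  have hi1 : Integrable (weylProd hε lam B u v) := by
    rw [← hψ]; exact SchwartzMap.integrable ψ
  have hi2 : Integrable fun X => u X * v X := by
    obtain ⟨C, hC⟩ := schwartz_decay v 0 0
    refine (SchwartzMap.integrable u).mul_bdd (c := C) v.continuous.aestronglyMeasurable
      (Eventually.of_forall fun X => ?_)
    simpa using hC X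
  calc (((2 * Real.pi) ^ d : ℝ) : ℂ) * ∫ X, weylProd hε lam B u v X
      = (((2 * Real.pi) ^ d : ℝ) : ℂ) * ∫ q, ∫ ξ, weylProd hε lam B u v (q, ξ) :=
        congrArg _ (integral_prod _ hi1)
    _ = ∫ q, ∫ y, G (q + (ε / 2) • y) y := by rw [← integral_const_mul]; simp only [h1]
    _ = ∫ y, ∫ q, G (q + (ε / 2) • y) y :=
        integral_integral_swap (f := fun q y => G (q + (ε / 2) • y) y) hGs.swap
    _ = ∫ y, ∫ q, G q y := by
        refine integral_congr_ae (Eventually.of_forall fun y => ?_)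
        exact integral_add_right_eq_self (fun q => G q y) ((ε / 2) • y)
    _ = ∫ q, ∫ y, G q y := (integral_integral_swap (f := G) hGi).symm
    _ = (((2 * Real.pi) ^ d : ℝ) : ℂ) * ∫ q, ∫ ξ, u (q, ξ) * v (q, ξ) := by
        rw [← integral_const_mul]; simp only [hG, integral_partialFourier_mul]
    _ = _ := congrArg _ (integral_prod (fun X : Phase d => u X * v X) hi2).symm

end Trace

/-! ### Injectivity of the quantization, and uniqueness of the product. -/

section Uniqueness

open OscPhase (decay decayExp integrable_decay decay_pos)

variable {d : ℕ} {ε lam : ℝ} {A : Fin d → Conf d → ℝ} {B : Fin d → Fin d → Conf d → ℝ}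

lemma eq_zero_of_integral_schwartz_mul {E : Type*} [NormedAddCommGroup E] [NormedSpace ℝ E]
    [FiniteDimensional ℝ E] [MeasureSpace E] [BorelSpace E]
    [(volume : Measure E).IsAddHaarMeasure] {f : E → ℂ} (hf : Continuous f)
    (h : ∀ φ : 𝓢(E, ℂ), ∫ x, φ x * f x = 0) (x : E) : f x = 0 := by
  have h1 := ae_eq_zero_of_integral_contDiff_smul_eq_zero hf.locallyIntegrable
    (μ := (volume : Measure E)) fun g hg hs => by
      have hc : HasCompactSupport fun x => (g x : ℂ) := hs.comp_left Complex.ofReal_zero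
      refine Eq.trans ?_ (h (hc.toSchwartzMap (Complex.ofRealCLM.contDiff.comp hg)))
      simp only [Complex.real_smul]
      rfl
  exact congrFun (Continuous.ae_eq_iff_eq volume hf continuous_const |>.1 h1) x

/-- Magnetic Weyl quantization is injective on Schwartz functions. -/
lemma eq_zero_of_quantFun_schwartz (hA : ∀ l, (A l).HasTemperateGrowth) (hε : 0 < ε) (lam : ℝ)
    (u : 𝓢(Phase d, ℂ)) (h : ∀ (φ : 𝓢(Conf d, ℂ)) x, quantFun ε lam A u φ x = 0) : u = 0 := by
  have hpF : ∀ q y, partialFourier u q y = 0 := by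
    intro q y
    -- Chosen so that the midpoint $\varepsilon(x+\frac12y)$ is `q`. The kernel is continuous and
    -- annihilates every Schwartz function, hence vanishes at this point, and the transport factor
    -- is not zero.
    set x : Conf d := ε⁻¹ • q - (2 : ℝ)⁻¹ • y with hx
    have hc : Continuous fun z => transport ε lam A x (z - x) *
        partialFourier u (ε • (x + (2 : ℝ)⁻¹ • (z - x))) (z - x) := by
      have h1 : Continuous fun z => transport ε lam A x (z - x) := by
        simpa only [Function.comp_def] using (continuous_transport hA ε lam).comp
          (by fun_prop : Continuous fun z : Conf d => (x, z - x))
      have h2 : Continuous fun z =>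
          partialFourier u (ε • (x + (2 : ℝ)⁻¹ • (z - x))) (z - x) := by
        simpa only [Function.comp_def] using (continuous_partialFourier u).comp
          (by fun_prop : Continuous fun z : Conf d => (ε • (x + (2 : ℝ)⁻¹ • (z - x)), z - x))
      exact h1.mul h2
    have h3 := eq_zero_of_integral_schwartz_mul hc (fun φ => by
      have h4 := quantFun_eq_integral hA hε lam u φ x
      rw [h, mul_zero, ← integral_sub_right_eq_self _ x] at h4
      rw [h4]
      refine integral_congr_ae (Eventually.of_forall fun z => ?_)
      simp only [add_sub_cancel]
      ring) (x + y)
    rw [add_sub_cancel_left] at h3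
    have h5 := (mul_eq_zero.1 h3).resolve_left (norm_ne_zero_iff.1 (by
      rw [norm_transport]; exact one_ne_zero))
    have h6 : ε • (x + (2 : ℝ)⁻¹ • y) = q := by
      rw [hx, sub_add_cancel, smul_smul, mul_inv_cancel₀ hε.ne', one_smul]
    rwa [h6] at h5
  ext X
  have h := integral_partialFourier_neg u X.1 X.2
  simp only [hpF, mul_zero, integral_zero] at h
  exact (mul_eq_zero.1 h.symm).resolve_left (two_pi_pow_ne_zero d)

/-- Magnetic Weyl quantization is injective on functions of polynomial growth. -/
lemma eq_zero_of_quantFun (hB : ∀ l j, IsBCInfty (B l j)) (hA : IsVectorPotential A B)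
    (hε : 0 < ε) (lam : ℝ) {u : Phase d → ℂ} {M : ℕ}
    (hu : IsAmp (ContinuousLinearMap.id ℝ _) (fun _ (_ : Unit) X => (1 + ‖X‖) ^ M) fun _ => u)
    (h : ∀ (φ : 𝓢(Conf d, ℂ)) x, quantFun ε lam A u φ x = 0) (X : Phase d) : u X = 0 := by
  refine eq_zero_of_integral_schwartz_mul (hu.smooth ()).continuous (fun v => ?_) X
  have hv : ∀ K : ℕ, IsAmp (ContinuousLinearMap.id ℝ _)
      (fun _ (_ : Unit) X => ((1 + ‖X‖) ^ K)⁻¹) fun _ => v := fun K => isAmp_schwartz _ v K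
  -- The Schwartz decay of `v` beats the growth of `u`, so the product is Schwartz; its quantization
  -- is the composition of a vanishing operator with another one.
  have hzero : ∀ X, weylProd hε lam B u v X = 0 := by
    obtain ⟨ψ, hψ⟩ : ∃ ψ : 𝓢(Phase d, ℂ), ⇑ψ = weylProd hε lam B u v := by
      refine exists_schwartz_of_isAmp fun K => ?_
      refine (isAmp_weylProd hB hε lam hu (isModerate_pow M) (hv (M + K))
        (isModerate_pow_inv (M + K))).mono (fun _ _ X => by positivity)
        fun _ => ⟨1, fun _ X => le_of_eq ?_⟩
      have : (1 + ‖X‖) ^ M ≠ 0 := by positivity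
      rw [pow_add]
      field_simp
    have hv0 : IsAmp (ContinuousLinearMap.id ℝ _)
        (fun _ (_ : Unit) X => (1 + ‖X‖) ^ 0) fun _ => v := by simpa using hv 0
    obtain ⟨T, hT⟩ := exists_quantOp hA.1 ε lam (isAmp_one_mul_pow_of_le hv0 le_rfl)
    have h0 := eq_zero_of_quantFun_schwartz hA.1 hε lam ψ fun φ x => by
      rw [hψ, ← quantFun_comp hB hA hε lam hu hv0 hT φ x, h]
    intro X
    rw [← hψ, h0]
    rfl
  set χ := stdCutoff (Phase d) with hχd
  have hχ : χ 0 = 1 := stdCutoff_zero _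
  have f1 := isAmp_regularize_sub hu (fun X => by positivity) hχ
  have f2 := isAmp_regularize hu (fun X => by positivity) hχ
  simp only [← pow_succ'] at f1 f2
  have hδ : ∀ δ : Set.Ioc (0 : ℝ) 1, (0 : ℝ) ≤ δ := fun δ => δ.2.1.le
  -- The decay requested of `v` is just what cancels the growth of the error and leaves an
  -- integrable weight.
  have hcancel : ∀ (δ : ℝ) (X : Phase d),
      δ * (1 + ‖X‖) ^ (M + 1) * ((1 + ‖X‖) ^ (M + 1 + decayExp (Phase d)))⁻¹ = δ * decay X := by
    intro δ X
    have : (1 + ‖X‖) ^ (M + 1) ≠ 0 := by positivity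
    rw [decay, pow_add _ (M + 1)]
    field_simp
  have hvr := (hv (M + 1 + decayExp (Phase d))).reindex fun _ : Set.Ioc (0 : ℝ) 1 => ()
  obtain ⟨C₁, h₁, hb₁⟩ := (isAmp_weylProd hB hε lam f1 ((isModerate_pow (M + 1)).const_mul hδ) hvr
    (isModerate_pow_inv (M + 1 + decayExp (Phase d)))).bound
    fun _ δ X => mul_nonneg (mul_nonneg (hδ δ) (by positivity)) (by positivity)
  obtain ⟨C₂, h₂, hb₂⟩ := (f1.mul hvr (W₃ := fun _ (δ : Set.Ioc (0 : ℝ) 1) X =>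
    δ * (1 + ‖X‖) ^ (M + 1) * ((1 + ‖X‖) ^ (M + 1 + decayExp (Phase d)))⁻¹)
    (fun _ δ X => mul_nonneg (hδ δ) (by positivity)) (fun _ _ X => by positivity)
    fun j k => ⟨1, fun δ X => by rw [one_mul]⟩).bound
    fun _ δ X => mul_nonneg (mul_nonneg (hδ δ) (by positivity)) (by positivity)
  simp only [hcancel] at hb₁ hb₂
  have hint : ∀ (F : Phase d → ℂ) (C δ : ℝ), (∀ X, ‖F X‖ ≤ C * (δ * decay X)) →
      ‖∫ X, F X‖ ≤ C * δ * ∫ X : Phase d, decay X := by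
    intro F C δ hF
    rw [← integral_const_mul]
    refine norm_integral_le_of_norm_le (integrable_decay.const_mul _)
      (Eventually.of_forall fun X => (hF X).trans (le_of_eq (by ring)))
  have hmain : ∀ δ ∈ Set.Ioc (0 : ℝ) 1, ‖∫ X, v X * u X‖ ≤
      (C₁ + C₂) * (∫ X : Phase d, decay X) * δ := by
    intro δ hδ'
    obtain ⟨w, hw⟩ := exists_schwartz_regularize hu χ hδ'.1
    have hu' : IsAmp (ContinuousLinearMap.id ℝ _)
        (fun _ (_ : Unit) X => (1 + ‖X‖) ^ (M + 1)) fun _ => u := by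
      simpa only [one_mul] using isAmp_one_mul_pow_of_le hu (Nat.le_succ M)
    have e1 : ∀ X, weylProd hε lam B (fun X => regularize χ δ u X - u X) v X =
        weylProd hε lam B w v X := fun X => by
      rw [weylProd_sub_left hB hε lam (f2.reindex fun _ : Unit => (⟨δ, hδ'⟩ : Set.Ioc (0 : ℝ) 1))
        hu' (isModerate_pow (M + 1)) (hv 0) (isModerate_pow_inv 0), hzero, sub_zero, hw]
    have b1 := hint (weylProd hε lam B w v) C₁ δ fun X => by
      rw [← e1]; exact hb₁ ⟨δ, hδ'⟩ X
    have b2 := hint (fun X => (regularize χ δ u X - u X) * v X) C₂ δ fun X => hb₂ ⟨δ, hδ'⟩ X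
    have hi1 : Integrable fun X => w X * v X := by
      obtain ⟨C, hC⟩ := schwartz_decay v 0 0
      refine (SchwartzMap.integrable w).mul_bdd (c := C) v.continuous.aestronglyMeasurable
        (Eventually.of_forall fun X => ?_)
      simpa using hC X
    have hi2 : Integrable fun X => (regularize χ δ u X - u X) * v X := by
      refine OscPhase.integrable_of_decay (C := C₂ * δ) ?_ fun X =>
        (hb₂ ⟨δ, hδ'⟩ X).trans (le_of_eq (by ring))
      rw [← hw]
      exact (w.continuous.sub (hu.smooth ()).continuous).mul v.continuous
    -- The trace identity applies to the regularized `w` only. Since $u\sharp v=0$, the product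
    -- $w\sharp v$ equals $(w-u)\sharp v$, so both integrals on the right are $O(\delta)$.
    have e2 : ∫ X, v X * u X = (∫ X, weylProd hε lam B w v X) -
        ∫ X, (regularize χ δ u X - u X) * v X := by
      rw [integral_weylProd hB hε lam w v, ← integral_sub hi1 hi2]
      refine integral_congr_ae (Eventually.of_forall fun X => ?_)
      simp only [hw]
      ring
    rw [e2]
    refine (norm_sub_le _ _).trans ((add_le_add b1 b2).trans (le_of_eq ?_))
    ring
  have hle : ‖∫ X, v X * u X‖ ≤ 0 :=
    ge_of_tendsto (tendsto_mul_const_nhdsGT _) (by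
      filter_upwards [Ioc_mem_nhdsGT zero_lt_one] with δ hδ using hmain δ hδ)
  exact norm_le_zero_iff.1 hle

/-- Limits along one admissible cut-off are unique, so any operator satisfying the definition is the
oscillatory integral. -/
lemma IsQuantization.apply_eq (hA : ∀ l, (A l).HasTemperateGrowth) (hε : 0 < ε) {f : Phase d → ℂ}
    {M : ℕ}
    (hf : IsAmp (ContinuousLinearMap.id ℝ _) (fun _ (_ : Unit) X => (1 + ‖X‖) ^ M) fun _ => f)
    {T : 𝓢(Conf d, ℂ) →L[ℂ] 𝓢(Conf d, ℂ)} (h : IsQuantization ε lam A f T)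
    (φ : 𝓢(Conf d, ℂ)) (x : Conf d) : T φ x = quantFun ε lam A f φ x := by
  obtain ⟨S, hS⟩ := exists_quantOp hA ε lam (isAmp_one_mul_pow_of_le hf le_rfl)
  have h1 := (h φ x _ (stdCutoff_zero (Phase d))).2
  have h2 := (isQuantization_of_eq hA hε lam hf hS φ x _ (stdCutoff_zero (Phase d))).2
  rw [← hS]
  exact mul_left_cancel₀ (two_pi_pow_ne_zero d) (tendsto_nhds_unique h1 h2)

end Uniqueness

end MagneticWeyl

end

theorem mainTheorem5 (d : ℕ) (ε lam : ℝ) (hε : 0 < ε) (ρ : ℝ) (hρ₀ : 0 ≤ ρ) (hρ₁ : ρ ≤ 1)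
    (m₁ m₂ : ℝ) (B : Fin d → Fin d → MagneticWeyl.Conf d → ℝ)
    (hB : MagneticWeyl.IsMagneticField B) (f g : MagneticWeyl.Phase d → ℂ)
    (hf : MagneticWeyl.IsSymbol m₁ ρ f) (hg : MagneticWeyl.IsSymbol m₂ ρ g) :
    ∃ h : MagneticWeyl.Phase d → ℂ,
      MagneticWeyl.IsSymbol (m₁ + m₂) ρ h ∧
      (∀ A : Fin d → MagneticWeyl.Conf d → ℝ, MagneticWeyl.IsVectorPotential A B →
        MagneticWeyl.IsWeylProduct ε lam A f g h ∧
        ∀ (m' : ℝ) (h' : MagneticWeyl.Phase d → ℂ), MagneticWeyl.IsSymbol m' ρ h' →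
          MagneticWeyl.IsWeylProduct ε lam A f g h' → h' = h) ∧
      ∀ X : MagneticWeyl.Phase d,
        MagneticWeyl.HasFourierOscIntegral₂ (MagneticWeyl.productKernel ε lam B X) f g
          ((((2 * Real.pi) ^ (2 * d) : ℝ) : ℂ) * h X) ∧
        MagneticWeyl.HasOscIntegral (MagneticWeyl.productIntegrand ε lam B f g X)
          ((((Real.pi * ε) ^ (2 * d) : ℝ) : ℂ) * h X) := by
  have hB' := hB.1
  have hf' := hf.isAmp_pow hρ₀
  have hg' := hg.isAmp_pow hρ₀
  have hh := MagneticWeyl.isSymbol_weylProd hB' hε lam hρ₀ hf hg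
  have hh' := hh.isAmp_pow hρ₀
  refine ⟨MagneticWeyl.weylProd hε lam B f g, hh, fun A hA => ⟨?_, fun m' h' hs hw => ?_⟩,
    fun X => ⟨MagneticWeyl.hasFourierOscIntegral₂_productKernel hB' hε lam hf' hg' X,
      MagneticWeyl.hasOscIntegral_productIntegrand hB' hε lam hf' hg' X⟩⟩
  · obtain ⟨F, hF⟩ := MagneticWeyl.exists_quantOp hA.1 ε lam
      (MagneticWeyl.isAmp_one_mul_pow_of_le hf' le_rfl)
    obtain ⟨G, hG⟩ := MagneticWeyl.exists_quantOp hA.1 ε lam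
      (MagneticWeyl.isAmp_one_mul_pow_of_le hg' le_rfl)
    exact ⟨F, G, MagneticWeyl.isQuantization_of_eq hA.1 hε lam hf' hF,
      MagneticWeyl.isQuantization_of_eq hA.1 hε lam hg' hG,
      MagneticWeyl.isQuantization_of_eq hA.1 hε lam hh' fun φ x =>
        (hF (G φ) x).trans (MagneticWeyl.quantFun_comp hB' hA hε lam hf' hg' hG φ x)⟩
  · obtain ⟨F, G, hF, hG, hFG⟩ := hw
    have hs' := hs.isAmp_pow hρ₀
    -- The two candidates may have different orders; the larger growth exponent makes their
    -- difference a single function of polynomial growth, to which injectivity applies.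
    have h1 := MagneticWeyl.isAmp_one_mul_pow_of_le hs' (le_max_left _ ⌈|m₁ + m₂|⌉₊)
    have h2 := MagneticWeyl.isAmp_one_mul_pow_of_le hh' (le_max_right ⌈|m'|⌉₊ _)
    have h3 := h1.sub h2 fun _ _ X => by positivity
    simp only [one_mul] at h3
    funext X
    refine sub_eq_zero.1 (MagneticWeyl.eq_zero_of_quantFun hB' hA hε lam h3 (fun φ x => ?_) X)
    rw [MagneticWeyl.quantFun_sub hA.1 ε lam h1 h2, ← hFG.apply_eq hA.1 hε hs',
      ← MagneticWeyl.quantFun_comp hB' hA hε lam hf' hg' (hG.apply_eq hA.1 hε hg'),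
      ← hF.apply_eq hA.1 hε hf']
    exact sub_self _
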